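/- We work over $\mathbb C$. For $N\ge 0$, $d\ge 2$ let $\mathrm{Hom}_d^N$ be the set of endomorphisms of $\mathbb P^N$ given by $N+1$ homogeneous polynomials of degree $d$ without common zero. For $f\in\mathrm{Hom}_d^N$ and $n\ge1$ put $$\Sigma_n(f)=\prod_{P:\,f^n(P)=P}\bigl(w-\gamma_{f^n,P}(t)\bigr)=\sum_{i=0}^{D_n}\sum_{j=0}^{Ni}(-1)^{i+j}\sigma^{(n)}_{i,j}(f)\,w^{D_n-i}t^{Ni-j},\qquad D_n=\frac{d^{n(N+1)}-1}{d^n-1},$$ where $\gamma_{f^n,P}(t)$ is the characteristic polynomial of the differential of $f^n$ at $P$ and each $P$ is counted with its multiplicity as a fixed point of $f^n$ (the dimension of the local ring at $P$ of the fixed-point scheme of $f^n$). Let $\tau^N_{d,n}(f)$ be the collection of all $\sigma^{(m)}_{i,j}(f)$ with $1\le m\le n$, $0\le i\le D_m$, $0\le j\le Ni$. A family in $\mathrm{Hom}_d^N$ is a map $a\mapsto f_a$ from a connected topological space to $\mathrm{Hom}_d^N$ that is continuous, i.e. locally in $a$ given by polynomials whose coefficients depend continuously on $a$ (for instance, an algebraic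 or holomorphic family over a connected base). It is isospectral if $a\mapsto\tau^N_{d,n}(f_a)$ is constant for every $n$. A map $f\in\mathrm{Hom}_d^1$ is a Lattès map if there are a lattice $\Lambda\subset\mathbb C$, a nonconstant holomorphic map $\Theta:\mathbb C/\Lambda\to\mathbb P^1$ and an affine map $L(z)=\alpha z+\beta$ with $\alpha\Lambda\subseteq\Lambda$ such that $f\circ\Theta=\Theta\circ L$. Let $\eta:(\mathbb P^1)^k\to\mathrm{Sym}^k\mathbb P^1=\mathbb P^k$ be the quotient map whose $j$-th coordinate ($0\le j\le k$) is the coefficient of $T^j$ in $\prod_{i=1}^k(u_i+v_iT)$ at the point $([u_i:v_i])_{i}$. Theorem. Let $d\ge2$, let $k\geq 1$, and let $(f_a)$ be a family in $\mathrm{Hom}_d^1$ all of whose members are Lattès maps. Then for every $a$ there is exactly one self-map $F_a$ of $\mathbb P^k$ with $F_a\circ\eta=\eta\circ(f_a\times\cdots\times f_a)$ (the $k$-fold symmetric product of $f_a$); it belongs to $\mathrm{Hom}_d^k$, and $(F_a)$ is an isospectral family in $\mathrm{Hom}_d^k$. -/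

import Mathlib

open scoped LinearAlgebra.Projectivization Topology

noncomputable section

namespace IsoSym

/-- The complex projective space `ℙ^N`, with homogeneous coordinates indexed by `0, …, N`. -/
abbrev PSpace (N : ℕ) : Type := ℙ ℂ (Fin (N + 1) → ℂ)

/-- `G` is an `(N+1)`-tuple of homogeneous polynomials of degree `d` without common zero
which induces the map `f` on `ℙ^N`. -/
def IsLift {N : ℕ} (d : ℕ) (G : Fin (N + 1) → MvPolynomial (Fin (N + 1)) ℂ)
    (f : PSpace N → PSpace N) : Prop :=
  (∀ i, (G i).IsHomogeneous d) ∧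
    ∀ (v : Fin (N + 1) → ℂ) (hv : v ≠ 0),
      ∃ h : (fun i => MvPolynomial.eval v (G i)) ≠ 0,
        f (Projectivization.mk ℂ v hv) =
          Projectivization.mk ℂ (fun i => MvPolynomial.eval v (G i)) h

/-- `Hom_d^N`: the endomorphisms of `ℙ^N` of degree `d`. -/
structure HomPN (N d : ℕ) where
  /-- the map on points -/
  toFun : PSpace N → PSpace N
  /-- the map is given by homogeneous polynomials of degree `d` without common zero -/
  exists_lift : ∃ G, IsLift d G toFun

/-- A tuple of homogeneous polynomials defining `f`; it is unique up to a nonzero constant. -/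
def HomPN.lift {N d : ℕ} (f : HomPN N d) : Fin (N + 1) → MvPolynomial (Fin (N + 1)) ℂ :=
  f.exists_lift.choose

/-- The `n`-th iterate of a tuple of polynomials, under composition. -/
def iterLift {N : ℕ} (G : Fin (N + 1) → MvPolynomial (Fin (N + 1)) ℂ) :
    ℕ → Fin (N + 1) → MvPolynomial (Fin (N + 1)) ℂ
  | 0 => MvPolynomial.X
  | n + 1 => fun i => MvPolynomial.bind₁ (iterLift G n) (G i)

/-! ### Affine charts -/

/-- The inverse of the affine chart `x_b ≠ 0`: put `1` in position `b`. -/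
def ofAffine {N : ℕ} (b : Fin (N + 1)) (z : Fin N → ℂ) : PSpace N :=
  Projectivization.mk ℂ (b.insertNth (α := fun _ => ℂ) 1 z) (by
    intro h
    have := congrFun h b
    simp at this)

/-- The affine chart `x_b ≠ 0`: divide by the coordinate `b` and forget it. -/
def toAffine {N : ℕ} (b : Fin (N + 1)) (P : PSpace N) : Fin N → ℂ :=
  fun i => P.rep (b.succAbove i) / P.rep b

theorem exists_rep_ne_zero {N : ℕ} (P : PSpace N) : ∃ b, P.rep b ≠ 0 :=
  Function.ne_iff.mp P.rep_nonzero

/-- An index `b` such that `P` lies in the chart `x_b ≠ 0`. -/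
def chartIdx {N : ℕ} (P : PSpace N) : Fin (N + 1) := (exists_rep_ne_zero P).choose

/-! ### Multipliers and multiplicities of fixed points -/

/-- The multiplier polynomial of `g` at a fixed point `P`: the characteristic polynomial of the
differential at `P` of `g`, read in an affine chart around `P`. -/
def multiplierPoly {N : ℕ} (g : PSpace N → PSpace N) (P : PSpace N) : Polynomial ℂ :=
  LinearMap.charpoly
    (fderiv ℂ (fun z => toAffine (chartIdx P) (g (ofAffine (chartIdx P) z)))
      (toAffine (chartIdx P) P) : (Fin N → ℂ) →ₗ[ℂ] (Fin N → ℂ))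

/-- Dehomogenization of a polynomial at the coordinate `x_b`. -/
def dehom {N : ℕ} (b : Fin (N + 1)) (p : MvPolynomial (Fin (N + 1)) ℂ) :
    MvPolynomial (Fin N) ℂ :=
  MvPolynomial.aeval (b.insertNth (α := fun _ => MvPolynomial (Fin N) ℂ) 1 MvPolynomial.X) p

/-- The maximal ideal of polynomials that vanish at the point `z` of affine space. -/
def pointIdeal {N : ℕ} (z : Fin N → ℂ) : Ideal (MvPolynomial (Fin N) ℂ) :=
  RingHom.ker (MvPolynomial.eval z)

instance {N : ℕ} (z : Fin N → ℂ) : (pointIdeal z).IsPrime :=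
  RingHom.ker_isPrime (MvPolynomial.eval z)

/-- The ideal, in the chart `x_b ≠ 0`, of the scheme of fixed points of the map defined by `G`. -/
def fixedIdeal {N : ℕ} (G : Fin (N + 1) → MvPolynomial (Fin (N + 1)) ℂ) (b : Fin (N + 1)) :
    Ideal (MvPolynomial (Fin N) ℂ) :=
  Ideal.span (Set.range fun l : Fin N =>
    dehom b (G (b.succAbove l)) - MvPolynomial.X l * dehom b (G b))

/-- The multiplicity of `P` as a fixed point of the map defined by `G`: the dimension over `ℂ` of
the local ring at `P` of the scheme of fixed points. -/
def fixedMult {N : ℕ} (G : Fin (N + 1) → MvPolynomial (Fin (N + 1)) ℂ) (P : PSpace N) : ℕ :=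
  Module.finrank ℂ
    (Localization.AtPrime (pointIdeal (toAffine (chartIdx P) P)) ⧸
      (fixedIdeal G (chartIdx P)).map
        (algebraMap (MvPolynomial (Fin N) ℂ)
          (Localization.AtPrime (pointIdeal (toAffine (chartIdx P) P)))))

/-! ### The multiplier invariants -/

/-- The number of points of period `n`, with multiplicity, of an endomorphism of `ℙ^N` of degree
`d`, that is, `(d^{n(N+1)} - 1)/(d^n - 1)`. -/
def numPer (N d n : ℕ) : ℕ := ∑ i ∈ Finset.range (N + 1), (d ^ n) ^ i

/-- `Σ_n(f) = ∏_P (w - γ_{f^n,P}(t))`, over the points `P` with `f^n(P) = P`, counted with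
multiplicity. The outer variable is `w`, the inner one is `t`. -/
def bigSigma {N d : ℕ} (n : ℕ) (f : HomPN N d) : Polynomial (Polynomial ℂ) :=
  ∏ᶠ P ∈ Function.ptsOfPeriod f.toFun n,
    (Polynomial.X - Polynomial.C (multiplierPoly (f.toFun^[n]) P)) ^
      fixedMult (iterLift f.lift n) P

/-- The multiplier invariant `σ_{i,j}^{(n)}`: up to the sign `(-1)^{i+j}`, the coefficient of
`w^{D_n - i} t^{N i - j}` in `Σ_n(f)`. -/
def sigmaInv {N d : ℕ} (n i j : ℕ) (f : HomPN N d) : ℂ :=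
  (-1) ^ (i + j) * ((bigSigma n f).coeff (numPer N d n - i)).coeff (N * i - j)

/-- The multiplier map `τ_{d,n}^N`: all the invariants `σ_{i,j}^{(m)}` with `1 ≤ m ≤ n`,
`0 ≤ i ≤ D_m` and `0 ≤ j ≤ N i`. -/
def multiplierMap {N d : ℕ} (n : ℕ) (f : HomPN N d) :
    (m : Fin n) → (i : Fin (numPer N d (m + 1) + 1)) → Fin (N * i + 1) → ℂ :=
  fun m i j => sigmaInv (m + 1) i j f

/-! ### Families -/

/-- `f` is a continuous family in `Hom_d^N`: locally on the parameter space, it is defined by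
polynomials whose coefficients depend continuously on the parameter. -/
def IsFamily {A : Type*} [TopologicalSpace A] {N d : ℕ} (f : A → HomPN N d) : Prop :=
  ∀ a₀ : A, ∃ U ∈ 𝓝 a₀, ∃ G : A → Fin (N + 1) → MvPolynomial (Fin (N + 1)) ℂ,
    (∀ a ∈ U, IsLift d (G a) (f a).toFun) ∧
      ∀ i m, ContinuousOn (fun a => MvPolynomial.coeff m (G a i)) U

/-- A family is isospectral if its image under each multiplier map `τ_{d,n}^N` is one point. -/
def IsIsospectral {A : Type*} {N d : ℕ} (f : A → HomPN N d) : Prop :=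
  ∀ (n : ℕ) (a b : A), multiplierMap n (f a) = multiplierMap n (f b)

/-! ### Lattès maps -/

/-- A map from `ℂ` to `ℙ^1` is holomorphic if, locally, it has holomorphic homogeneous
coordinates without common zero. -/
def IsHolomorphicToP1 (Θ : ℂ → PSpace 1) : Prop :=
  ∀ z₀ : ℂ, ∃ g : ℂ → Fin 2 → ℂ, AnalyticAt ℂ g z₀ ∧
    ∀ᶠ z in 𝓝 z₀, ∃ h : g z ≠ 0, Θ z = Projectivization.mk ℂ (g z) h

/-- `f` is a Lattès map: there are a complex torus `ℂ/Λ`, a nonconstant holomorphic map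
`Θ : ℂ/Λ → ℙ^1` and an affine self-map `z ↦ α z + β` of `ℂ/Λ` such that
`f (Θ z) = Θ (α z + β)`. -/
def IsLattes (f : PSpace 1 → PSpace 1) : Prop :=
  ∃ (L : PeriodPair) (Θ : ℂ → PSpace 1) (α β : ℂ),
    IsHolomorphicToP1 Θ ∧
    (∀ z, ∀ ω ∈ L.lattice, Θ (z + ω) = Θ z) ∧
    (∃ z w, Θ z ≠ Θ w) ∧
    (∀ ω ∈ L.lattice, α * ω ∈ L.lattice) ∧
    ∀ z, f (Θ z) = Θ (α * z + β)

/-! ### Symmetric products -/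

/-- The form `∏_i (u_i + v_i T)` attached to a `k`-tuple of vectors `(u_i, v_i)`. -/
def symForm {k : ℕ} (v : Fin k → Fin 2 → ℂ) : Polynomial ℂ :=
  ∏ i, (Polynomial.C (v i 0) + Polynomial.C (v i 1) * Polynomial.X)

/-- The homogenized elementary symmetric functions of a `k`-tuple of vectors `(u_i, v_i)`: the
`j`-th one is `∑_{|I| = j} ∏_{i ∉ I} u_i ∏_{i ∈ I} v_i`, the coefficient of `T^j` in
`∏_i (u_i + v_i T)`. -/
def symVec {k : ℕ} (v : Fin k → Fin 2 → ℂ) : Fin (k + 1) → ℂ :=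
  fun j => (symForm v).coeff j

theorem symVec_ne_zero {k : ℕ} (v : Fin k → Fin 2 → ℂ) (hv : ∀ i, v i ≠ 0) : symVec v ≠ 0 := by
  have h1 : symForm v ≠ 0 := by
    refine Finset.prod_ne_zero_iff.mpr fun i _ h => hv i ?_
    have h0 := congrArg (fun p => Polynomial.coeff p 0) h
    have h1 := congrArg (fun p => Polynomial.coeff p 1) h
    simp [Polynomial.coeff_C] at h0 h1
    funext l
    fin_cases l
    · exact h0
    · exact h1
  have h2 : (symForm v).natDegree ≤ k := by
    refine (Polynomial.natDegree_prod_le _ _).trans ?_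
    refine (Finset.sum_le_card_nsmul _ _ 1 fun i _ => ?_).trans (by simp)
    compute_degree
  intro h
  apply h1
  rw [← Polynomial.leadingCoeff_eq_zero]
  exact congrFun h ⟨(symForm v).natDegree, by omega⟩

/-- The quotient map `η : (ℙ^1)^k → Sym^k ℙ^1 = ℙ^k`. -/
def symMap {k : ℕ} (P : Fin k → PSpace 1) : PSpace k :=
  Projectivization.mk ℂ (symVec fun i => (P i).rep)
    (symVec_ne_zero _ fun i => (P i).rep_nonzero)

/-- `F` is the `k`-fold symmetric product of `f`: it is induced by `f × ⋯ × f` on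
`Sym^k ℙ^1 = ℙ^k`. -/
def IsSymProduct (k : ℕ) (f : PSpace 1 → PSpace 1) (F : PSpace k → PSpace k) : Prop :=
  ∀ P : Fin k → PSpace 1, F (symMap P) = symMap fun i => f (P i)

end IsoSym

end

open scoped LinearAlgebra.Projectivization Topology

noncomputable section

namespace IsoSym

/-! ### Homogeneous coordinates and affine charts -/

/-- The vector of homogeneous coordinates with `1` in position `b` and `z` elsewhere. -/
def affineVec {N : ℕ} (b : Fin (N + 1)) (z : Fin N → ℂ) : Fin (N + 1) → ℂ :=
  b.insertNth (α := fun _ => ℂ) 1 z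

@[simp] theorem affineVec_same {N : ℕ} (b : Fin (N + 1)) (z : Fin N → ℂ) :
    affineVec b z b = 1 := by
  simp [affineVec]

@[simp] theorem affineVec_succAbove {N : ℕ} (b : Fin (N + 1)) (z : Fin N → ℂ) (l : Fin N) :
    affineVec b z (b.succAbove l) = z l := by
  simp [affineVec]

theorem affineVec_ne_zero {N : ℕ} (b : Fin (N + 1)) (z : Fin N → ℂ) : affineVec b z ≠ 0 := by
  intro h
  simpa using congrFun h b

theorem ofAffine_eq {N : ℕ} (b : Fin (N + 1)) (z : Fin N → ℂ) :
    ofAffine b z = Projectivization.mk ℂ (affineVec b z) (affineVec_ne_zero b z) := rfl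

theorem contDiff_affineVec {N : ℕ} (b : Fin (N + 1)) {m : WithTop ℕ∞} :
    ContDiff ℂ m (affineVec (N := N) b) := by
  refine contDiff_pi.2 ?_
  rw [Fin.forall_iff_succAbove b]
  refine ⟨by simpa using contDiff_const, fun l => ?_⟩
  simpa using contDiff_apply ℂ ℂ l

/-- Two nonzero vectors define the same point if and only if they are proportional. -/
theorem mk_eq_mk_iff_mul_eq_mul {ι : Type*} {v w : ι → ℂ} (hv : v ≠ 0) (hw : w ≠ 0) :
    Projectivization.mk ℂ v hv = Projectivization.mk ℂ w hw ↔
      ∀ i j, v i * w j = v j * w i := by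
  rw [Projectivization.mk_eq_mk_iff']
  constructor
  · rintro ⟨a, rfl⟩ i j
    simp only [Pi.smul_apply, smul_eq_mul]
    ring
  · intro h
    obtain ⟨j, hj⟩ := Function.ne_iff.1 hw
    refine ⟨v j / w j, funext fun i => ?_⟩
    have := h i j
    simp only [Pi.zero_apply] at hj
    simp only [Pi.smul_apply, smul_eq_mul]
    field_simp
    linear_combination -this

theorem exists_rep_mk {N : ℕ} {v : Fin (N + 1) → ℂ} (hv : v ≠ 0) :
    ∃ t : ℂ, t ≠ 0 ∧ (Projectivization.mk ℂ v hv).rep = t • v := by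
  obtain ⟨a, ha⟩ := Projectivization.exists_smul_eq_mk_rep ℂ v hv
  exact ⟨a, a.ne_zero, ha.symm⟩

theorem rep_mk_ne_zero_iff {N : ℕ} {v : Fin (N + 1) → ℂ} (hv : v ≠ 0) (b : Fin (N + 1)) :
    (Projectivization.mk ℂ v hv).rep b ≠ 0 ↔ v b ≠ 0 := by
  obtain ⟨t, ht, h⟩ := exists_rep_mk hv
  simp [h, ht]

theorem toAffine_mk {N : ℕ} {v : Fin (N + 1) → ℂ} (hv : v ≠ 0) (b : Fin (N + 1)) :
    toAffine b (Projectivization.mk ℂ v hv) = fun l => v (b.succAbove l) / v b := by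
  obtain ⟨t, ht, h⟩ := exists_rep_mk hv
  funext l
  simp [toAffine, h, mul_div_mul_left _ _ ht]

theorem rep_ofAffine_ne_zero {N : ℕ} (b : Fin (N + 1)) (z : Fin N → ℂ) :
    (ofAffine b z).rep b ≠ 0 := by
  rw [ofAffine_eq, rep_mk_ne_zero_iff]
  simp

@[simp] theorem toAffine_ofAffine {N : ℕ} (b : Fin (N + 1)) (z : Fin N → ℂ) :
    toAffine b (ofAffine b z) = z := by
  rw [ofAffine_eq, toAffine_mk]
  simp

theorem smul_affineVec_div {N : ℕ} (v : Fin (N + 1) → ℂ) (b : Fin (N + 1)) (hb : v b ≠ 0) :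
    v b • affineVec b (fun l => v (b.succAbove l) / v b) = v := by
  funext i
  revert i
  rw [Fin.forall_iff_succAbove b]
  refine ⟨by simp, fun l => ?_⟩
  simp only [Pi.smul_apply, affineVec_succAbove, smul_eq_mul]
  field_simp

theorem ofAffine_toAffine {N : ℕ} (b : Fin (N + 1)) (P : PSpace N) (hP : P.rep b ≠ 0) :
    ofAffine b (toAffine b P) = P := by
  conv_rhs => rw [← P.mk_rep]
  rw [ofAffine_eq, Projectivization.mk_eq_mk_iff']
  exact ⟨(P.rep b)⁻¹, by
    rw [inv_smul_eq_iff₀ hP]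
    exact (smul_affineVec_div P.rep b hP).symm⟩

theorem rep_chartIdx_ne_zero {N : ℕ} (P : PSpace N) : P.rep (chartIdx P) ≠ 0 :=
  (exists_rep_ne_zero P).choose_spec

theorem ofAffine_chartIdx {N : ℕ} (P : PSpace N) :
    ofAffine (chartIdx P) (toAffine (chartIdx P) P) = P :=
  ofAffine_toAffine _ _ (rep_chartIdx_ne_zero P)

/-! ### Lifts of iterates -/

theorem isLift_iterate {N d : ℕ} {G : Fin (N + 1) → MvPolynomial (Fin (N + 1)) ℂ}
    {f : PSpace N → PSpace N} (h : IsLift d G f) (n : ℕ) :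
    IsLift (d ^ n) (iterLift G n) (f^[n]) := by
  induction n with
  | zero =>
    refine ⟨fun i => by simpa [iterLift] using MvPolynomial.isHomogeneous_X ℂ i,
      fun v hv => ?_⟩
    have : (fun i => MvPolynomial.eval v (iterLift G 0 i)) = v := by
      funext i; simp [iterLift]
    simp only [this]
    exact ⟨hv, rfl⟩
  | succ n ih =>
    refine ⟨fun i => ?_, fun v hv => ?_⟩
    · rw [pow_succ]
      exact (h.1 i).aeval _ ih.1
    · obtain ⟨h1, h2⟩ := ih.2 v hv
      obtain ⟨h3, h4⟩ := h.2 _ h1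
      have : (fun i => MvPolynomial.eval v (iterLift G (n + 1) i)) =
          fun i => MvPolynomial.eval (fun i => MvPolynomial.eval v (iterLift G n i)) (G i) := by
        funext i
        simp only [iterLift]
        rw [MvPolynomial.eval, MvPolynomial.eval₂Hom_bind₁]
        rfl
      simp only [this]
      exact ⟨h3, by rw [Function.iterate_succ_apply', h2, h4]⟩

theorem HomPN.isLift {N d : ℕ} (f : HomPN N d) : IsLift d f.lift f.toFun :=
  f.exists_lift.choose_spec

/-! ### Maps read in charts -/

/-- The map `g` read in the chart `x_b ≠ 0`. -/
def chartMap {N : ℕ} (b : Fin (N + 1)) (g : PSpace N → PSpace N) (z : Fin N → ℂ) : Fin N → ℂ :=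
  toAffine b (g (ofAffine b z))

theorem contDiff_eval {σ : Type*} [Fintype σ] (p : MvPolynomial σ ℂ) {m : WithTop ℕ∞} :
    ContDiff ℂ m (fun v : σ → ℂ => MvPolynomial.eval v p) := by
  induction p using MvPolynomial.induction_on with
  | C a => simpa using contDiff_const
  | add p q hp hq => simpa using hp.add hq
  | mul_X p i hp => simpa using hp.mul (contDiff_apply ℂ ℂ i)

theorem chartMap_eq {N d : ℕ} {G : Fin (N + 1) → MvPolynomial (Fin (N + 1)) ℂ}
    {g : PSpace N → PSpace N} (h : IsLift d G g) (b : Fin (N + 1)) (z : Fin N → ℂ) :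
    chartMap b g z = fun l => MvPolynomial.eval (affineVec b z) (G (b.succAbove l)) /
      MvPolynomial.eval (affineVec b z) (G b) := by
  obtain ⟨h1, h2⟩ := h.2 _ (affineVec_ne_zero b z)
  rw [chartMap, ofAffine_eq, h2, toAffine_mk]

theorem rep_apply_ofAffine_ne_zero_iff {N d : ℕ}
    {G : Fin (N + 1) → MvPolynomial (Fin (N + 1)) ℂ}
    {g : PSpace N → PSpace N} (h : IsLift d G g) (b c : Fin (N + 1)) (z : Fin N → ℂ) :
    (g (ofAffine b z)).rep c ≠ 0 ↔ MvPolynomial.eval (affineVec b z) (G c) ≠ 0 := by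
  obtain ⟨h1, h2⟩ := h.2 _ (affineVec_ne_zero b z)
  rw [ofAffine_eq, h2, rep_mk_ne_zero_iff]

theorem eventually_rep_apply_ofAffine_ne_zero {N d : ℕ}
    {G : Fin (N + 1) → MvPolynomial (Fin (N + 1)) ℂ}
    {g : PSpace N → PSpace N} (h : IsLift d G g) (b c : Fin (N + 1)) (z₀ : Fin N → ℂ)
    (h0 : (g (ofAffine b z₀)).rep c ≠ 0) :
    ∀ᶠ z in 𝓝 z₀, (g (ofAffine b z)).rep c ≠ 0 := by
  simp only [rep_apply_ofAffine_ne_zero_iff h] at h0 ⊢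
  exact ((contDiff_eval (m := 0) (G c)).comp
    (contDiff_affineVec b)).continuous.continuousAt.eventually_ne h0

theorem contDiffAt_chartMap {N d : ℕ}
    {G : Fin (N + 1) → MvPolynomial (Fin (N + 1)) ℂ}
    {g : PSpace N → PSpace N} (h : IsLift d G g) (b : Fin (N + 1)) (z₀ : Fin N → ℂ)
    (h0 : (g (ofAffine b z₀)).rep b ≠ 0) {m : WithTop ℕ∞} :
    ContDiffAt ℂ m (chartMap b g) z₀ := by
  rw [rep_apply_ofAffine_ne_zero_iff h] at h0
  have : chartMap b g = fun z l => MvPolynomial.eval (affineVec b z) (G (b.succAbove l)) /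
      MvPolynomial.eval (affineVec b z) (G b) := funext (chartMap_eq h b)
  rw [this, contDiffAt_pi]
  intro l
  exact ((contDiff_eval _).comp (contDiff_affineVec b)).contDiffAt.div
    ((contDiff_eval _).comp (contDiff_affineVec b)).contDiffAt h0

/-- The change of charts. -/
def transition {N : ℕ} (b c : Fin (N + 1)) (z : Fin N → ℂ) : Fin N → ℂ :=
  toAffine c (ofAffine b z)

theorem rep_ofAffine_ne_zero_iff {N : ℕ} (b c : Fin (N + 1)) (z : Fin N → ℂ) :
    (ofAffine b z).rep c ≠ 0 ↔ affineVec b z c ≠ 0 := by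
  rw [ofAffine_eq, rep_mk_ne_zero_iff]

theorem eventually_rep_ofAffine_ne_zero {N : ℕ} (b c : Fin (N + 1)) (z₀ : Fin N → ℂ)
    (h0 : (ofAffine b z₀).rep c ≠ 0) : ∀ᶠ z in 𝓝 z₀, (ofAffine b z).rep c ≠ 0 := by
  simp only [rep_ofAffine_ne_zero_iff] at h0 ⊢
  exact ((continuous_apply c).comp
    (contDiff_affineVec (m := 0) b).continuous).continuousAt.eventually_ne h0

theorem differentiableAt_transition {N : ℕ} (b c : Fin (N + 1)) (z₀ : Fin N → ℂ)
    (h0 : (ofAffine b z₀).rep c ≠ 0) : DifferentiableAt ℂ (transition b c) z₀ := by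
  rw [rep_ofAffine_ne_zero_iff] at h0
  have : transition b c = fun z l => affineVec b z (c.succAbove l) / affineVec b z c := by
    funext z
    rw [transition, ofAffine_eq, toAffine_mk]
  have h (i) : DifferentiableAt ℂ (fun z => affineVec b z i) z₀ :=
    (((contDiff_apply ℂ ℂ i).comp (contDiff_affineVec (m := 1) b)).differentiable
      (by simp)).differentiableAt
  simp only [this, differentiableAt_pi, div_eq_mul_inv]
  exact fun l => (h _).fun_mul ((h c).fun_inv h0)

/-- The characteristic polynomial of the differential at a fixed point does not depend on the
chart. -/
theorem multiplierPoly_eq {N d : ℕ} {G : Fin (N + 1) → MvPolynomial (Fin (N + 1)) ℂ}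
    {g : PSpace N → PSpace N} (h : IsLift d G g) (P : PSpace N) (hP : g P = P)
    (b : Fin (N + 1)) (hb : P.rep b ≠ 0) :
    multiplierPoly g P = LinearMap.charpoly
      (fderiv ℂ (chartMap b g) (toAffine b P) : (Fin N → ℂ) →ₗ[ℂ] (Fin N → ℂ)) := by
  set c := chartIdx P with hc
  have hc0 : P.rep c ≠ 0 := rep_chartIdx_ne_zero P
  set z := toAffine b P with hz
  set y := toAffine c P with hy
  have hPz : ofAffine b z = P := ofAffine_toAffine b P hb
  have hPy : ofAffine c y = P := ofAffine_toAffine c P hc0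
  have hzy : transition b c z = y := by rw [transition, hPz]
  have hyz : transition c b y = z := by rw [transition, hPy]
  have hT : HasFDerivAt (transition b c) (fderiv ℂ (transition b c) z) z :=
    (differentiableAt_transition b c z (by rwa [hPz])).hasFDerivAt
  have hS : HasFDerivAt (transition c b) (fderiv ℂ (transition c b) y) y :=
    (differentiableAt_transition c b y (by rwa [hPy])).hasFDerivAt
  have hA : HasFDerivAt (chartMap b g) (fderiv ℂ (chartMap b g) z) z :=
    ((contDiffAt_chartMap (m := 1) h b z (by rwa [hPz, hP])).differentiableAt
      (by simp)).hasFDerivAt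
  have hB : HasFDerivAt (chartMap c g) (fderiv ℂ (chartMap c g) y) y :=
    ((contDiffAt_chartMap (m := 1) h c y (by rwa [hPy, hP])).differentiableAt
      (by simp)).hasFDerivAt
  set T := fderiv ℂ (transition b c) z
  set S := fderiv ℂ (transition c b) y
  set A := fderiv ℂ (chartMap b g) z
  set B := fderiv ℂ (chartMap c g) y
  have hST : S.comp T = ContinuousLinearMap.id ℂ _ := by
    have h1 : HasFDerivAt (transition c b ∘ transition b c) (S.comp T) z :=
      HasFDerivAt.comp z (by rwa [hzy]) hT
    refine h1.unique ((hasFDerivAt_id z).congr_of_eventuallyEq ?_)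
    filter_upwards [eventually_rep_ofAffine_ne_zero b c z (by rwa [hPz])] with w hw
    simp [transition, ofAffine_toAffine _ _ hw]
  have hTS : T.comp S = ContinuousLinearMap.id ℂ _ := by
    have h1 : HasFDerivAt (transition b c ∘ transition c b) (T.comp S) y :=
      HasFDerivAt.comp y (by rwa [hyz]) hS
    refine h1.unique ((hasFDerivAt_id y).congr_of_eventuallyEq ?_)
    filter_upwards [eventually_rep_ofAffine_ne_zero c b y (by rwa [hPy])] with w hw
    simp [transition, ofAffine_toAffine _ _ hw]
  have hBT : B.comp T = T.comp A := by
    have h1 : HasFDerivAt (chartMap c g ∘ transition b c) (B.comp T) z :=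
      HasFDerivAt.comp z (by rwa [hzy]) hT
    have h3 : chartMap b g z = z := by rw [chartMap, hPz, hP]
    have h2 : HasFDerivAt (transition b c ∘ chartMap b g) (T.comp A) z :=
      HasFDerivAt.comp z (by rwa [h3]) hA
    refine h1.unique (h2.congr_of_eventuallyEq ?_)
    filter_upwards [eventually_rep_ofAffine_ne_zero b c z (by rwa [hPz]),
      eventually_rep_apply_ofAffine_ne_zero h b b z (by rwa [hPz, hP])] with w hw hw'
    simp [transition, chartMap, ofAffine_toAffine _ _ hw, ofAffine_toAffine _ _ hw']
  let e : (Fin N → ℂ) ≃ₗ[ℂ] (Fin N → ℂ) :=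
    LinearEquiv.ofLinearMap (T : (Fin N → ℂ) →ₗ[ℂ] (Fin N → ℂ)) S
      (LinearMap.ext fun x => congrArg (fun φ : (Fin N → ℂ) →L[ℂ] (Fin N → ℂ) => φ x) hTS)
      (LinearMap.ext fun x => congrArg (fun φ : (Fin N → ℂ) →L[ℂ] (Fin N → ℂ) => φ x) hST)
  have hconj : (B : (Fin N → ℂ) →ₗ[ℂ] (Fin N → ℂ)) = e.conj A := by
    refine LinearMap.ext fun x => ?_
    have h1 : B (T (S x)) = T (A (S x)) := congrArg (fun φ : (Fin N → ℂ) →L[ℂ] _ => φ (S x)) hBT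
    have h2 : T (S x) = x := congrArg (fun φ : (Fin N → ℂ) →L[ℂ] _ => φ x) hTS
    rw [h2] at h1
    exact h1
  change LinearMap.charpoly (B : (Fin N → ℂ) →ₗ[ℂ] (Fin N → ℂ)) = _
  rw [hconj, LinearEquiv.charpoly_conj]

/-- The differential of an iterate at a fixed point is a power of the differential. -/
theorem hasFDerivAt_chartMap_iterate {N d : ℕ} {G : Fin (N + 1) → MvPolynomial (Fin (N + 1)) ℂ}
    {g : PSpace N → PSpace N} (h : IsLift d G g) (b : Fin (N + 1)) (z : Fin N → ℂ)
    (hz : g (ofAffine b z) = ofAffine b z) (r : ℕ) :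
    HasFDerivAt (chartMap b (g^[r])) ((fderiv ℂ (chartMap b g) z) ^ r) z := by
  have hit (r : ℕ) : g^[r] (ofAffine b z) = ofAffine b z := Function.iterate_fixed hz r
  induction r with
  | zero =>
    have : chartMap b (g^[0]) = id := by funext w; simp [chartMap]
    rw [this, pow_zero]
    exact hasFDerivAt_id z
  | succ r ih =>
    have hA : HasFDerivAt (chartMap b g) (fderiv ℂ (chartMap b g) z) z :=
      ((contDiffAt_chartMap (m := 1) h b z
        (by rw [hz]; exact rep_ofAffine_ne_zero b z)).differentiableAt (by simp)).hasFDerivAt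
    have h3 : chartMap b g z = z := by rw [chartMap, hz, toAffine_ofAffine]
    have h2 : HasFDerivAt (chartMap b (g^[r]) ∘ chartMap b g) _ z :=
      HasFDerivAt.comp z (by rwa [h3]) hA
    rw [pow_succ]
    refine h2.congr_of_eventuallyEq ?_
    filter_upwards [eventually_rep_apply_ofAffine_ne_zero h b b z
      (by rw [hz]; exact rep_ofAffine_ne_zero b z)] with w hw
    simp [chartMap, ofAffine_toAffine _ _ hw]

/-! ### Resultants with prescribed formal degrees -/

theorem resultant_mul_left_of_le {R : Type*} [CommRing R] (f₁ f₂ g : Polynomial R) {m₁ m₂ n : ℕ}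
    (h₁ : f₁.natDegree ≤ m₁) (h₂ : f₂.natDegree ≤ m₂) (hg : g.natDegree ≤ n) :
    (f₁ * f₂).resultant g (m₁ + m₂) n = f₁.resultant g m₁ n * f₂.resultant g m₂ n := by
  obtain ⟨k₁, rfl⟩ := Nat.exists_eq_add_of_le h₁
  obtain ⟨k₂, rfl⟩ := Nat.exists_eq_add_of_le h₂
  have h : f₁.natDegree + k₁ + (f₂.natDegree + k₂) =
      (f₁.natDegree + f₂.natDegree) + (k₁ + k₂) := by ring
  rw [h, Polynomial.resultant_add_left_deg _ _ _ _ _ Polynomial.natDegree_mul_le,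
    Polynomial.resultant_mul_left _ _ _ _ hg, Polynomial.resultant_add_left_deg _ _ _ _ _ le_rfl,
    Polynomial.resultant_add_left_deg _ _ _ _ _ le_rfl]
  ring

theorem resultant_prod_left_of_le {R ι : Type*} [CommRing R] (s : Finset ι)
    (f : ι → Polynomial R) (g : Polynomial R) {n : ℕ}
    (hf : ∀ i ∈ s, (f i).natDegree ≤ 1) (hg : g.natDegree ≤ n) :
    (∏ i ∈ s, f i).resultant g s.card n = ∏ i ∈ s, (f i).resultant g 1 n := by
  classical
  induction s using Finset.induction with
  | empty => simp
  | insert a s ha ih =>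
    have h1 : (∏ i ∈ s, f i).natDegree ≤ s.card := by
      refine (Polynomial.natDegree_prod_le _ _).trans ?_
      refine (Finset.sum_le_card_nsmul _ _ 1 fun i hi => hf i (Finset.mem_insert_of_mem hi)).trans ?_
      simp
    rw [Finset.prod_insert ha, Finset.prod_insert ha, Finset.card_insert_of_notMem ha, add_comm,
      resultant_mul_left_of_le _ _ _ (hf a (Finset.mem_insert_self _ _)) h1 hg,
      ih fun i hi => hf i (Finset.mem_insert_of_mem hi)]

theorem resultant_linear_left {K : Type*} [Field K] (u v : K) (g : Polynomial K) {n : ℕ}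
    (hg : g.natDegree ≤ n) :
    (Polynomial.C u + Polynomial.C v * Polynomial.X).resultant g 1 n =
      ∑ j ∈ Finset.range (n + 1), g.coeff j * (-u) ^ j * v ^ (n - j) := by
  by_cases hv : v = 0
  · subst hv
    rw [Finset.sum_range_succ, Finset.sum_eq_zero]
    · have h := Polynomial.resultant_succ_left_deg (Polynomial.C u) g 0 n (by simp)
      simp only [zero_add] at h
      have h0 : Polynomial.C u + Polynomial.C 0 * Polynomial.X = Polynomial.C u := by simp
      rw [h0, h, Polynomial.resultant_C_zero_left, neg_pow, Nat.sub_self]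
      ring
    · intro j hj
      have : n - j ≠ 0 := by have := Finset.mem_range.1 hj; omega
      simp [this]
  · have h : Polynomial.C u + Polynomial.C v * Polynomial.X =
        Polynomial.C v * (Polynomial.X + Polynomial.C (u / v)) := by
      rw [mul_add, ← Polynomial.C_mul, mul_div_cancel₀ _ hv, add_comm]
    rw [h, Polynomial.resultant_C_mul_left, Polynomial.resultant_X_add_C_left _ _ _ hg,
      Polynomial.eval_eq_sum_range' (Nat.lt_succ_of_le hg), Finset.mul_sum]
    refine Finset.sum_congr rfl fun j hj => ?_
    have hj' : j ≤ n := Nat.lt_succ_iff.1 (Finset.mem_range.1 hj)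
    have : v ^ n = v ^ (n - j) * v ^ j := by rw [← pow_add, Nat.sub_add_cancel hj']
    rw [this, neg_pow (u / v), neg_pow u, div_pow]
    field_simp

/-! ### Binary forms -/

/-- The coefficient of `x₀ ^ j x₁ ^ (d - j)` in a binary form of degree `d`. -/
def binaryCoeff (d : ℕ) (p : MvPolynomial (Fin 2) ℂ) (j : ℕ) : ℂ :=
  MvPolynomial.coeff (Finsupp.single 0 j + Finsupp.single 1 (d - j)) p

theorem eval_binary {d : ℕ} {p : MvPolynomial (Fin 2) ℂ} (hp : p.IsHomogeneous d)
    (v : Fin 2 → ℂ) :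
    MvPolynomial.eval v p =
      ∑ j ∈ Finset.range (d + 1), binaryCoeff d p j * v 0 ^ j * v 1 ^ (d - j) := by
  classical
  rw [MvPolynomial.eval_eq']
  have h1 : p.support ⊆ (Finset.range (d + 1)).image
      fun j => (Finsupp.single 0 j + Finsupp.single 1 (d - j) : Fin 2 →₀ ℕ) := by
    intro m hm
    have := hp.degree_eq_sum_deg_support hm
    rw [← Finsupp.degree_apply, Finsupp.degree_eq_sum, Fin.sum_univ_two] at this
    refine Finset.mem_image.2 ⟨m 0, Finset.mem_range.2 (by omega), ?_⟩
    ext i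
    fin_cases i
    · simp
    · simp; omega
  rw [Finset.sum_subset h1, Finset.sum_image]
  · refine Finset.sum_congr rfl fun j _ => ?_
    simp [Fin.prod_univ_two, binaryCoeff, mul_assoc]
  · intro j _ j' _ h
    simpa using DFunLike.congr_fun h 0
  · intro m _ hm
    simp [MvPolynomial.notMem_support_iff.1 hm]

/-! ### The lift of a symmetric product -/

theorem natDegree_symForm_le {k : ℕ} (v : Fin k → Fin 2 → ℂ) : (symForm v).natDegree ≤ k := by
  refine (Polynomial.natDegree_prod_le _ _).trans ?_
  refine (Finset.sum_le_card_nsmul _ _ 1 fun i _ => ?_).trans (by simp)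
  compute_degree

/-- The polynomial `e_0 + e_1 T + ⋯ + e_k T^k` with indeterminate coefficients. -/
def genericForm (k : ℕ) : Polynomial (Polynomial (MvPolynomial (Fin (k + 1)) ℂ)) :=
  ∑ j : Fin (k + 1), Polynomial.C (Polynomial.C (MvPolynomial.X j)) * Polynomial.X ^ (j : ℕ)

/-- The coefficients of the pencil `G_0 + T G_1` of binary forms, with alternating signs. -/
def pencilCoeff (k d : ℕ) (G : Fin 2 → MvPolynomial (Fin 2) ℂ) (j : ℕ) :
    Polynomial (MvPolynomial (Fin (k + 1)) ℂ) :=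
  Polynomial.C (MvPolynomial.C ((-1) ^ j * binaryCoeff d (G 0) j)) +
    Polynomial.X * Polynomial.C (MvPolynomial.C ((-1) ^ j * binaryCoeff d (G 1) j))

/-- The pencil `G_0 + T G_1` of binary forms, dehomogenized. -/
def pencil (k d : ℕ) (G : Fin 2 → MvPolynomial (Fin 2) ℂ) :
    Polynomial (Polynomial (MvPolynomial (Fin (k + 1)) ℂ)) :=
  ∑ j ∈ Finset.range (d + 1), Polynomial.C (pencilCoeff k d G j) * Polynomial.X ^ j

/-- The resultant of a generic form of degree `k` and the pencil `G_0 + T G_1`. -/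
def symResultant (k d : ℕ) (G : Fin 2 → MvPolynomial (Fin 2) ℂ) :
    Polynomial (MvPolynomial (Fin (k + 1)) ℂ) :=
  (genericForm k).resultant (pencil k d G) k d

/-- The homogeneous polynomials that define the symmetric product. -/
def symLift (k d : ℕ) (G : Fin 2 → MvPolynomial (Fin 2) ℂ) (j : Fin (k + 1)) :
    MvPolynomial (Fin (k + 1)) ℂ :=
  (symResultant k d G).coeff j

theorem coeff_genericForm (k j : ℕ) : (genericForm k).coeff j =
    if h : j < k + 1 then Polynomial.C (MvPolynomial.X ⟨j, h⟩) else 0 := by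
  simp only [genericForm, Polynomial.finsetSum_coeff, Polynomial.coeff_C_mul_X_pow]
  split_ifs with h
  · rw [Finset.sum_eq_single ⟨j, h⟩]
    · simp
    · intro b _ hb
      rw [if_neg]
      rintro rfl
      exact hb rfl
    · simp
  · exact Finset.sum_eq_zero fun b _ => if_neg (by omega)

theorem coeff_pencil (k d : ℕ) (G : Fin 2 → MvPolynomial (Fin 2) ℂ) (j : ℕ) :
    (pencil k d G).coeff j = if j < d + 1 then pencilCoeff k d G j else 0 := by
  simp only [pencil, Polynomial.finsetSum_coeff, Polynomial.coeff_C_mul_X_pow]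
  simp

/-- Evaluation at `e ∈ ℂ^{k+1}` and `t ∈ ℂ`. -/
def evalPair {k : ℕ} (e : Fin (k + 1) → ℂ) (t : ℂ) :
    Polynomial (MvPolynomial (Fin (k + 1)) ℂ) →+* ℂ :=
  (Polynomial.evalRingHom t).comp (Polynomial.mapRingHom (MvPolynomial.eval e))

theorem evalPair_symResultant {k d : ℕ} {G : Fin 2 → MvPolynomial (Fin 2) ℂ}
    (hG : ∀ i, (G i).IsHomogeneous d) (v : Fin k → Fin 2 → ℂ) (t : ℂ) :
    evalPair (symVec v) t (symResultant k d G) =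
      ∏ i, (MvPolynomial.eval (v i) (G 0) + MvPolynomial.eval (v i) (G 1) * t) := by
  have h1 : (genericForm k).map (evalPair (symVec v) t) = symForm v := by
    ext j
    rw [Polynomial.coeff_map, coeff_genericForm]
    split_ifs with h
    · simp [evalPair, symVec]
    · rw [map_zero, Polynomial.coeff_eq_zero_of_natDegree_lt]
      have := natDegree_symForm_le v
      omega
  set g := (pencil k d G).map (evalPair (symVec v) t) with hg
  have hc (j : ℕ) (hj : j < d + 1) : g.coeff j =
      (-1) ^ j * (binaryCoeff d (G 0) j + binaryCoeff d (G 1) j * t) := by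
    rw [hg, Polynomial.coeff_map, coeff_pencil, if_pos hj]
    simp [evalPair, pencilCoeff]
    ring
  have hgd : g.natDegree ≤ d := by
    rw [Polynomial.natDegree_le_iff_coeff_eq_zero]
    intro j hj
    rw [hg, Polynomial.coeff_map, coeff_pencil, if_neg (by omega), map_zero]
  rw [symResultant, ← Polynomial.resultant_map_map, h1, ← hg]
  have h2 := resultant_prod_left_of_le Finset.univ
    (fun i => Polynomial.C (v i 0) + Polynomial.C (v i 1) * Polynomial.X) g (n := d)
    (fun i _ => by compute_degree) hgd
  rw [Finset.card_univ, Fintype.card_fin] at h2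
  rw [symForm, h2]
  refine Finset.prod_congr rfl fun i _ => ?_
  rw [resultant_linear_left _ _ _ hgd, eval_binary (hG 0), eval_binary (hG 1), Finset.sum_mul,
    ← Finset.sum_add_distrib]
  refine Finset.sum_congr rfl fun j hj => ?_
  rw [hc j (Finset.mem_range.1 hj), neg_pow (v i 0)]
  have : ((-1 : ℂ) ^ j) * (-1) ^ j = 1 := by rw [← mul_pow]; simp
  linear_combination (binaryCoeff d (G 0) j + binaryCoeff d (G 1) j * t) * v i 0 ^ j *
    v i 1 ^ (d - j) * this

/-- The polynomials `symLift k d G` induce `G × ⋯ × G` on the coefficients of products of linear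
forms. -/
theorem eval_symLift {k d : ℕ} {G : Fin 2 → MvPolynomial (Fin 2) ℂ}
    (hG : ∀ i, (G i).IsHomogeneous d) (v : Fin k → Fin 2 → ℂ) :
    (fun j => MvPolynomial.eval (symVec v) (symLift k d G j)) =
      symVec fun i l => MvPolynomial.eval (v i) (G l) := by
  have h : (symResultant k d G).map (MvPolynomial.eval (symVec v)) =
      symForm fun i l => MvPolynomial.eval (v i) (G l) := by
    refine Polynomial.funext fun t => ?_
    have := evalPair_symResultant hG v t
    rw [evalPair, RingHom.comp_apply, Polynomial.coe_evalRingHom, Polynomial.coe_mapRingHom] at this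
    rw [this, symForm, Polynomial.eval_prod]
    simp
  funext j
  rw [symVec, ← h, Polynomial.coeff_map, symLift]

/-- All the coefficients are homogeneous of degree `m`. -/
def HomogeneousCoeffs {σ : Type*} (m : ℕ) (s : Polynomial (MvPolynomial σ ℂ)) : Prop :=
  ∀ j, (s.coeff j).IsHomogeneous m

theorem HomogeneousCoeffs.mul {σ : Type*} {m n : ℕ} {s t : Polynomial (MvPolynomial σ ℂ)}
    (hs : HomogeneousCoeffs m s) (ht : HomogeneousCoeffs n t) :
    HomogeneousCoeffs (m + n) (s * t) := by
  intro j
  rw [Polynomial.coeff_mul]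
  exact MvPolynomial.IsHomogeneous.sum _ _ _ fun i _ => (hs _).mul (ht _)

theorem HomogeneousCoeffs.C {σ : Type*} {m : ℕ} {p : MvPolynomial σ ℂ}
    (hp : p.IsHomogeneous m) : HomogeneousCoeffs m (Polynomial.C p) := by
  intro j
  rw [Polynomial.coeff_C]
  split_ifs
  · exact hp
  · exact MvPolynomial.isHomogeneous_zero _ _ _

theorem HomogeneousCoeffs.zero {σ : Type*} {m : ℕ} :
    HomogeneousCoeffs m (0 : Polynomial (MvPolynomial σ ℂ)) := by
  intro j
  simpa using MvPolynomial.isHomogeneous_zero _ _ _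

theorem HomogeneousCoeffs.sum {σ ι : Type*} {m : ℕ} (S : Finset ι)
    {s : ι → Polynomial (MvPolynomial σ ℂ)} (hs : ∀ i ∈ S, HomogeneousCoeffs m (s i)) :
    HomogeneousCoeffs m (∑ i ∈ S, s i) := by
  intro j
  rw [Polynomial.finsetSum_coeff]
  exact MvPolynomial.IsHomogeneous.sum _ _ _ fun i hi => hs i hi j

theorem HomogeneousCoeffs.prod {σ ι : Type*} (n : ι → ℕ) (S : Finset ι)
    {s : ι → Polynomial (MvPolynomial σ ℂ)} (hs : ∀ i ∈ S, HomogeneousCoeffs (n i) (s i)) :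
    HomogeneousCoeffs (∑ i ∈ S, n i) (∏ i ∈ S, s i) := by
  classical
  induction S using Finset.induction with
  | empty => simpa using HomogeneousCoeffs.C (MvPolynomial.isHomogeneous_one σ ℂ)
  | insert a S ha ih =>
    rw [Finset.sum_insert ha, Finset.prod_insert ha]
    exact (hs a (Finset.mem_insert_self _ _)).mul
      (ih fun i hi => hs i (Finset.mem_insert_of_mem hi))

theorem homogeneousCoeffs_coeff_pencil (k d : ℕ) (G : Fin 2 → MvPolynomial (Fin 2) ℂ) (j : ℕ) :
    HomogeneousCoeffs 0 ((pencil k d G).coeff j) := by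
  rw [coeff_pencil]
  split_ifs
  · intro i
    rw [pencilCoeff, Polynomial.coeff_add, Polynomial.coeff_mul_C, Polynomial.coeff_X,
      Polynomial.coeff_C]
    refine MvPolynomial.IsHomogeneous.add ?_ ?_
    · split_ifs
      · exact MvPolynomial.isHomogeneous_C _ _
      · exact MvPolynomial.isHomogeneous_zero _ _ _
    · split_ifs
      · rw [one_mul]; exact MvPolynomial.isHomogeneous_C _ _
      · rw [zero_mul]; exact MvPolynomial.isHomogeneous_zero _ _ _
  · exact HomogeneousCoeffs.zero

theorem homogeneousCoeffs_coeff_genericForm (k j : ℕ) :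
    HomogeneousCoeffs 1 ((genericForm k).coeff j) := by
  rw [coeff_genericForm]
  split_ifs
  · exact HomogeneousCoeffs.C (MvPolynomial.isHomogeneous_X _ _)
  · exact HomogeneousCoeffs.zero

theorem isHomogeneous_symLift (k d : ℕ) (G : Fin 2 → MvPolynomial (Fin 2) ℂ) (j : Fin (k + 1)) :
    (symLift k d G j).IsHomogeneous d := by
  suffices h : HomogeneousCoeffs d (symResultant k d G) from h j
  rw [symResultant, Polynomial.resultant, Matrix.det_apply]
  refine HomogeneousCoeffs.sum _ fun τ _ => ?_
  have h : HomogeneousCoeffs d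
      (∏ i, Polynomial.sylvester (genericForm k) (pencil k d G) k d (τ i) i) := by
    let n : Fin (k + d) → ℕ := Fin.addCases (fun _ => 0) fun _ => 1
    have hn : ∑ i, n i = d := by simp [n, Fin.sum_univ_add]
    suffices h : HomogeneousCoeffs (∑ i, n i)
        (∏ i, Polynomial.sylvester (genericForm k) (pencil k d G) k d (τ i) i) by rwa [hn] at h
    refine HomogeneousCoeffs.prod n _ fun i _ => ?_
    induction i using Fin.addCases with
    | left i =>
      simp only [Polynomial.sylvester, Matrix.of_apply, Fin.addCases_left, n]
      split_ifs
      · exact homogeneousCoeffs_coeff_pencil _ _ _ _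
      · exact HomogeneousCoeffs.zero
    | right i =>
      simp only [Polynomial.sylvester, Matrix.of_apply, Fin.addCases_right, n]
      split_ifs
      · exact homogeneousCoeffs_coeff_genericForm _ _
      · exact HomogeneousCoeffs.zero
  obtain h1 | h1 := Int.units_eq_one_or (Equiv.Perm.sign τ)
  · rw [h1, one_smul]; exact h
  · rw [h1, Units.neg_smul, one_smul]
    intro j
    rw [Polynomial.coeff_neg]
    exact (h j).neg

/-- All the coefficients depend continuously on the parameter. -/
def ContinuousCoeffs {A σ : Type*} [TopologicalSpace A] (U : Set A)
    (s : A → Polynomial (MvPolynomial σ ℂ)) : Prop :=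
  ∀ j m, ContinuousOn (fun a => MvPolynomial.coeff m ((s a).coeff j)) U

section ContinuousCoeffs

variable {A σ ι : Type*} [TopologicalSpace A] {U : Set A}

theorem ContinuousCoeffs.const (s : Polynomial (MvPolynomial σ ℂ)) :
    ContinuousCoeffs U fun _ : A => s :=
  fun _ _ => continuousOn_const

theorem ContinuousCoeffs.mul {s t : A → Polynomial (MvPolynomial σ ℂ)}
    (hs : ContinuousCoeffs U s) (ht : ContinuousCoeffs U t) :
    ContinuousCoeffs U fun a => s a * t a := by
  classical
  intro j m
  simp only [Polynomial.coeff_mul, MvPolynomial.coeff_sum, MvPolynomial.coeff_mul]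
  exact continuousOn_finsetSum _ fun i _ => continuousOn_finsetSum _ fun l _ =>
    (hs _ _).mul (ht _ _)

theorem ContinuousCoeffs.sum (S : Finset ι) {s : ι → A → Polynomial (MvPolynomial σ ℂ)}
    (hs : ∀ i ∈ S, ContinuousCoeffs U (s i)) : ContinuousCoeffs U fun a => ∑ i ∈ S, s i a := by
  intro j m
  simp only [Polynomial.finsetSum_coeff, MvPolynomial.coeff_sum]
  exact continuousOn_finsetSum _ fun i hi => hs i hi _ _

theorem ContinuousCoeffs.prod (S : Finset ι) {s : ι → A → Polynomial (MvPolynomial σ ℂ)}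
    (hs : ∀ i ∈ S, ContinuousCoeffs U (s i)) : ContinuousCoeffs U fun a => ∏ i ∈ S, s i a := by
  classical
  induction S using Finset.induction with
  | empty => simpa using ContinuousCoeffs.const 1
  | insert a S ha ih =>
    simp only [Finset.prod_insert ha]
    exact (hs a (Finset.mem_insert_self _ _)).mul
      (ih fun i hi => hs i (Finset.mem_insert_of_mem hi))

theorem ContinuousCoeffs.C_C {c : A → ℂ} (hc : ContinuousOn c U) :
    ContinuousCoeffs (σ := σ) U fun a => Polynomial.C (MvPolynomial.C (c a)) := by
  classical
  intro j m
  simp only [Polynomial.coeff_C]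
  split_ifs
  · simp only [MvPolynomial.coeff_C]
    split_ifs
    · exact hc
    · exact continuousOn_const
  · simpa using continuousOn_const

theorem ContinuousCoeffs.add {s t : A → Polynomial (MvPolynomial σ ℂ)}
    (hs : ContinuousCoeffs U s) (ht : ContinuousCoeffs U t) :
    ContinuousCoeffs U fun a => s a + t a := by
  intro j m
  simp only [Polynomial.coeff_add, MvPolynomial.coeff_add]
  exact (hs _ _).add (ht _ _)

theorem continuousOn_coeff_symLift (k d : ℕ) {G : A → Fin 2 → MvPolynomial (Fin 2) ℂ}
    (hG : ∀ i m, ContinuousOn (fun a => MvPolynomial.coeff m (G a i)) U) (j : Fin (k + 1))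
    (m : Fin (k + 1) →₀ ℕ) :
    ContinuousOn (fun a => MvPolynomial.coeff m (symLift k d (G a) j)) U := by
  suffices h : ContinuousCoeffs U fun a => symResultant k d (G a) from h j m
  simp only [symResultant, Polynomial.resultant, Matrix.det_apply]
  refine ContinuousCoeffs.sum _ fun τ _ => ?_
  have h : ContinuousCoeffs U fun a =>
      (∏ i, Polynomial.sylvester (genericForm k) (pencil k d (G a)) k d (τ i) i) := by
    refine ContinuousCoeffs.prod _ fun i _ => ?_
    induction i using Fin.addCases with
    | left i =>
      simp only [Polynomial.sylvester, Matrix.of_apply, Fin.addCases_left]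
      split_ifs
      · simp only [coeff_pencil]
        split_ifs
        · simp only [pencilCoeff]
          exact (ContinuousCoeffs.C_C (continuousOn_const.mul (hG _ _))).add
            ((ContinuousCoeffs.const _).mul
              (ContinuousCoeffs.C_C (continuousOn_const.mul (hG _ _))))
        · exact ContinuousCoeffs.const _
      · exact ContinuousCoeffs.const _
    | right i =>
      simp only [Polynomial.sylvester, Matrix.of_apply, Fin.addCases_right]
      exact ContinuousCoeffs.const _
  obtain h1 | h1 := Int.units_eq_one_or (Equiv.Perm.sign τ)
  · simpa only [h1, one_smul] using h
  · simp only [h1, Units.neg_smul, one_smul]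
    intro j m
    simp only [Polynomial.coeff_neg, MvPolynomial.coeff_neg]
    exact (h j m).neg

end ContinuousCoeffs

/-! ### Products of linear forms -/

/-- The coefficients of the product of a linear form and a form of degree `k`. -/
def mulLin {k : ℕ} (l : Fin 2 → ℂ) (p : Fin (k + 1) → ℂ) : Fin (k + 1 + 1) → ℂ :=
  fun j => l 0 * Fin.snoc (α := fun _ => ℂ) p 0 j + l 1 * Fin.cons (α := fun _ => ℂ) 0 p j

theorem coeff_linear_mul (a b : ℂ) (p : Polynomial ℂ) (j : ℕ) :
    ((Polynomial.C a + Polynomial.C b * Polynomial.X) * p).coeff j =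
      a * p.coeff j + b * (if j = 0 then 0 else p.coeff (j - 1)) := by
  rw [add_mul, Polynomial.coeff_add, Polynomial.coeff_C_mul, mul_assoc, Polynomial.coeff_C_mul]
  cases j with
  | zero => simp
  | succ j => simp [Polynomial.coeff_X_mul]

theorem mulLin_eq_coeff {k : ℕ} (l : Fin 2 → ℂ) (p : Polynomial ℂ) (hp : p.natDegree ≤ k)
    (j : Fin (k + 1 + 1)) :
    mulLin l (fun i : Fin (k + 1) => p.coeff i) j =
      ((Polynomial.C (l 0) + Polynomial.C (l 1) * Polynomial.X) * p).coeff j := by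
  rw [coeff_linear_mul, mulLin]
  congr 2
  · induction j using Fin.lastCases with
    | last =>
      rw [Fin.snoc_last, Polynomial.coeff_eq_zero_of_natDegree_lt]
      simp only [Fin.val_last]
      omega
    | cast j => simp
  · induction j using Fin.cases with
    | zero => simp
    | succ j => simp

theorem symVec_succAbove {k : ℕ} (v : Fin (k + 1) → Fin 2 → ℂ) (i : Fin (k + 1)) :
    symVec v = mulLin (v i) (symVec fun j => v (i.succAbove j)) := by
  funext j
  unfold symVec
  rw [mulLin_eq_coeff _ _ (natDegree_symForm_le _), symForm, Fin.prod_univ_succAbove _ i]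
  rfl

theorem symVec_zero (v : Fin 0 → Fin 2 → ℂ) : symVec v = fun _ => 1 := by
  funext j
  fin_cases j
  simp [symVec, symForm]

theorem mulLin_smul {k : ℕ} (l : Fin 2 → ℂ) (s : ℂ) (p : Fin (k + 1) → ℂ) :
    mulLin l (s • p) = s • mulLin l p := by
  funext j
  have h1 : Fin.snoc (α := fun _ => ℂ) (s • p) 0 j = s * Fin.snoc (α := fun _ => ℂ) p 0 j := by
    induction j using Fin.lastCases <;> simp
  have h2 : Fin.cons (α := fun _ => ℂ) 0 (s • p) j = s * Fin.cons (α := fun _ => ℂ) 0 p j := by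
    induction j using Fin.cases <;> simp
  simp only [mulLin, h1, h2, Pi.smul_apply, smul_eq_mul]
  ring

theorem mulLin_add {k : ℕ} (l : Fin 2 → ℂ) (p q : Fin (k + 1) → ℂ) :
    mulLin l (p + q) = mulLin l p + mulLin l q := by
  funext j
  have h1 : Fin.snoc (α := fun _ => ℂ) (p + q) 0 j =
      Fin.snoc (α := fun _ => ℂ) p 0 j + Fin.snoc (α := fun _ => ℂ) q 0 j := by
    induction j using Fin.lastCases <;> simp
  have h2 : Fin.cons (α := fun _ => ℂ) 0 (p + q) j =
      Fin.cons (α := fun _ => ℂ) 0 p j + Fin.cons (α := fun _ => ℂ) 0 q j := by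
    induction j using Fin.cases <;> simp
  simp only [mulLin, h1, h2, Pi.add_apply]
  ring

theorem smul_mulLin {k : ℕ} (l : Fin 2 → ℂ) (s : ℂ) (p : Fin (k + 1) → ℂ) :
    mulLin (s • l) p = s • mulLin l p := by
  funext j
  simp only [mulLin, Pi.smul_apply, smul_eq_mul]
  ring

theorem add_mulLin {k : ℕ} (l m : Fin 2 → ℂ) (p : Fin (k + 1) → ℂ) :
    mulLin (l + m) p = mulLin l p + mulLin m p := by
  funext j
  simp only [mulLin, Pi.add_apply]
  ring

theorem symVec_smul {k : ℕ} (t : Fin k → ℂ) (v : Fin k → Fin 2 → ℂ) :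
    symVec (fun i => t i • v i) = (∏ i, t i) • symVec v := by
  have : symForm (fun i => t i • v i) = Polynomial.C (∏ i, t i) * symForm v := by
    rw [symForm, symForm, map_prod, ← Finset.prod_mul_distrib]
    refine Finset.prod_congr rfl fun i _ => ?_
    simp only [Pi.smul_apply, smul_eq_mul, Polynomial.C_mul]
    ring
  funext j
  rw [symVec, this, Polynomial.coeff_C_mul]
  rfl

/-- The value of a binary form with coefficients `q`. -/
def formEval {k : ℕ} (q : Fin (k + 1) → ℂ) (x : Fin 2 → ℂ) : ℂ :=
  ∑ j : Fin (k + 1), q j * (x 0 ^ (k - j) * x 1 ^ (j : ℕ))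

theorem formEval_mulLin {k : ℕ} (l : Fin 2 → ℂ) (p : Fin (k + 1) → ℂ) (x : Fin 2 → ℂ) :
    formEval (mulLin l p) x = (l 0 * x 0 + l 1 * x 1) * formEval p x := by
  simp only [formEval, mulLin, add_mul, Finset.sum_add_distrib]
  congr 1
  · rw [Fin.sum_univ_castSucc, Finset.mul_sum]
    simp only [Fin.snoc_castSucc, Fin.snoc_last, mul_zero, zero_mul, add_zero, Fin.val_castSucc]
    refine Finset.sum_congr rfl fun j _ => ?_
    rw [show k + 1 - (j : ℕ) = (k - j) + 1 by omega, pow_succ]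
    ring
  · rw [Fin.sum_univ_succ, Finset.mul_sum]
    simp only [Fin.cons_zero, Fin.cons_succ, mul_zero, zero_mul, zero_add, Fin.val_succ]
    refine Finset.sum_congr rfl fun j _ => ?_
    rw [show k + 1 - ((j : ℕ) + 1) = k - j by omega, pow_succ]
    ring

theorem formEval_symVec {k : ℕ} (v : Fin k → Fin 2 → ℂ) (x : Fin 2 → ℂ) :
    formEval (symVec v) x = ∏ i, (v i 0 * x 0 + v i 1 * x 1) := by
  induction k with
  | zero => simp [symVec_zero, formEval]
  | succ k ih =>
    rw [symVec_succAbove v 0, formEval_mulLin, ih, Fin.prod_univ_succ]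
    simp

theorem formEval_smul {k : ℕ} (s : ℂ) (q : Fin (k + 1) → ℂ) (x : Fin 2 → ℂ) :
    formEval (s • q) x = s * formEval q x := by
  simp [formEval, Finset.mul_sum, mul_assoc]

/-- A nonzero binary form of positive degree has a linear factor. -/
theorem exists_eq_mulLin {k : ℕ} (q : Fin (k + 1 + 1) → ℂ) :
    ∃ (l : Fin 2 → ℂ) (p : Fin (k + 1) → ℂ), l ≠ 0 ∧ q = mulLin l p := by
  by_cases hq : q (Fin.last _) = 0
  · refine ⟨![1, 0], fun i => q i.castSucc, fun h => by simpa using congrFun h 0, ?_⟩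
    funext j
    induction j using Fin.lastCases with
    | last => simp [mulLin, hq]
    | cast j => simp [mulLin]
  · let Q : Polynomial ℂ := ∑ j : Fin (k + 1 + 1), Polynomial.C (q j) * Polynomial.X ^ (j : ℕ)
    have hc (j : Fin (k + 1 + 1)) : Q.coeff j = q j := by
      simp only [Q, Polynomial.finsetSum_coeff, Polynomial.coeff_C_mul_X_pow, Fin.val_inj]
      simp
    have hdeg : Q.natDegree ≤ k + 1 := by
      refine Polynomial.natDegree_sum_le_of_forall_le _ _ fun j _ => ?_
      exact (Polynomial.natDegree_C_mul_X_pow_le _ _).trans (by omega)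
    have hd : Q.degree ≠ 0 := by
      intro h
      have h1 := hc (Fin.last _)
      rw [Polynomial.coeff_eq_zero_of_degree_lt] at h1
      · exact hq h1.symm
      · rw [h]; simp only [Fin.val_last]; exact_mod_cast Nat.succ_pos k
    obtain ⟨x, hx⟩ := IsAlgClosed.exists_root Q hd
    obtain ⟨R, hR⟩ := Polynomial.dvd_iff_isRoot.2 hx
    have hR' : Q = (Polynomial.C (-x) + Polynomial.C 1 * Polynomial.X) * R := by
      rw [hR, Polynomial.C_neg, Polynomial.C_1]
      ring
    have hRd : R.natDegree ≤ k := by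
      by_cases h0 : R = 0
      · simp [h0]
      · rw [hR, Polynomial.natDegree_mul (Polynomial.X_sub_C_ne_zero x) h0,
          Polynomial.natDegree_X_sub_C] at hdeg
        omega
    refine ⟨![-x, 1], fun i => R.coeff i, fun h => by simpa using congrFun h 1, ?_⟩
    funext j
    rw [mulLin_eq_coeff _ _ hRd, ← hc]
    simpa using congrArg (fun p => Polynomial.coeff p j) hR'

theorem exists_eq_smul_symVec {k : ℕ} (q : Fin (k + 1) → ℂ) (hq : q ≠ 0) :
    ∃ (s : ℂ) (v : Fin k → Fin 2 → ℂ), s ≠ 0 ∧ (∀ i, v i ≠ 0) ∧ q = s • symVec v := by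
  induction k with
  | zero =>
    refine ⟨q 0, Fin.elim0, fun h => hq ?_, fun i => i.elim0, ?_⟩
    · funext i; fin_cases i; exact h
    · funext i; fin_cases i; simp [symVec_zero]
  | succ k ih =>
    obtain ⟨l, p, hl, rfl⟩ := exists_eq_mulLin q
    have hp : p ≠ 0 := by
      rintro rfl
      apply hq
      have := mulLin_smul l 0 (0 : Fin (k + 1) → ℂ)
      simpa using this
    obtain ⟨s, v, hs, hv, rfl⟩ := ih p hp
    refine ⟨s, Fin.cons l v, hs, fun i => ?_, ?_⟩
    · induction i using Fin.cases with
      | zero => simpa using hl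
      | succ i => simpa using hv i
    · rw [mulLin_smul, symVec_succAbove (Fin.cons l v) 0]
      simp

/-! ### The quotient map `(ℙ^1)^k → ℙ^k` -/

theorem symMap_mk {k : ℕ} (v : Fin k → Fin 2 → ℂ) (hv : ∀ i, v i ≠ 0) :
    symMap (fun i => Projectivization.mk ℂ (v i) (hv i)) =
      Projectivization.mk ℂ (symVec v) (symVec_ne_zero v hv) := by
  choose t ht h using fun i => exists_rep_mk (hv i)
  rw [symMap, Projectivization.mk_eq_mk_iff']
  refine ⟨∏ i, t i, ?_⟩
  simp only [h, symVec_smul]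

theorem symMap_surjective {k : ℕ} : Function.Surjective (symMap (k := k)) := by
  intro P
  induction P using Projectivization.ind with
  | h q hq =>
    obtain ⟨s, v, hs, hv, rfl⟩ := exists_eq_smul_symVec q hq
    refine ⟨fun i => Projectivization.mk ℂ (v i) (hv i), ?_⟩
    rw [symMap_mk, Projectivization.mk_eq_mk_iff']
    exact ⟨s⁻¹, inv_smul_smul₀ hs _⟩

/-- The points of a tuple are determined by its image in the symmetric product. -/
theorem exists_eq_of_symMap_eq {k : ℕ} {x y : Fin k → PSpace 1} (h : symMap x = symMap y)
    (i : Fin k) : ∃ j, x i = y j := by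
  rw [symMap, symMap, Projectivization.mk_eq_mk_iff'] at h
  obtain ⟨s, hs⟩ := h
  have h1 := formEval_symVec (fun i => (x i).rep) ![(x i).rep 1, -(x i).rep 0]
  have hs0 : s ≠ 0 := by
    rintro rfl
    rw [zero_smul] at hs
    exact symVec_ne_zero _ (fun i => (x i).rep_nonzero) hs.symm
  rw [Finset.prod_eq_zero (Finset.mem_univ i) (by simp; ring), ← hs, formEval_smul,
    formEval_symVec, mul_eq_zero, or_iff_right hs0, Finset.prod_eq_zero_iff] at h1
  obtain ⟨j, _, hj⟩ := h1
  refine ⟨j, ?_⟩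
  rw [← (x i).mk_rep, ← (y j).mk_rep, mk_eq_mk_iff_mul_eq_mul]
  simp at hj
  intro a b
  fin_cases a <;> fin_cases b <;> simp only [Fin.zero_eta, Fin.mk_one]
  · linear_combination -hj
  · linear_combination hj

/-! ### Symmetric products of maps -/

theorem eval_smul_of_isHomogeneous {σ : Type*} [Fintype σ] {d : ℕ} {p : MvPolynomial σ ℂ}
    (hp : p.IsHomogeneous d) (s : ℂ) (v : σ → ℂ) :
    MvPolynomial.eval (s • v) p = s ^ d * MvPolynomial.eval v p := by
  rw [MvPolynomial.eval_eq', MvPolynomial.eval_eq', Finset.mul_sum]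
  refine Finset.sum_congr rfl fun m hm => ?_
  have := hp.degree_eq_sum_deg_support hm
  rw [← Finsupp.degree_apply, Finsupp.degree_eq_sum] at this
  simp only [Pi.smul_apply, smul_eq_mul, mul_pow, Finset.prod_mul_distrib]
  rw [Finset.prod_pow_eq_pow_sum, ← this]
  ring

theorem IsLift.symMap_comp {k d : ℕ} {G : Fin 2 → MvPolynomial (Fin 2) ℂ}
    {f : PSpace 1 → PSpace 1} (h : IsLift d G f) (v : Fin k → Fin 2 → ℂ) (hv : ∀ i, v i ≠ 0) :
    ∃ h0 : (fun j => MvPolynomial.eval (symVec v) (symLift k d G j)) ≠ 0,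
      symMap (fun i => f (Projectivization.mk ℂ (v i) (hv i))) = Projectivization.mk ℂ _ h0 := by
  choose h1 h2 using fun i => h.2 (v i) (hv i)
  rw [eval_symLift h.1]
  refine ⟨symVec_ne_zero _ h1, ?_⟩
  simp only [h2]
  exact symMap_mk _ h1

theorem exists_isSymProduct (k : ℕ) {d : ℕ} {G : Fin 2 → MvPolynomial (Fin 2) ℂ}
    {f : PSpace 1 → PSpace 1} (h : IsLift d G f) : ∃ F, IsSymProduct k f F := by
  refine ⟨fun P => symMap fun i => f ((symMap_surjective P).choose i), fun x => ?_⟩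
  set y := (symMap_surjective (symMap x)).choose with hy
  have hyx : symMap y = symMap x := (symMap_surjective (symMap x)).choose_spec
  rw [symMap, symMap, Projectivization.mk_eq_mk_iff'] at hyx
  obtain ⟨s, hs⟩ := hyx
  obtain ⟨h1, h2⟩ := h.symMap_comp (fun i => (y i).rep) fun i => (y i).rep_nonzero
  obtain ⟨h3, h4⟩ := h.symMap_comp (fun i => (x i).rep) fun i => (x i).rep_nonzero
  simp only [Projectivization.mk_rep] at h2 h4
  change (symMap fun i => f (y i)) = _
  rw [h2, h4, Projectivization.mk_eq_mk_iff']
  refine ⟨s ^ d, funext fun j => ?_⟩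
  rw [← hs, eval_smul_of_isHomogeneous (isHomogeneous_symLift k d G j)]
  rfl

theorem IsSymProduct.unique {k : ℕ} {f : PSpace 1 → PSpace 1} {F F' : PSpace k → PSpace k}
    (h : IsSymProduct k f F) (h' : IsSymProduct k f F') : F = F' := by
  funext P
  obtain ⟨x, rfl⟩ := symMap_surjective P
  rw [h, h']

theorem IsSymProduct.isLift {k d : ℕ} {G : Fin 2 → MvPolynomial (Fin 2) ℂ}
    {f : PSpace 1 → PSpace 1} {F : PSpace k → PSpace k} (hF : IsSymProduct k f F)
    (h : IsLift d G f) : IsLift d (symLift k d G) F := by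
  refine ⟨isHomogeneous_symLift k d G, fun q hq => ?_⟩
  obtain ⟨s, v, hs, hv, rfl⟩ := exists_eq_smul_symVec q hq
  obtain ⟨h1, h2⟩ := h.symMap_comp v hv
  have h3 : (fun j => MvPolynomial.eval (s • symVec v) (symLift k d G j)) =
      s ^ d • fun j => MvPolynomial.eval (symVec v) (symLift k d G j) := by
    funext j
    rw [eval_smul_of_isHomogeneous (isHomogeneous_symLift k d G j)]
    rfl
  simp only [h3]
  refine ⟨smul_ne_zero (pow_ne_zero _ hs) h1, ?_⟩
  have h4 : Projectivization.mk ℂ (s • symVec v) hq =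
      symMap fun i => Projectivization.mk ℂ (v i) (hv i) := by
    rw [symMap_mk, Projectivization.mk_eq_mk_iff']
    exact ⟨s, rfl⟩
  rw [h4, hF, h2, Projectivization.mk_eq_mk_iff']
  exact ⟨(s ^ d)⁻¹, inv_smul_smul₀ (pow_ne_zero _ hs) _⟩

theorem IsSymProduct.iterate {k : ℕ} {f : PSpace 1 → PSpace 1} {F : PSpace k → PSpace k}
    (hF : IsSymProduct k f F) (n : ℕ) : IsSymProduct k (f^[n]) (F^[n]) := by
  induction n with
  | zero => exact fun _ => rfl
  | succ n ih =>
    intro x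
    rw [Function.iterate_succ_apply', ih, hF]
    simp only [Function.iterate_succ_apply']

/-! ### Simple fixed points -/

theorem exists_eq_sum_mul_X_sub_C {N : ℕ} (z : Fin N → ℂ) (p : MvPolynomial (Fin N) ℂ) :
    ∃ r : Fin N → MvPolynomial (Fin N) ℂ,
      p = MvPolynomial.C (MvPolynomial.eval z p) +
        ∑ j, r j * (MvPolynomial.X j - MvPolynomial.C (z j)) := by
  classical
  induction p using MvPolynomial.induction_on with
  | C a => exact ⟨0, by simp⟩
  | add p q hp hq =>
    obtain ⟨r, hr⟩ := hp
    obtain ⟨s, hs⟩ := hq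
    refine ⟨r + s, ?_⟩
    simp only [Pi.add_apply, add_mul, Finset.sum_add_distrib, map_add]
    linear_combination hr + hs
  | mul_X p i hp =>
    obtain ⟨r, hr⟩ := hp
    refine ⟨fun j => r j * MvPolynomial.X i +
      if j = i then MvPolynomial.C (MvPolynomial.eval z p) else 0, ?_⟩
    simp only [add_mul, Finset.sum_add_distrib, ite_mul, zero_mul, Finset.sum_ite_eq',
      Finset.mem_univ, if_true, map_mul, MvPolynomial.eval_X]
    have : ∑ j, r j * MvPolynomial.X i * (MvPolynomial.X j - MvPolynomial.C (z j)) =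
        (∑ j, r j * (MvPolynomial.X j - MvPolynomial.C (z j))) * MvPolynomial.X i := by
      rw [Finset.sum_mul]
      exact Finset.sum_congr rfl fun j _ => by ring
    rw [this]
    linear_combination MvPolynomial.X i * hr

theorem X_sub_C_mem_pointIdeal {N : ℕ} (z : Fin N → ℂ) (j : Fin N) :
    MvPolynomial.X j - MvPolynomial.C (z j) ∈ pointIdeal z := by
  simp [pointIdeal, RingHom.mem_ker]

theorem pointIdeal_eq_span {N : ℕ} (z : Fin N → ℂ) : pointIdeal z =
    Ideal.span (Set.range fun j => MvPolynomial.X j - MvPolynomial.C (z j)) := by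
  apply le_antisymm
  · intro p hp
    obtain ⟨r, hr⟩ := exists_eq_sum_mul_X_sub_C z p
    rw [pointIdeal, RingHom.mem_ker] at hp
    rw [hr, hp, map_zero, zero_add]
    exact Ideal.sum_mem _ fun j _ => Ideal.mul_mem_left _ _ (Ideal.subset_span ⟨j, rfl⟩)
  · rw [Ideal.span_le]
    rintro _ ⟨j, rfl⟩
    exact X_sub_C_mem_pointIdeal z j

/-- The local ring of affine space at the point `z`. -/
abbrev PointRing {N : ℕ} (z : Fin N → ℂ) : Type := Localization.AtPrime (pointIdeal z)

theorem finrank_quotient_maximalIdeal {N : ℕ} (z : Fin N → ℂ) :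
    Module.finrank ℂ (Localization.AtPrime (pointIdeal z) ⧸
      IsLocalRing.maximalIdeal (Localization.AtPrime (pointIdeal z))) = 1 := by
  have h1 : (1 : PointRing z ⧸ IsLocalRing.maximalIdeal (PointRing z)) ≠ 0 := one_ne_zero
  refine (finrank_eq_one_iff_of_nonzero' _ h1).2 fun w => ?_
  obtain ⟨x, rfl⟩ := Ideal.Quotient.mk_surjective w
  obtain ⟨⟨a, s⟩, hx⟩ := IsLocalization.surj (pointIdeal z).primeCompl x
  have hs : MvPolynomial.eval z (s : MvPolynomial (Fin N) ℂ) ≠ 0 := s.2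
  refine ⟨MvPolynomial.eval z a / MvPolynomial.eval z (s : MvPolynomial (Fin N) ℂ), ?_⟩
  set c := MvPolynomial.eval z a / MvPolynomial.eval z (s : MvPolynomial (Fin N) ℂ) with hc
  have h2 : c • (1 : PointRing z ⧸ IsLocalRing.maximalIdeal (PointRing z)) =
      Ideal.Quotient.mk _ (algebraMap (MvPolynomial (Fin N) ℂ) (PointRing z) (MvPolynomial.C c)) := by
    rw [Algebra.smul_def, mul_one]
    rfl
  rw [h2, eq_comm, Ideal.Quotient.eq]
  have hu : IsUnit (algebraMap (MvPolynomial (Fin N) ℂ) (PointRing z) (s : MvPolynomial (Fin N) ℂ)) := IsLocalization.map_units (PointRing z) s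
  have h3 : (x - algebraMap (MvPolynomial (Fin N) ℂ) (PointRing z) (MvPolynomial.C c)) * algebraMap (MvPolynomial (Fin N) ℂ) (PointRing z) (s : MvPolynomial (Fin N) ℂ) ∈
      IsLocalRing.maximalIdeal (PointRing z) := by
    rw [sub_mul, hx, ← map_mul, ← map_sub, ← Localization.AtPrime.map_eq_maximalIdeal]
    refine Ideal.mem_map_of_mem _ ?_
    change _ ∈ RingHom.ker _
    rw [RingHom.mem_ker]
    simp [hc, div_mul_cancel₀ _ hs]
  rwa [Ideal.mul_unit_mem_iff_mem _ hu] at h3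

/-- A zero of `N` polynomials in `N` variables with invertible Jacobian has multiplicity one. -/
theorem finrank_localization_quotient_eq_one {N : ℕ} (z : Fin N → ℂ)
    (p : Fin N → MvPolynomial (Fin N) ℂ) (hp : ∀ l, MvPolynomial.eval z (p l) = 0)
    (T : (Fin N → ℂ) →L[ℂ] (Fin N → ℂ)) (hT : Function.Injective T)
    (hd : HasFDerivAt (fun y l => MvPolynomial.eval y (p l)) T z) :
    Module.finrank ℂ (Localization.AtPrime (pointIdeal z) ⧸
      (Ideal.span (Set.range p)).map (algebraMap (MvPolynomial (Fin N) ℂ)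
        (Localization.AtPrime (pointIdeal z)))) = 1 := by
  classical
  choose r hr using fun l => exists_eq_sum_mul_X_sub_C z (p l)
  simp only [hp, map_zero, zero_add] at hr
  have hd' (l : Fin N) : HasFDerivAt (fun y => MvPolynomial.eval y (p l))
      (∑ j, MvPolynomial.eval z (r l j) •
        (ContinuousLinearMap.proj j : (Fin N → ℂ) →L[ℂ] ℂ)) z := by
    have h1 : (fun y => MvPolynomial.eval y (p l)) =
        fun y => ∑ j, MvPolynomial.eval y (r l j) * (y j - z j) := by
      funext y
      conv_lhs => rw [hr l]
      simp
    rw [h1]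
    refine HasFDerivAt.fun_sum fun j _ => ?_
    have h2 := ((contDiff_eval (m := 1) (r l j)).differentiable
      (by simp)).differentiableAt.hasFDerivAt (x := z)
    have h3 : HasFDerivAt (fun y : Fin N → ℂ => y j - z j)
        (ContinuousLinearMap.proj j : (Fin N → ℂ) →L[ℂ] ℂ) z :=
      (hasFDerivAt_apply j z).sub_const _
    refine (h2.fun_mul h3).congr_fderiv (ContinuousLinearMap.ext fun w => ?_)
    simp
  have hTl (w : Fin N → ℂ) (l : Fin N) : T w l = ∑ j, MvPolynomial.eval z (r l j) * w j := by
    have h1 := (hasFDerivAt_pi'.1 hd l).unique (hd' l)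
    simpa using congrArg (fun φ : (Fin N → ℂ) →L[ℂ] ℂ => φ w) h1
  set M : Matrix (Fin N) (Fin N) ℂ := Matrix.of fun l j => MvPolynomial.eval z (r l j) with hM
  have hMT : M.mulVec = T := by
    funext w l
    rw [hTl]
    rfl
  have hMu : IsUnit M := by
    rw [← Matrix.mulVec_injective_iff_isUnit, hMT]
    exact hT
  have hMM : M⁻¹ * M = 1 := Matrix.nonsing_inv_mul M ((Matrix.isUnit_iff_isUnit_det M).1 hMu)
  set I : Ideal (MvPolynomial (Fin N) ℂ) := Ideal.span (Set.range p)
  have hIle : I ≤ pointIdeal z := by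
    rw [Ideal.span_le]
    rintro _ ⟨l, rfl⟩
    exact (RingHom.mem_ker).2 (hp l)
  have hle : pointIdeal z ≤ I ⊔ pointIdeal z * pointIdeal z := by
    conv_lhs => rw [pointIdeal_eq_span]
    rw [Ideal.span_le]
    rintro _ ⟨j, rfl⟩
    have h1 : ∑ l, MvPolynomial.C (M⁻¹ j l) * p l =
        ∑ i, (∑ l, MvPolynomial.C (M⁻¹ j l) * r l i) *
          (MvPolynomial.X i - MvPolynomial.C (z i)) := by
      simp only [Finset.sum_mul]
      rw [Finset.sum_comm]
      refine Finset.sum_congr rfl fun l _ => ?_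
      conv_lhs => rw [hr l, Finset.mul_sum]
      exact Finset.sum_congr rfl fun i _ => by ring
    have h2 : (MvPolynomial.X j - MvPolynomial.C (z j) : MvPolynomial (Fin N) ℂ) =
        ∑ i, MvPolynomial.C ((1 : Matrix (Fin N) (Fin N) ℂ) j i) *
          (MvPolynomial.X i - MvPolynomial.C (z i)) := by
      rw [Finset.sum_eq_single j]
      · simp
      · intro i _ hi
        simp [Matrix.one_apply_ne hi.symm]
      · simp
    have h3 : (MvPolynomial.X j - MvPolynomial.C (z j) : MvPolynomial (Fin N) ℂ) =
        (∑ l, MvPolynomial.C (M⁻¹ j l) * p l) +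
        ∑ i, (MvPolynomial.C ((1 : Matrix (Fin N) (Fin N) ℂ) j i) -
          ∑ l, MvPolynomial.C (M⁻¹ j l) * r l i) *
          (MvPolynomial.X i - MvPolynomial.C (z i)) := by
      rw [h1, ← Finset.sum_add_distrib, h2]
      refine Finset.sum_congr rfl fun i _ => ?_
      ring
    change (MvPolynomial.X j - MvPolynomial.C (z j) : MvPolynomial (Fin N) ℂ) ∈ _
    rw [h3]
    refine Submodule.add_mem_sup (Ideal.sum_mem _ fun l _ => Ideal.mul_mem_left _ _
      (Ideal.subset_span ⟨l, rfl⟩)) (Ideal.sum_mem _ fun i _ =>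
        Ideal.mul_mem_mul ?_ (X_sub_C_mem_pointIdeal z i))
    rw [pointIdeal, RingHom.mem_ker, ← hMM]
    simp [Matrix.mul_apply, hM]
  have hmap : (pointIdeal z).map (algebraMap (MvPolynomial (Fin N) ℂ) (PointRing z)) = IsLocalRing.maximalIdeal (PointRing z) :=
    Localization.AtPrime.map_eq_maximalIdeal
  have hI : I.map (algebraMap (MvPolynomial (Fin N) ℂ) (PointRing z)) = IsLocalRing.maximalIdeal (PointRing z) := by
    apply le_antisymm
    · rw [← hmap]
      exact Ideal.map_mono hIle
    · have hfg : (IsLocalRing.maximalIdeal (PointRing z)).FG := by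
        rw [← hmap]
        have h : (pointIdeal z).FG := by
          rw [pointIdeal_eq_span]
          exact Submodule.fg_span (Set.finite_range _)
        exact h.map _
      refine Submodule.le_of_le_smul_of_le_jacobson_bot hfg
        (IsLocalRing.maximalIdeal_le_jacobson _) ?_
      have h1 := Ideal.map_mono (f := algebraMap (MvPolynomial (Fin N) ℂ) (PointRing z)) hle
      rw [Ideal.map_sup, Ideal.map_mul, hmap] at h1
      exact h1
  have key : ∀ J : Ideal (PointRing z), J = IsLocalRing.maximalIdeal (PointRing z) → Module.finrank ℂ (PointRing z ⧸ J) = 1 := by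
    rintro _ rfl
    exact finrank_quotient_maximalIdeal z
  exact key _ hI

theorem eval_dehom {N : ℕ} (b : Fin (N + 1)) (p : MvPolynomial (Fin (N + 1)) ℂ)
    (z : Fin N → ℂ) :
    MvPolynomial.eval z (dehom b p) = MvPolynomial.eval (affineVec b z) p := by
  induction p using MvPolynomial.induction_on with
  | C a => simp [dehom]
  | add p q hp hq =>
    simp only [dehom, map_add] at hp hq ⊢
    rw [hp, hq]
  | mul_X p i hp =>
    simp only [dehom, map_mul, MvPolynomial.aeval_X, MvPolynomial.eval_X] at hp ⊢
    rw [hp]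
    congr 1
    revert i
    rw [Fin.forall_iff_succAbove b]
    exact ⟨by simp, fun l => by simp⟩

theorem hasFDerivAt_smul_sub {V : Type*} [NormedAddCommGroup V] [NormedSpace ℂ V] {B : V → ℂ}
    {M : V → V} {A : V →L[ℂ] V} {z : V} (hM : HasFDerivAt M A z) (hz : M z = z)
    (hB : DifferentiableAt ℂ B z) :
    HasFDerivAt (fun y => B y • (M y - y)) (B z • (A - ContinuousLinearMap.id ℂ V)) z := by
  have h := hB.hasFDerivAt.fun_smul (hM.fun_sub (hasFDerivAt_id z))
  simpa [hz] using h

/-- If `1` is not an eigenvalue, then `A - 1` is injective. -/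
theorem injective_smul_sub_id {V : Type*} [NormedAddCommGroup V] [NormedSpace ℂ V]
    [FiniteDimensional ℂ V] {A : V →L[ℂ] V}
    (hA : (LinearMap.charpoly (A : V →ₗ[ℂ] V)).eval 1 ≠ 0) {β : ℂ} (hβ : β ≠ 0) :
    Function.Injective (β • (A - ContinuousLinearMap.id ℂ V)) := by
  rw [injective_iff_map_eq_zero]
  intro w hw
  by_contra hw0
  apply hA
  change Polynomial.IsRoot _ _
  rw [← Module.End.hasEigenvalue_iff_isRoot_charpoly]
  refine Module.End.hasEigenvalue_of_hasEigenvector (x := w) ⟨?_, hw0⟩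
  rw [Module.End.mem_eigenspace_iff, one_smul]
  have : A w - w = 0 := by simpa [hβ] using hw
  exact sub_eq_zero.1 this

theorem fixedMult_eq_one {N d : ℕ} {G : Fin (N + 1) → MvPolynomial (Fin (N + 1)) ℂ}
    {g : PSpace N → PSpace N} (h : IsLift d G g) {P : PSpace N} (hP : g P = P)
    (h1 : (multiplierPoly g P).eval 1 ≠ 0) : fixedMult G P = 1 := by
  set b := chartIdx P with hb
  set z := toAffine b P with hz
  have hPz : ofAffine b z = P := ofAffine_chartIdx P
  have hgz : g (ofAffine b z) = ofAffine b z := by rw [hPz, hP]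
  have hrep : (g (ofAffine b z)).rep b ≠ 0 := by rw [hgz]; exact rep_ofAffine_ne_zero b z
  have hA : HasFDerivAt (chartMap b g) (fderiv ℂ (chartMap b g) z) z :=
    ((contDiffAt_chartMap (m := 1) h b z hrep).differentiableAt (by simp)).hasFDerivAt
  have hMz : chartMap b g z = z := by rw [chartMap, hgz, toAffine_ofAffine]
  set B : (Fin N → ℂ) → ℂ := fun y => MvPolynomial.eval (affineVec b y) (G b) with hBdef
  have hB : DifferentiableAt ℂ B z :=
    (((contDiff_eval (m := 1) (G b)).comp (contDiff_affineVec b)).differentiable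
      (by simp)).differentiableAt
  have hBz : B z ≠ 0 := (rep_apply_ofAffine_ne_zero_iff h b b z).1 hrep
  have hK := hasFDerivAt_smul_sub hA hMz hB
  refine finrank_localization_quotient_eq_one z
    (fun l => dehom b (G (b.succAbove l)) - MvPolynomial.X l * dehom b (G b)) ?_ _
    (injective_smul_sub_id h1 hBz) (hK.congr_of_eventuallyEq ?_)
  · intro l
    have := congrFun hMz l
    rw [chartMap_eq h] at this
    simp only [map_sub, map_mul, MvPolynomial.eval_X, eval_dehom]
    rw [div_eq_iff hBz] at this
    rw [this, sub_self]
  · filter_upwards [eventually_rep_apply_ofAffine_ne_zero h b b z hrep] with y hy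
    have hBy : B y ≠ 0 := (rep_apply_ofAffine_ne_zero_iff h b b y).1 hy
    funext l
    simp only [map_sub, map_mul, MvPolynomial.eval_X, eval_dehom, chartMap_eq h, Pi.smul_apply,
      Pi.sub_apply, smul_eq_mul, mul_sub]
    rw [mul_div_cancel₀ _ hBy, mul_comm (y l)]

/-! ### Maps of projective space given by maps of homogeneous coordinates -/

/-- The map `Φ` on homogeneous coordinates induces the map `g` of projective space. -/
def Induces {N : ℕ} (Φ : (Fin (N + 1) → ℂ) → Fin (N + 1) → ℂ) (g : PSpace N → PSpace N) : Prop :=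
  ∀ (v : Fin (N + 1) → ℂ) (hv : v ≠ 0), ∃ h : Φ v ≠ 0,
    g (Projectivization.mk ℂ v hv) = Projectivization.mk ℂ (Φ v) h

theorem Induces.chartMap_eq {N : ℕ} {Φ : (Fin (N + 1) → ℂ) → Fin (N + 1) → ℂ}
    {g : PSpace N → PSpace N} (h : Induces Φ g) (b : Fin (N + 1)) (z : Fin N → ℂ) :
    chartMap b g z = fun l => Φ (affineVec b z) (b.succAbove l) / Φ (affineVec b z) b := by
  obtain ⟨h1, h2⟩ := h _ (affineVec_ne_zero b z)
  rw [chartMap, ofAffine_eq, h2, toAffine_mk]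

theorem Induces.apply_ofAffine_eq_iff {N : ℕ} {Φ : (Fin (N + 1) → ℂ) → Fin (N + 1) → ℂ}
    {g : PSpace N → PSpace N} (h : Induces Φ g) (b : Fin (N + 1)) (z : Fin N → ℂ) :
    g (ofAffine b z) = ofAffine b z ↔
      (fun l => Φ (affineVec b z) (b.succAbove l) - z l * Φ (affineVec b z) b) = 0 := by
  obtain ⟨h1, h2⟩ := h _ (affineVec_ne_zero b z)
  rw [ofAffine_eq, h2]
  constructor
  · intro h3
    rw [mk_eq_mk_iff_mul_eq_mul] at h3
    funext l
    have := h3 (b.succAbove l) b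
    simp only [affineVec_same, affineVec_succAbove] at this
    simp only [Pi.zero_apply]
    linear_combination this
  · intro h3
    rw [Projectivization.mk_eq_mk_iff']
    refine ⟨Φ (affineVec b z) b, funext fun i => ?_⟩
    revert i
    rw [Fin.forall_iff_succAbove b]
    refine ⟨by simp, fun l => ?_⟩
    have := congrFun h3 l
    simp only [Pi.zero_apply] at this
    simp only [Pi.smul_apply, affineVec_succAbove, smul_eq_mul]
    linear_combination -this

theorem continuous_coeff_charpoly {N : ℕ} (j : ℕ) :
    Continuous fun A : (Fin N → ℂ) →L[ℂ] (Fin N → ℂ) =>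
      (LinearMap.charpoly (A : (Fin N → ℂ) →ₗ[ℂ] (Fin N → ℂ))).coeff j := by
  have h (A : (Fin N → ℂ) →L[ℂ] (Fin N → ℂ)) :
      (LinearMap.charpoly (A : (Fin N → ℂ) →ₗ[ℂ] (Fin N → ℂ))).coeff j =
      MvPolynomial.eval (fun p : Fin N × Fin N => A (Pi.single p.2 1) p.1)
        ((Matrix.charpoly.univ ℂ (Fin N)).coeff j) := by
    have h1 := Matrix.charpoly.univ_coeff_eval₂Hom (Fin N) (RingHom.id ℂ)
      (fun p : Fin N × Fin N => A (Pi.single p.2 1) p.1) j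
    rw [← LinearMap.charpoly_toMatrix _ (Pi.basisFun ℂ (Fin N))]
    refine Eq.trans ?_ h1.symm
    congr 2
  simp only [h]
  refine (MvPolynomial.continuous_eval _).comp ?_
  refine continuous_pi fun p => ?_
  exact (continuous_apply p.1).comp
    (ContinuousLinearMap.apply ℂ (Fin N → ℂ) (Pi.single p.2 1 : Fin N → ℂ)).continuous

/-- A nondegenerate fixed point of a member of a family extends to a branch of fixed points of
the nearby members. -/
theorem exists_fixed_branch {A W : Type*} [TopologicalSpace A] [NormedAddCommGroup W]
    [NormedSpace ℂ W] [CompleteSpace W] {N : ℕ}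
    (Φ : W × (Fin (N + 1) → ℂ) → Fin (N + 1) → ℂ) (hΦ : ContDiff ℂ 2 Φ)
    (g : A → PSpace N → PSpace N) (hlift : ∀ a, ∃ D G, IsLift D G (g a)) (c : A → W) (a₀ : A)
    (hc : ContinuousAt c a₀) (hg : ∀ᶠ a in 𝓝 a₀, Induces (fun v => Φ (c a, v)) (g a))
    (P : PSpace N) (hP : g a₀ P = P) (h1 : (multiplierPoly (g a₀) P).eval 1 ≠ 0) :
    ∃ w : A → Fin (N + 1) → ℂ, ∃ hw : ∀ a, w a ≠ 0,
      Projectivization.mk ℂ (w a₀) (hw a₀) = P ∧ ContinuousAt w a₀ ∧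
      (∀ᶠ a in 𝓝 a₀, g a (Projectivization.mk ℂ (w a) (hw a)) =
        Projectivization.mk ℂ (w a) (hw a)) ∧
      (∀ j, Filter.Tendsto
        (fun a => (multiplierPoly (g a) (Projectivization.mk ℂ (w a) (hw a))).coeff j) (𝓝 a₀)
        (𝓝 ((multiplierPoly (g a₀) P).coeff j))) ∧
      ∀ (v₀ : Fin (N + 1) → ℂ) (hv₀ : v₀ ≠ 0), Projectivization.mk ℂ v₀ hv₀ = P →
        ∀ᶠ q : A × (Fin (N + 1) → ℂ) in 𝓝 (a₀, v₀), ∀ hv : q.2 ≠ 0,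
          g q.1 (Projectivization.mk ℂ q.2 hv) = Projectivization.mk ℂ q.2 hv →
          Projectivization.mk ℂ q.2 hv = Projectivization.mk ℂ (w q.1) (hw q.1) := by
  set b := chartIdx P with hb
  set z := toAffine b P with hz
  have hPz : ofAffine b z = P := ofAffine_chartIdx P
  have hgz : g a₀ (ofAffine b z) = ofAffine b z := by rw [hPz, hP]
  have hrep : (g a₀ (ofAffine b z)).rep b ≠ 0 := by rw [hgz]; exact rep_ofAffine_ne_zero b z
  have hg0 : Induces (fun v => Φ (c a₀, v)) (g a₀) := hg.self_of_nhds
  obtain ⟨D, G, hG⟩ := hlift a₀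
  -- the equation of the fixed points
  have haff : ContDiff ℂ 2 fun q : W × (Fin N → ℂ) => (q.1, affineVec b q.2) :=
    contDiff_fst.prodMk ((contDiff_affineVec b).comp contDiff_snd)
  have hΦi (i) : ContDiff ℂ 2 fun q : W × (Fin N → ℂ) => Φ (q.1, affineVec b q.2) i :=
    contDiff_pi.1 (hΦ.comp haff) i
  set K : W × (Fin N → ℂ) → Fin N → ℂ := fun q l =>
    Φ (q.1, affineVec b q.2) (b.succAbove l) - q.2 l * Φ (q.1, affineVec b q.2) b with hKdef
  have hK : ContDiff ℂ 2 K := by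
    refine contDiff_pi.2 fun l => (hΦi _).sub (ContDiff.mul ?_ (hΦi _))
    exact (contDiff_apply ℂ ℂ l).comp contDiff_snd
  have hK0 : K (c a₀, z) = 0 := (hg0.apply_ofAffine_eq_iff b z).1 hgz
  have hKs : HasStrictFDerivAt K (fderiv ℂ K (c a₀, z)) (c a₀, z) :=
    hK.contDiffAt.hasStrictFDerivAt (by simp)
  -- its derivative
  have hA : HasFDerivAt (chartMap b (g a₀)) (fderiv ℂ (chartMap b (g a₀)) z) z :=
    ((contDiffAt_chartMap (m := 1) hG b z hrep).differentiableAt (by simp)).hasFDerivAt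
  have hMz : chartMap b (g a₀) z = z := by rw [chartMap, hgz, toAffine_ofAffine]
  have hinc (x : W) (y : Fin N → ℂ) : HasFDerivAt (fun y' : Fin N → ℂ => (x, y'))
      (ContinuousLinearMap.inr ℂ W (Fin N → ℂ)) y := hasFDerivAt_prodMk_right x y
  have hBd (i) : DifferentiableAt ℂ (fun y => Φ (c a₀, affineVec b y) i) z :=
    (((hΦi i).differentiable (by simp)).differentiableAt (x := (c a₀, z))).comp z
      (hinc _ _).differentiableAt
  have hBz : Φ (c a₀, affineVec b z) b ≠ 0 := by
    obtain ⟨h2, h3⟩ := hg0 _ (affineVec_ne_zero b z)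
    rw [ofAffine_eq, h3, rep_mk_ne_zero_iff] at hrep
    exact hrep
  have hKz : HasFDerivAt (fun y => K (c a₀, y)) (Φ (c a₀, affineVec b z) b •
      (fderiv ℂ (chartMap b (g a₀)) z - ContinuousLinearMap.id ℂ _)) z := by
    refine (hasFDerivAt_smul_sub hA hMz (hBd b)).congr_of_eventuallyEq ?_
    filter_upwards [(hBd b).continuousAt.eventually_ne hBz] with y hy
    funext l
    simp only [hKdef, hg0.chartMap_eq, Pi.smul_apply, Pi.sub_apply, smul_eq_mul, mul_sub]
    rw [mul_div_cancel₀ _ hy, mul_comm (y l)]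
  have hinr : (fderiv ℂ K (c a₀, z)).comp (ContinuousLinearMap.inr ℂ W (Fin N → ℂ)) =
      Φ (c a₀, affineVec b z) b •
      (fderiv ℂ (chartMap b (g a₀)) z - ContinuousLinearMap.id ℂ _) :=
    (HasFDerivAt.comp z hKs.hasFDerivAt (hinc _ _)).unique hKz
  have hinv : ((fderiv ℂ K (c a₀, z)).comp
      (ContinuousLinearMap.inr ℂ W (Fin N → ℂ))).IsInvertible := by
    have hinj : Function.Injective ((fderiv ℂ K (c a₀, z)).comp
        (ContinuousLinearMap.inr ℂ W (Fin N → ℂ))) := by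
      rw [hinr]
      exact injective_smul_sub_id h1 hBz
    refine ⟨(LinearEquiv.ofInjectiveEndo _ hinj).toContinuousLinearEquiv, ?_⟩
    ext w l
    rfl
  set φ := hKs.implicitFunctionOfProdDomain hinv with hφ
  have hφt : Filter.Tendsto φ (𝓝 (c a₀)) (𝓝 z) :=
    hKs.tendsto_implicitFunctionOfProdDomain hinv
  have hφK : ∀ᶠ x in 𝓝 (c a₀), K (x, φ x) = K (c a₀, z) :=
    hKs.eventually_apply_implicitFunctionOfProdDomain hinv
  have hφu : ∀ᶠ q in 𝓝 (c a₀, z), K q = K (c a₀, z) ↔ φ q.1 = q.2 :=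
    hKs.eventually_apply_eq_iff_implicitFunctionOfProdDomain hinv
  have hφ0 : φ (c a₀) = z := hφu.self_of_nhds.1 rfl
  have hct : Filter.Tendsto c (𝓝 a₀) (𝓝 (c a₀)) := hc
  have hφc : Filter.Tendsto (fun a => φ (c a)) (𝓝 a₀) (𝓝 z) := hφt.comp hct
  refine ⟨fun a => affineVec b (φ (c a)), fun a => affineVec_ne_zero _ _, ?_, ?_, ?_, ?_, ?_⟩
  · simp only [hφ0]
    rw [← ofAffine_eq, hPz]
  · have h2 : Filter.Tendsto (fun a => affineVec b (φ (c a))) (𝓝 a₀) (𝓝 (affineVec b z)) :=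
      ((contDiff_affineVec (m := 0) b).continuous.tendsto z).comp hφc
    rw [← hφ0] at h2
    exact h2
  · filter_upwards [hg, hct.eventually hφK] with a ha hKa
    rw [← ofAffine_eq, ha.apply_ofAffine_eq_iff]
    rw [hK0] at hKa
    exact hKa
  · intro j
    set R : W × (Fin N → ℂ) → Fin N → ℂ := fun q l =>
      Φ (q.1, affineVec b q.2) (b.succAbove l) / Φ (q.1, affineVec b q.2) b with hRdef
    have hR : ContDiffAt ℂ 2 R (c a₀, z) :=
      contDiffAt_pi.2 fun l => (hΦi _).contDiffAt.div (hΦi _).contDiffAt hBz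
    have hR' : ContinuousAt (fderiv ℂ R) (c a₀, z) :=
      (hR.fderiv_right (m := 1) (by norm_num)).continuousAt
    have hpair : Filter.Tendsto (fun a => (c a, φ (c a))) (𝓝 a₀) (𝓝 (c a₀, z)) :=
      hct.prodMk_nhds hφc
    have hRe : ∀ᶠ q in 𝓝 (c a₀, z), ContDiffAt ℂ 2 R q := hR.eventually (by simp)
    have hchart (a : A) (ha : Induces (fun v => Φ (c a, v)) (g a)) (y : Fin N → ℂ)
        (hy : ContDiffAt ℂ 2 R (c a, y)) : fderiv ℂ (chartMap b (g a)) y =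
        (fderiv ℂ R (c a, y)).comp (ContinuousLinearMap.inr ℂ W (Fin N → ℂ)) := by
      have h2 : chartMap b (g a) = fun y' => R (c a, y') := funext fun y' => ha.chartMap_eq b y'
      rw [h2]
      exact (HasFDerivAt.comp y (hy.differentiableAt (by simp)).hasFDerivAt
        (hinc _ _)).fderiv
    have hlim : Filter.Tendsto (fun a => (fderiv ℂ R (c a, φ (c a))).comp
        (ContinuousLinearMap.inr ℂ W (Fin N → ℂ))) (𝓝 a₀)
        (𝓝 ((fderiv ℂ R (c a₀, z)).comp (ContinuousLinearMap.inr ℂ W (Fin N → ℂ)))) :=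
      Filter.Tendsto.comp (g := fun T : (W × (Fin N → ℂ)) →L[ℂ] (Fin N → ℂ) =>
        T.comp (ContinuousLinearMap.inr ℂ W (Fin N → ℂ)))
        ((by fun_prop : Continuous fun T : (W × (Fin N → ℂ)) →L[ℂ] (Fin N → ℂ) =>
        T.comp (ContinuousLinearMap.inr ℂ W (Fin N → ℂ))).tendsto _) (hR'.tendsto.comp hpair)
    have hlim' := ((continuous_coeff_charpoly j).tendsto _).comp hlim
    rw [← hchart a₀ hg0 z hR] at hlim'
    refine hlim'.congr' ?_
    filter_upwards [hg, hct.eventually hφK, hpair.eventually hRe] with a ha hKa hRa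
    rw [hK0] at hKa
    have hfix := (ha.apply_ofAffine_eq_iff b (φ (c a))).2 hKa
    obtain ⟨D', G', hG'⟩ := hlift a
    rw [← ofAffine_eq, multiplierPoly_eq hG' _ hfix b (rep_ofAffine_ne_zero _ _),
      toAffine_ofAffine, hchart a ha _ hRa]
    rfl
  · intro v₀ hv₀ hv₀P
    have hv₀b : v₀ b ≠ 0 := by
      rw [← rep_mk_ne_zero_iff hv₀, hv₀P]
      exact rep_chartIdx_ne_zero P
    have hv₀z : (fun l => v₀ (b.succAbove l) / v₀ b) = z := by
      rw [← toAffine_mk hv₀, hv₀P]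
    have hcoord : Filter.Tendsto (fun q : A × (Fin (N + 1) → ℂ) =>
        (c q.1, fun l => q.2 (b.succAbove l) / q.2 b)) (𝓝 (a₀, v₀)) (𝓝 (c a₀, z)) := by
      refine (hct.comp (continuous_fst.tendsto (a₀, v₀))).prodMk_nhds ?_
      rw [← hv₀z, tendsto_pi_nhds]
      intro l
      have hap (i) : Filter.Tendsto (fun q : A × (Fin (N + 1) → ℂ) => q.2 i) (𝓝 (a₀, v₀))
          (𝓝 (v₀ i)) := ((continuous_apply i).comp continuous_snd).tendsto (a₀, v₀)
      exact (hap _).div (hap b) hv₀b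
    have hne : ∀ᶠ q : A × (Fin (N + 1) → ℂ) in 𝓝 (a₀, v₀), q.2 b ≠ 0 :=
      ((continuous_apply b).comp continuous_snd).continuousAt.eventually_ne hv₀b
    filter_upwards [hne, hcoord.eventually hφu,
      (continuous_fst.tendsto (a₀, v₀)).eventually hg] with q hqb hqu hqg hq hfix
    have hq' : Projectivization.mk ℂ q.2 hq =
        ofAffine b fun l => q.2 (b.succAbove l) / q.2 b := by
      rw [ofAffine_eq, Projectivization.mk_eq_mk_iff']
      exact ⟨q.2 b, smul_affineVec_div q.2 b hqb⟩
    rw [hq', hqg.apply_ofAffine_eq_iff] at hfix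
    rw [hK0] at hqu
    rw [hq', ofAffine_eq]
    simp only [hqu.1 hfix]

/-! ### The space of coefficients -/

/-- The exponents of the monomials of degree `d` in `N + 1` variables. -/
def exponents (N d : ℕ) : Finset (Fin (N + 1) →₀ ℕ) := Finset.univ.finsuppAntidiag d

/-- The coefficients of an `(N+1)`-tuple of homogeneous polynomials of degree `d`. -/
abbrev CoeffSpace (N d : ℕ) : Type := Fin (N + 1) → exponents N d → ℂ

/-- The map of homogeneous coordinates with given coefficients. -/
def evalCoeffs {N d : ℕ} (c : CoeffSpace N d) (v : Fin (N + 1) → ℂ) : Fin (N + 1) → ℂ :=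
  fun i => ∑ m, c i m * ∏ s, v s ^ (m : Fin (N + 1) →₀ ℕ) s

/-- The iterates of the map of homogeneous coordinates with given coefficients. -/
def iterCoeffs {N d : ℕ} (n : ℕ) (q : CoeffSpace N d × (Fin (N + 1) → ℂ)) : Fin (N + 1) → ℂ :=
  (evalCoeffs q.1)^[n] q.2

theorem contDiff_evalCoeffs {N d : ℕ} {m : WithTop ℕ∞} :
    ContDiff ℂ m fun q : CoeffSpace N d × (Fin (N + 1) → ℂ) => evalCoeffs q.1 q.2 := by
  refine contDiff_pi.2 fun i => ContDiff.sum fun e _ => ContDiff.mul ?_ ?_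
  · exact (contDiff_apply_apply ℂ ℂ i e).comp contDiff_fst
  · exact contDiff_prod fun s _ => ((contDiff_apply ℂ ℂ s).comp contDiff_snd).pow _

theorem contDiff_iterCoeffs {N d : ℕ} (n : ℕ) {m : WithTop ℕ∞} :
    ContDiff ℂ m (iterCoeffs (N := N) (d := d) n) := by
  induction n with
  | zero => exact contDiff_snd
  | succ n ih =>
    have : iterCoeffs (N := N) (d := d) (n + 1) = fun q => evalCoeffs q.1 (iterCoeffs n q) := by
      funext q
      rw [iterCoeffs, Function.iterate_succ_apply']
      rfl
    rw [this]
    exact contDiff_evalCoeffs.comp (contDiff_fst.prodMk ih)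

/-- The coefficients of a tuple of polynomials. -/
def coeffsOf {N : ℕ} (d : ℕ) (G : Fin (N + 1) → MvPolynomial (Fin (N + 1)) ℂ) : CoeffSpace N d :=
  fun i m => MvPolynomial.coeff m (G i)

theorem evalCoeffs_coeffsOf {N d : ℕ} {G : Fin (N + 1) → MvPolynomial (Fin (N + 1)) ℂ}
    (hG : ∀ i, (G i).IsHomogeneous d) (v : Fin (N + 1) → ℂ) :
    evalCoeffs (coeffsOf d G) v = fun i => MvPolynomial.eval v (G i) := by
  classical
  funext i
  rw [MvPolynomial.eval_eq', evalCoeffs]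
  have h : (G i).support ⊆ exponents N d := by
    intro m hm
    have := (hG i).degree_eq_sum_deg_support hm
    rw [← Finsupp.degree_apply, Finsupp.degree_eq_sum] at this
    rw [exponents, Finset.mem_finsuppAntidiag]
    exact ⟨this.symm, Finset.subset_univ _⟩
  rw [Finset.sum_subset h]
  · exact Finset.sum_coe_sort (exponents N d)
      fun m => MvPolynomial.coeff m (G i) * ∏ s, v s ^ m s
  · intro m _ hm
    simp [MvPolynomial.notMem_support_iff.1 hm]

theorem Induces.iterate {N : ℕ} {Φ : (Fin (N + 1) → ℂ) → Fin (N + 1) → ℂ}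
    {g : PSpace N → PSpace N} (h : Induces Φ g) (n : ℕ) : Induces (Φ^[n]) (g^[n]) := by
  induction n with
  | zero => exact fun v hv => ⟨hv, rfl⟩
  | succ n ih =>
    intro v hv
    obtain ⟨h1, h2⟩ := ih v hv
    obtain ⟨h3, h4⟩ := h _ h1
    simp only [Function.iterate_succ_apply']
    exact ⟨h3, by rw [h2, h4]⟩

theorem IsLift.induces_iterCoeffs {N d : ℕ} {G : Fin (N + 1) → MvPolynomial (Fin (N + 1)) ℂ}
    {g : PSpace N → PSpace N} (h : IsLift d G g) (n : ℕ) :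
    Induces (fun v => iterCoeffs n (coeffsOf d G, v)) (g^[n]) := by
  refine Induces.iterate (Φ := evalCoeffs (coeffsOf d G)) (g := g) (fun v hv => ?_) n
  rw [evalCoeffs_coeffsOf h.1]
  exact h.2 v hv

/-! ### Continuity of the multiplier invariants -/

theorem finite_fixedPoints_of_local {N : ℕ} (X : Set (PSpace N))
    (h : ∀ (v₀ : Fin (N + 1) → ℂ) (_ : v₀ ≠ 0), ∃ Q : PSpace N, ∀ᶠ v in 𝓝 v₀, ∀ hv : v ≠ 0,
      Projectivization.mk ℂ v hv ∈ X → Projectivization.mk ℂ v hv = Q) : X.Finite := by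
  have hfin : {P ∈ X | ∃ (v : Fin (N + 1) → ℂ) (hv : v ≠ 0),
      v ∈ Metric.sphere (0 : Fin (N + 1) → ℂ) 1 ∧ Projectivization.mk ℂ v hv = P}.Finite := by
    refine IsCompact.induction_on (isCompact_sphere (0 : Fin (N + 1) → ℂ) 1)
      (p := fun s => {P ∈ X | ∃ (v : Fin (N + 1) → ℂ) (hv : v ≠ 0),
        v ∈ s ∧ Projectivization.mk ℂ v hv = P}.Finite) ?_ ?_ ?_ ?_
    · simp
    · intro s t hst ht
      refine ht.subset ?_
      rintro P ⟨hP, v, hv, hvs, hvP⟩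
      exact ⟨hP, v, hv, hst hvs, hvP⟩
    · intro s t hs ht
      refine (hs.union ht).subset ?_
      rintro P ⟨hP, v, hv, hvs | hvt, hvP⟩
      · exact Or.inl ⟨hP, v, hv, hvs, hvP⟩
      · exact Or.inr ⟨hP, v, hv, hvt, hvP⟩
    · intro v₀ hv₀
      have h0 : v₀ ≠ 0 := by
        rintro rfl
        simp at hv₀
      obtain ⟨Q, hQ⟩ := h v₀ h0
      refine ⟨_, mem_nhdsWithin_of_mem_nhds hQ, (Set.finite_singleton Q).subset ?_⟩
      rintro P ⟨hP, v, hv, hvs, rfl⟩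
      exact hvs hv hP
  refine hfin.subset fun P hP => ⟨hP, ?_⟩
  have hn : ‖P.rep‖ ≠ 0 := norm_ne_zero_iff.2 P.rep_nonzero
  have hc : ((‖P.rep‖⁻¹ : ℝ) : ℂ) ≠ 0 := by exact_mod_cast inv_ne_zero hn
  refine ⟨((‖P.rep‖⁻¹ : ℝ) : ℂ) • P.rep, smul_ne_zero hc P.rep_nonzero, ?_, ?_⟩
  · rw [mem_sphere_zero_iff_norm, norm_smul, Complex.norm_real, norm_inv, norm_norm,
      inv_mul_cancel₀ hn]
  · conv_rhs => rw [← P.mk_rep]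
    rw [Projectivization.mk_eq_mk_iff']
    exact ⟨_, rfl⟩

/-- The coefficient of a product of polynomials `w - γ_i(t)` depends continuously on the
coefficients of the `γ_i`. -/
theorem tendsto_coeff_prod {ι A : Type*} {l : Filter A} (S : Finset ι)
    (γ : ι → A → Polynomial ℂ) (γ₀ : ι → Polynomial ℂ)
    (h : ∀ i ∈ S, ∀ j, Filter.Tendsto (fun a => (γ i a).coeff j) l (𝓝 ((γ₀ i).coeff j)))
    (m j : ℕ) :
    Filter.Tendsto (fun a => ((∏ i ∈ S, (Polynomial.X - Polynomial.C (γ i a))).coeff m).coeff j) l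
      (𝓝 (((∏ i ∈ S, (Polynomial.X - Polynomial.C (γ₀ i))).coeff m).coeff j)) := by
  classical
  induction S using Finset.induction generalizing m j with
  | empty => simpa using tendsto_const_nhds
  | insert i S hi ih =>
    simp only [Finset.prod_insert hi, Polynomial.coeff_mul, Polynomial.finsetSum_coeff]
    refine tendsto_finsetSum _ fun p _ => tendsto_finsetSum _ fun q _ => Filter.Tendsto.mul ?_
      (ih (fun i' hi' => h i' (Finset.mem_insert_of_mem hi')) _ _)
    simp only [Polynomial.coeff_sub, Polynomial.coeff_C]
    refine tendsto_const_nhds.sub ?_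
    split_ifs
    · exact h i (Finset.mem_insert_self _ _) _
    · simpa using tendsto_const_nhds

theorem bigSigma_eq_of_nondegenerate {N d n : ℕ} (f : HomPN N d)
    (h : ∀ P, f.toFun^[n] P = P → (multiplierPoly (f.toFun^[n]) P).eval 1 ≠ 0) :
    bigSigma n f = ∏ᶠ P ∈ {P | f.toFun^[n] P = P},
      (Polynomial.X - Polynomial.C (multiplierPoly (f.toFun^[n]) P)) := by
  rw [bigSigma]
  refine finprod_mem_congr rfl fun P hP => ?_
  rw [fixedMult_eq_one (isLift_iterate f.isLift n) hP (h P hP), pow_one]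

/-- In a family all of whose periodic points are nondegenerate, the multiplier invariants are
continuous. -/
theorem continuous_coeff_bigSigma {A : Type*} [TopologicalSpace A] {N d : ℕ} (f : A → HomPN N d)
    (hf : IsFamily f) (n : ℕ)
    (h : ∀ a P, (f a).toFun^[n] P = P → (multiplierPoly ((f a).toFun^[n]) P).eval 1 ≠ 0)
    (m j : ℕ) : Continuous fun a => ((bigSigma n (f a)).coeff m).coeff j := by
  rw [continuous_iff_continuousAt]
  intro a₀
  obtain ⟨U, hU, G, hG, hGc⟩ := hf a₀
  set g : A → PSpace N → PSpace N := fun a => (f a).toFun^[n] with hg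
  set c : A → CoeffSpace N d := fun a => coeffsOf d (G a) with hc
  have hcc : ContinuousAt c a₀ := by
    refine continuousAt_pi.2 fun i => continuousAt_pi.2 fun e => ?_
    exact (hGc i e).continuousAt hU
  have hind : ∀ᶠ a in 𝓝 a₀, Induces (fun v => iterCoeffs n (c a, v)) (g a) := by
    filter_upwards [hU] with a ha
    exact (hG a ha).induces_iterCoeffs n
  have hlift (a : A) : ∃ D G, IsLift D G (g a) := ⟨_, _, isLift_iterate (f a).isLift n⟩
  set X : A → Set (PSpace N) := fun a => {P | g a P = P} with hX
  have hbr : ∀ P ∈ X a₀, _ := fun P hP => exists_fixed_branch (iterCoeffs n)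
    (contDiff_iterCoeffs n) g hlift c a₀ hcc hind P hP (h a₀ P hP)
  choose! w hw hw0 hwc hwfix hwcoeff hwuniq using hbr
  -- away from the fixed points of `g a₀` there are no fixed points
  have hcross (a : A) (ha : Induces (fun v => iterCoeffs n (c a, v)) (g a))
      (v : Fin (N + 1) → ℂ) (hv : v ≠ 0) : Projectivization.mk ℂ v hv ∈ X a ↔
      ∀ i j, iterCoeffs n (c a, v) i * v j = iterCoeffs n (c a, v) j * v i := by
    obtain ⟨h1, h2⟩ := ha v hv
    change g a _ = _ ↔ _
    rw [h2, mk_eq_mk_iff_mul_eq_mul]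
  have hoff (v₀ : Fin (N + 1) → ℂ) (hv₀ : v₀ ≠ 0) (hnot : Projectivization.mk ℂ v₀ hv₀ ∉ X a₀) :
      ∀ᶠ q : A × (Fin (N + 1) → ℂ) in 𝓝 (a₀, v₀), ∀ hv : q.2 ≠ 0,
        Projectivization.mk ℂ q.2 hv ∉ X q.1 := by
    rw [hcross a₀ hind.self_of_nhds] at hnot
    push Not at hnot
    obtain ⟨i, j, hij⟩ := hnot
    have hpair : Filter.Tendsto (fun q : A × (Fin (N + 1) → ℂ) => (c q.1, q.2)) (𝓝 (a₀, v₀))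
        (𝓝 (c a₀, v₀)) :=
      (hcc.tendsto.comp (continuous_fst.tendsto (a₀, v₀))).prodMk_nhds
        (continuous_snd.tendsto (a₀, v₀))
    have hI (i) : Filter.Tendsto (fun q : A × (Fin (N + 1) → ℂ) => iterCoeffs n (c q.1, q.2) i)
        (𝓝 (a₀, v₀)) (𝓝 (iterCoeffs n (c a₀, v₀) i)) :=
      (((continuous_apply i).comp
        (contDiff_iterCoeffs (m := 0) n).continuous).tendsto (c a₀, v₀)).comp hpair
    have hv (i) : Filter.Tendsto (fun q : A × (Fin (N + 1) → ℂ) => q.2 i)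
        (𝓝 (a₀, v₀)) (𝓝 (v₀ i)) := ((continuous_apply i).comp continuous_snd).tendsto (a₀, v₀)
    have hne := (((hI i).mul (hv j)).sub ((hI j).mul (hv i))).eventually_ne (sub_ne_zero.2 hij)
    filter_upwards [hne, (continuous_fst.tendsto (a₀, v₀)).eventually hind] with q hq hqi hqv hqX
    exact hq (sub_eq_zero.2 ((hcross _ hqi _ hqv).1 hqX i j))
  -- the fixed points of `g a₀` are finite in number
  have hfin : (X a₀).Finite := by
    refine finite_fixedPoints_of_local _ fun v₀ hv₀ => ?_
    have hin : Filter.Tendsto (fun v : Fin (N + 1) → ℂ => (a₀, v)) (𝓝 v₀) (𝓝 (a₀, v₀)) :=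
      (Continuous.prodMk_right a₀).tendsto v₀
    refine ⟨Projectivization.mk ℂ v₀ hv₀, ?_⟩
    by_cases hX0 : Projectivization.mk ℂ v₀ hv₀ ∈ X a₀
    · filter_upwards [hin.eventually (hwuniq _ hX0 v₀ hv₀ rfl)] with v hv hv' hvX
      rw [hv hv' hvX]
      exact hw0 _ hX0
    · filter_upwards [hin.eventually (hoff v₀ hv₀ hX0)] with v hv hv' hvX
      exact absurd hvX (hv hv')
  obtain ⟨br, hbrdef⟩ : ∃ br : A → PSpace N → PSpace N, ∀ a P (hP : P ∈ X a₀),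
      br a P = Projectivization.mk ℂ (w P a) (hw P hP a) := by
    classical
    refine ⟨fun a P => if hP : P ∈ X a₀ then Projectivization.mk ℂ (w P a) (hw P hP a) else P,
      fun a P hP => dif_pos hP⟩
  have hbij : ∀ᶠ a in 𝓝 a₀, Set.BijOn (br a) (X a₀) (X a) := by
    have h1 : ∀ᶠ a in 𝓝 a₀, ∀ P ∈ X a₀, br a P ∈ X a := by
      rw [hfin.eventually_all]
      intro P hP
      filter_upwards [hwfix P hP] with a ha
      rw [hbrdef a P hP]
      exact ha
    have h2 : ∀ᶠ a in 𝓝 a₀, ∀ P ∈ X a₀, ∀ Q ∈ X a₀, br a P = br a Q → P = Q := by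
      rw [hfin.eventually_all]
      intro P hP
      rw [hfin.eventually_all]
      intro Q hQ
      by_cases hPQ : P = Q
      · exact Filter.Eventually.of_forall fun _ _ => hPQ
      · have h3 := hPQ
        rw [← hw0 P hP, ← hw0 Q hQ, mk_eq_mk_iff_mul_eq_mul] at h3
        push Not at h3
        obtain ⟨i, j, hij⟩ := h3
        have hap (R) (hR : R ∈ X a₀) (i) : Filter.Tendsto (fun a => w R a i) (𝓝 a₀)
            (𝓝 (w R a₀ i)) := ((continuous_apply i).tendsto _).comp (hwc R hR)
        have hne := (((hap P hP i).mul (hap Q hQ j)).sub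
          ((hap P hP j).mul (hap Q hQ i))).eventually_ne (sub_ne_zero.2 hij)
        filter_upwards [hne] with a ha hEq
        rw [hbrdef a P hP, hbrdef a Q hQ, mk_eq_mk_iff_mul_eq_mul] at hEq
        exact absurd (sub_eq_zero.2 (hEq i j)) ha
    have h3 : ∀ᶠ a in 𝓝 a₀, ∀ v ∈ Metric.sphere (0 : Fin (N + 1) → ℂ) 1, ∀ hv : v ≠ 0,
        Projectivization.mk ℂ v hv ∈ X a → ∃ P ∈ X a₀, br a P = Projectivization.mk ℂ v hv := by
      refine (isCompact_sphere _ _).eventually_forall_of_forall_eventually fun v₀ hv₀s => ?_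
      have hv₀ : v₀ ≠ 0 := by
        rintro rfl
        simp at hv₀s
      by_cases hX0 : Projectivization.mk ℂ v₀ hv₀ ∈ X a₀
      · filter_upwards [hwuniq _ hX0 v₀ hv₀ rfl] with q hq hqv hqX
        exact ⟨_, hX0, by rw [hbrdef _ _ hX0, hq hqv hqX]⟩
      · filter_upwards [hoff v₀ hv₀ hX0] with q hq hqv hqX
        exact absurd hqX (hq hqv)
    filter_upwards [h1, h2, h3] with a h1a h2a h3a
    refine ⟨h1a, fun P hP Q hQ => h2a P hP Q hQ, fun P hP => ?_⟩
    have hn : ‖P.rep‖ ≠ 0 := norm_ne_zero_iff.2 P.rep_nonzero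
    have hc0 : ((‖P.rep‖⁻¹ : ℝ) : ℂ) ≠ 0 := by exact_mod_cast inv_ne_zero hn
    have hmk : Projectivization.mk ℂ (((‖P.rep‖⁻¹ : ℝ) : ℂ) • P.rep)
        (smul_ne_zero hc0 P.rep_nonzero) = P := by
      conv_rhs => rw [← P.mk_rep]
      rw [Projectivization.mk_eq_mk_iff']
      exact ⟨_, rfl⟩
    obtain ⟨Q, hQ, hQP⟩ := h3a (((‖P.rep‖⁻¹ : ℝ) : ℂ) • P.rep) (by
      rw [mem_sphere_zero_iff_norm, norm_smul, Complex.norm_real, norm_inv, norm_norm,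
        inv_mul_cancel₀ hn]) (smul_ne_zero hc0 P.rep_nonzero) (by rwa [hmk])
    exact ⟨Q, hQ, by rw [hQP, hmk]⟩
  have hlim := tendsto_coeff_prod (l := 𝓝 a₀) hfin.toFinset
    (fun P a => multiplierPoly (g a) (br a P)) (fun P => multiplierPoly (g a₀) P) (by
      intro P hP j
      have hP' := hfin.mem_toFinset.1 hP
      simp only [hbrdef _ P hP']
      exact hwcoeff P hP' j) m j
  have h0 : bigSigma n (f a₀) = ∏ P ∈ hfin.toFinset,
      (Polynomial.X - Polynomial.C (multiplierPoly (g a₀) P)) := by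
    rw [bigSigma_eq_of_nondegenerate _ (h a₀)]
    exact finprod_mem_eq_finite_toFinset_prod _ hfin
  rw [← h0] at hlim
  refine hlim.congr' ?_
  filter_upwards [hbij] with a ha
  rw [bigSigma_eq_of_nondegenerate _ (h a)]
  have h1 := finprod_mem_eq_of_bijOn (br a) ha
    (f := fun P => Polynomial.X - Polynomial.C (multiplierPoly (g a) (br a P)))
    (g := fun P => Polynomial.X - Polynomial.C (multiplierPoly (g a) P)) fun _ _ => rfl
  rw [finprod_mem_eq_finite_toFinset_prod _ hfin] at h1
  rw [h1]

/-! ### Binary forms and maps of the projective line -/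

theorem mk_eq_iff_det_eq_zero {v : Fin 2 → ℂ} (hv : v ≠ 0) (P : PSpace 1) :
    Projectivization.mk ℂ v hv = P ↔ P.rep 0 * v 1 - P.rep 1 * v 0 = 0 := by
  conv_lhs => rw [← P.mk_rep]
  rw [mk_eq_mk_iff_mul_eq_mul]
  constructor
  · intro h
    linear_combination -h 0 1
  · intro h i j
    fin_cases i <;> fin_cases j <;> simp only [Fin.zero_eta, Fin.mk_one]
    · linear_combination -h
    · linear_combination h

theorem exists_zero_of_isHomogeneous {d : ℕ} {p : MvPolynomial (Fin 2) ℂ}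
    (hp : p.IsHomogeneous (d + 1)) : ∃ v : Fin 2 → ℂ, v ≠ 0 ∧ MvPolynomial.eval v p = 0 := by
  obtain ⟨l, r, hl, hr⟩ := exists_eq_mulLin (k := d) fun j => binaryCoeff (d + 1) p j
  have h : MvPolynomial.eval ![-l 0, l 1] p = formEval (mulLin l r) ![l 1, -l 0] := by
    rw [← hr, eval_binary hp, formEval, Finset.sum_range]
    refine Finset.sum_congr rfl fun j _ => ?_
    simp
    ring
  refine ⟨![-l 0, l 1], ?_, ?_⟩
  · intro h0
    apply hl
    have h1 := congrFun h0 0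
    have h2 := congrFun h0 1
    funext i
    fin_cases i
    · simpa using h1
    · simpa using h2
  · rw [h, formEval_mulLin]
    simp
    left
    ring

theorem IsLift.surjective {d : ℕ} {G : Fin 2 → MvPolynomial (Fin 2) ℂ} {f : PSpace 1 → PSpace 1}
    (h : IsLift (d + 1) G f) : Function.Surjective f := by
  intro Q
  have hp : (MvPolynomial.C (Q.rep 0) * G 1 - MvPolynomial.C (Q.rep 1) * G 0).IsHomogeneous
      (d + 1) := ((h.1 1).C_mul _).sub ((h.1 0).C_mul _)
  obtain ⟨v, hv, hv0⟩ := exists_zero_of_isHomogeneous hp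
  obtain ⟨h1, h2⟩ := h.2 v hv
  refine ⟨Projectivization.mk ℂ v hv, ?_⟩
  rw [h2, mk_eq_iff_det_eq_zero]
  simpa using hv0

theorem IsLift.exists_fixedPoint {d : ℕ} {G : Fin 2 → MvPolynomial (Fin 2) ℂ}
    {f : PSpace 1 → PSpace 1} (h : IsLift d G f) : ∃ P, f P = P := by
  have hp : (MvPolynomial.X 1 * G 0 - MvPolynomial.X 0 * G 1).IsHomogeneous (d + 1) := by
    rw [add_comm]
    exact ((MvPolynomial.isHomogeneous_X ℂ 1).mul (h.1 0)).sub
      ((MvPolynomial.isHomogeneous_X ℂ 0).mul (h.1 1))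
  obtain ⟨v, hv, hv0⟩ := exists_zero_of_isHomogeneous hp
  obtain ⟨h1, h2⟩ := h.2 v hv
  refine ⟨Projectivization.mk ℂ v hv, ?_⟩
  simp only [map_sub, map_mul, MvPolynomial.eval_X] at hv0
  rw [h2, mk_eq_mk_iff_mul_eq_mul]
  intro i j
  fin_cases i <;> fin_cases j <;> simp only [Fin.zero_eta, Fin.mk_one]
  · linear_combination hv0
  · linear_combination -hv0

/-- The identity of the projective line is not of degree at least two. -/
theorem not_isLift_id {D : ℕ} (hD : 2 ≤ D) {G : Fin 2 → MvPolynomial (Fin 2) ℂ} :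
    ¬ IsLift D G (id : PSpace 1 → PSpace 1) := by
  intro h
  let p (i : Fin 2) : Polynomial ℂ :=
    ∑ j ∈ Finset.range (D + 1), Polynomial.C (binaryCoeff D (G i) j) * Polynomial.X ^ j
  have hpc (i : Fin 2) (j : ℕ) : (p i).coeff j =
      if j < D + 1 then binaryCoeff D (G i) j else 0 := by
    simp only [p, Polynomial.finsetSum_coeff, Polynomial.coeff_C_mul_X_pow]
    simp
  have hpe (i : Fin 2) (x : ℂ) : (p i).eval x = MvPolynomial.eval ![x, 1] (G i) := by
    rw [eval_binary (h.1 i)]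
    simp [p, Polynomial.eval_finsetSum]
  have hne (x : ℂ) : (![x, 1] : Fin 2 → ℂ) ≠ 0 := fun h0 => by simpa using congrFun h0 1
  have hp : p 0 = Polynomial.X * p 1 := by
    refine Polynomial.funext fun x => ?_
    obtain ⟨h1, h2⟩ := h.2 ![x, 1] (hne x)
    have h3 := (mk_eq_mk_iff_mul_eq_mul _ _).1 h2 0 1
    simp at h3
    rw [Polynomial.eval_mul, Polynomial.eval_X, hpe, hpe]
    simpa using h3.symm
  by_cases hdeg : (p 1).degree = 0
  · have hc (j : ℕ) (hj : 1 ≤ j) : (p 1).coeff j = 0 := by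
      refine Polynomial.coeff_eq_zero_of_degree_lt ?_
      rw [hdeg]
      exact_mod_cast hj
    have h1 : binaryCoeff D (G 1) D = 0 := by
      have := hc D (by omega)
      rwa [hpc, if_pos (by omega)] at this
    have h0 : binaryCoeff D (G 0) D = 0 := by
      have := hpc 0 D
      rw [if_pos (by omega)] at this
      rw [← this, hp]
      obtain ⟨D, rfl⟩ : ∃ D', D = D' + 1 := ⟨D - 1, by omega⟩
      rw [Polynomial.coeff_X_mul]
      exact hc D (by omega)
    obtain ⟨h2, -⟩ := h.2 ![1, 0] (fun h0 => by simpa using congrFun h0 0)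
    apply h2
    have key (i : Fin 2) (hi : binaryCoeff D (G i) D = 0) :
        MvPolynomial.eval ![1, 0] (G i) = 0 := by
      rw [eval_binary (h.1 i), Finset.sum_range_succ, hi, Finset.sum_eq_zero]
      · simp
      · intro j hj
        have : D - j ≠ 0 := by have := Finset.mem_range.1 hj; omega
        simp [this]
    funext i
    fin_cases i
    · exact key 0 h0
    · exact key 1 h1
  · obtain ⟨x, hx⟩ := IsAlgClosed.exists_root (p 1) hdeg
    obtain ⟨h1, -⟩ := h.2 ![x, 1] (hne x)
    apply h1
    have hx1 : (p 1).eval x = 0 := hx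
    have hx0 : (p 0).eval x = 0 := by rw [hp, Polynomial.eval_mul, hx1, mul_zero]
    funext i
    fin_cases i
    · simpa [hpe] using hx0
    · simpa [hpe] using hx1

/-! ### Holomorphic maps to the projective line -/

theorem analyticAt_apply {ι : Type*} [Fintype ι] {g : ℂ → ι → ℂ} {z : ℂ} (hg : AnalyticAt ℂ g z)
    (i : ι) : AnalyticAt ℂ (fun w => g w i) z :=
  (ContinuousLinearMap.proj (R := ℂ) (φ := fun _ : ι => ℂ) i).analyticAt _ |>.comp hg

theorem IsHolomorphicToP1.eventually_eq_or_ne {Θ : ℂ → PSpace 1} (hΘ : IsHolomorphicToP1 Θ)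
    (z : ℂ) (P : PSpace 1) :
    (∀ᶠ w in 𝓝 z, Θ w = P) ∨ ∀ᶠ w in 𝓝[≠] z, Θ w ≠ P := by
  obtain ⟨g, hg, hΘg⟩ := hΘ z
  have han : AnalyticAt ℂ (fun w => P.rep 0 * g w 1 - P.rep 1 * g w 0) z :=
    (analyticAt_const.mul (analyticAt_apply hg 1)).sub
      (analyticAt_const.mul (analyticAt_apply hg 0))
  refine han.eventually_eq_zero_or_eventually_ne_zero.imp (fun h => ?_) fun h => ?_
  · filter_upwards [h, hΘg] with w hw hw'
    obtain ⟨h1, h2⟩ := hw'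
    rw [h2, mk_eq_iff_det_eq_zero]
    exact hw
  · filter_upwards [h, nhdsWithin_le_nhds hΘg] with w hw hw'
    obtain ⟨h1, h2⟩ := hw'
    rw [h2, Ne, mk_eq_iff_det_eq_zero]
    exact hw

/-- The fibers of a nonconstant holomorphic map are discrete. -/
theorem IsHolomorphicToP1.eventually_ne {Θ : ℂ → PSpace 1} (hΘ : IsHolomorphicToP1 Θ)
    (hnc : ∃ z w, Θ z ≠ Θ w) (z : ℂ) (P : PSpace 1) : ∀ᶠ w in 𝓝[≠] z, Θ w ≠ P := by
  set S : Set ℂ := {z | ∀ᶠ w in 𝓝 z, Θ w = P} with hS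
  have hopen : IsOpen S := isOpen_iff_mem_nhds.2 fun z hz => hz.eventually_nhds
  have hclosed : IsClosed S := by
    refine ⟨isOpen_iff_mem_nhds.2 fun z hz => ?_⟩
    have h1 := (hΘ.eventually_eq_or_ne z P).resolve_left hz
    rw [eventually_nhdsWithin_iff] at h1
    filter_upwards [h1] with w hw hwS
    by_cases hwz : w = z
    · exact hz (hwz ▸ hwS)
    · exact hw hwz hwS.self_of_nhds
  rcases isClopen_iff.1 ⟨hclosed, hopen⟩ with h | h
  · refine (hΘ.eventually_eq_or_ne z P).resolve_left fun hz => ?_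
    have : z ∈ S := hz
    rw [h] at this
    exact this
  · obtain ⟨x, y, hxy⟩ := hnc
    have hall (x) : Θ x = P := by
      have hx : x ∈ S := by rw [h]; trivial
      exact Filter.Eventually.self_of_nhds (p := fun w => Θ w = P) hx
    exact absurd ((hall x).trans (hall y).symm) hxy

theorem exists_sub_mem_lattice (L : PeriodPair) :
    ∃ R : ℝ, ∀ z : ℂ, ∃ ω ∈ L.lattice, z + ω ∈ Metric.closedBall (0 : ℂ) R := by
  refine ⟨∑ i, ‖L.basis i‖, fun z => ⟨-(ZSpan.floor L.basis z : ℂ), ?_, ?_⟩⟩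
  · rw [L.lattice_eq_span_range_basis]
    exact neg_mem (ZSpan.floor L.basis z).2
  · rw [mem_closedBall_zero_iff, ← sub_eq_add_neg, ← ZSpan.fract_apply]
    exact ZSpan.norm_fract_le L.basis z

/-- The fibers of a nonconstant elliptic map are finite modulo periods. -/
theorem exists_lt_sub_mem_lattice {L : PeriodPair} {Θ : ℂ → PSpace 1}
    (hΘ : IsHolomorphicToP1 Θ) (hper : ∀ z, ∀ ω ∈ L.lattice, Θ (z + ω) = Θ z)
    (hnc : ∃ z w, Θ z ≠ Θ w) (P : PSpace 1) (s : ℕ → ℂ) (hs : ∀ j, Θ (s j) = P) :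
    ∃ i j, i < j ∧ s j - s i ∈ L.lattice := by
  obtain ⟨R, hR⟩ := exists_sub_mem_lattice L
  choose ω hω hωR using hR
  set t : ℕ → ℂ := fun j => s j + ω (s j) with ht
  have htP (j) : Θ (t j) = P := by rw [ht]; simp only; rw [hper _ _ (hω _), hs]
  have hfin : (Set.range t).Finite := by
    by_contra hinf
    obtain ⟨x, -, hx⟩ := Set.Infinite.exists_accPt_of_subset_isCompact hinf
      (isCompact_closedBall (0 : ℂ) R) (by rintro _ ⟨j, rfl⟩; exact hωR _)
    rw [accPt_iff_frequently] at hx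
    have h1 := hΘ.eventually_ne hnc x P
    rw [eventually_nhdsWithin_iff] at h1
    obtain ⟨y, ⟨hyx, j, rfl⟩, hy⟩ := (hx.and_eventually h1).exists
    exact hy hyx (htP j)
  obtain ⟨i, j, hij, h⟩ :=
    Set.Finite.exists_lt_map_eq_of_forall_mem (fun j => Set.mem_range_self (f := t) j) hfin
  refine ⟨i, j, hij, ?_⟩
  have : s j - s i = ω (s i) - ω (s j) := by
    simp only [ht] at h
    linear_combination -h
  rw [this]
  exact sub_mem (hω _) (hω _)

/-- A nonconstant elliptic map is surjective. -/
theorem surjective_of_periodic {L : PeriodPair} {Θ : ℂ → PSpace 1}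
    (hΘ : IsHolomorphicToP1 Θ) (hper : ∀ z, ∀ ω ∈ L.lattice, Θ (z + ω) = Θ z)
    (hnc : ∃ z w, Θ z ≠ Θ w) : Function.Surjective Θ := by
  intro Q
  by_contra hQ
  push Not at hQ
  set l : (Fin 2 → ℂ) → ℂ := fun v => Q.rep 0 * v 1 - Q.rep 1 * v 0 with hl
  have hl0 (z) : l (Θ z).rep ≠ 0 := by
    intro h
    apply hQ z
    rw [← (Θ z).mk_rep, mk_eq_iff_det_eq_zero]
    exact h
  have hconst (i : Fin 2) : ∀ z w, (Θ z).rep i / l (Θ z).rep = (Θ w).rep i / l (Θ w).rep := by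
    have hdiff : Differentiable ℂ fun z => (Θ z).rep i / l (Θ z).rep := by
      intro z
      obtain ⟨g, hg, hΘg⟩ := hΘ z
      have hl1 : l (g z) ≠ 0 := by
        obtain ⟨h1, h2⟩ := hΘg.self_of_nhds
        intro h
        apply hQ z
        rw [h2, mk_eq_iff_det_eq_zero]
        exact h
      have han : AnalyticAt ℂ (fun w => g w i / l (g w)) z :=
        (analyticAt_apply hg i).div ((analyticAt_const.mul (analyticAt_apply hg 1)).sub
          (analyticAt_const.mul (analyticAt_apply hg 0))) hl1
      refine han.differentiableAt.congr_of_eventuallyEq ?_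
      filter_upwards [hΘg] with w hw
      obtain ⟨h1, h2⟩ := hw
      obtain ⟨t, ht, h3⟩ := exists_rep_mk (N := 1) h1
      rw [h2, h3]
      simp only [hl, Pi.smul_apply, smul_eq_mul]
      rw [← mul_div_mul_left (g w i) _ ht]
      congr 1
      ring
    refine hdiff.apply_eq_apply_of_bounded ?_
    obtain ⟨R, hR⟩ := exists_sub_mem_lattice L
    refine ((isCompact_closedBall (0 : ℂ) R).image hdiff.continuous).isBounded.subset ?_
    rintro _ ⟨z, rfl⟩
    obtain ⟨ω, hω, hz⟩ := hR z
    refine ⟨z + ω, hz, ?_⟩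
    simp only [hper z ω hω]
  obtain ⟨x, y, hxy⟩ := hnc
  apply hxy
  rw [← (Θ x).mk_rep, ← (Θ y).mk_rep, mk_eq_mk_iff_mul_eq_mul]
  intro i j
  have h1 := hconst i x y
  have h2 := hconst j x y
  rw [div_eq_div_iff (hl0 x) (hl0 y)] at h1 h2
  have h3 : (Θ x).rep i * (Θ y).rep j * (l (Θ y).rep * l (Θ x).rep) =
      (Θ x).rep j * (Θ y).rep i * (l (Θ y).rep * l (Θ x).rep) := by
    linear_combination (Θ y).rep j * l (Θ x).rep * h1 - (Θ y).rep i * l (Θ x).rep * h2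
  exact mul_right_cancel₀ (mul_ne_zero (hl0 y) (hl0 x)) h3

/-! ### Lattès maps -/

/-- A presentation of `f` as a Lattès map. -/
structure LattesData (f : PSpace 1 → PSpace 1) where
  /-- the lattice -/
  L : PeriodPair
  /-- the holomorphic map from the torus -/
  Θ : ℂ → PSpace 1
  /-- the linear part of the affine map -/
  α : ℂ
  /-- the constant part of the affine map -/
  β : ℂ
  holomorphic : IsHolomorphicToP1 Θ
  periodic : ∀ z, ∀ ω ∈ L.lattice, Θ (z + ω) = Θ z
  nonconstant : ∃ z w, Θ z ≠ Θ w
  mul_mem : ∀ ω ∈ L.lattice, α * ω ∈ L.lattice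
  semiconj : ∀ z, f (Θ z) = Θ (α * z + β)

theorem IsLattes.nonempty_data {f : PSpace 1 → PSpace 1} (h : IsLattes f) :
    Nonempty (LattesData f) := by
  obtain ⟨L, Θ, α, β, h1, h2, h3, h4, h5⟩ := h
  exact ⟨⟨L, Θ, α, β, h1, h2, h3, h4, h5⟩⟩

namespace LattesData

variable {f : PSpace 1 → PSpace 1} (D : LattesData f)

/-- The affine map. -/
def affine (z : ℂ) : ℂ := D.α * z + D.β

theorem surjective : Function.Surjective D.Θ :=
  surjective_of_periodic D.holomorphic D.periodic D.nonconstant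

theorem iterate_apply (n : ℕ) (z : ℂ) : f^[n] (D.Θ z) = D.Θ (D.affine^[n] z) :=
  ((Function.Semiconj.iterate_right (f := D.Θ) (ga := D.affine) (gb := f)
    (fun z => (D.semiconj z).symm) n) z).symm

theorem affine_iterate_add (n : ℕ) (z h : ℂ) :
    D.affine^[n] (z + h) = D.affine^[n] z + D.α ^ n * h := by
  induction n with
  | zero => simp
  | succ n ih =>
    rw [Function.iterate_succ_apply', Function.iterate_succ_apply', ih, affine, affine]
    ring

theorem pow_mul_mem (n : ℕ) {ω : ℂ} (hω : ω ∈ D.L.lattice) : D.α ^ n * ω ∈ D.L.lattice := by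
  induction n with
  | zero => simpa using hω
  | succ n ih =>
    rw [pow_succ', mul_assoc]
    exact D.mul_mem _ ih

theorem affine_iterate_sub_mem {m : ℕ} {z : ℂ} (h : D.affine^[m] z - z ∈ D.L.lattice) (s : ℕ) :
    D.affine^[m * s] z - z ∈ D.L.lattice := by
  induction s with
  | zero => simp
  | succ s ih =>
    have h1 : D.affine^[m * (s + 1)] z = D.affine^[m] z + D.α ^ m * (D.affine^[m * s] z - z) := by
      rw [mul_add, mul_one, add_comm, Function.iterate_add_apply, ← affine_iterate_add]
      congr 1
      ring
    rw [h1, add_sub_right_comm]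
    exact add_mem h (D.pow_mul_mem m ih)

/-- A periodic point of `f` lifts to a periodic point of the affine map of the torus. -/
theorem exists_periodic_lift {m : ℕ} {P : PSpace 1} (hP : f^[m] P = P) :
    ∃ (ζ : ℂ) (r : ℕ), 0 < r ∧ D.Θ ζ = P ∧ D.affine^[m * r] ζ - ζ ∈ D.L.lattice := by
  obtain ⟨z, hz⟩ := D.surjective P
  have hit (j : ℕ) : f^[m * j] P = P := by
    rw [Function.iterate_mul]
    exact Function.iterate_fixed hP j
  obtain ⟨i, j, hij, h⟩ := exists_lt_sub_mem_lattice D.holomorphic D.periodic D.nonconstant P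
    (fun j => D.affine^[m * j] z) fun j => by rw [← iterate_apply, hz, hit]
  refine ⟨D.affine^[m * i] z, j - i, by omega, by rw [← iterate_apply, hz, hit], ?_⟩
  rw [← Function.iterate_add_apply, ← mul_add, Nat.sub_add_cancel hij.le]
  exact h

/-- The map `f` is linearized around a periodic point of the torus. -/
theorem iterate_apply_add {m : ℕ} {ζ : ℂ} (h : D.affine^[m] ζ - ζ ∈ D.L.lattice) (w : ℂ) :
    f^[m] (D.Θ (ζ + w)) = D.Θ (ζ + D.α ^ m * w) := by
  rw [iterate_apply, affine_iterate_add, ← D.periodic (ζ + D.α ^ m * w) _ h]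
  congr 1
  ring

theorem period_ne_zero : D.L.ω₁ ≠ 0 := D.L.indep.ne_zero 0

theorem one_lt_norm {d : ℕ} (hd : 2 ≤ d) {G : Fin 2 → MvPolynomial (Fin 2) ℂ}
    (hG : IsLift d G f) : 1 < ‖D.α‖ := by
  by_contra hα
  push Not at hα
  have hfin : (Metric.closedBall (0 : ℂ) ‖D.L.ω₁‖ ∩ D.L.lattice).Finite := by
    rw [D.L.lattice_eq_span_range_basis]
    exact ZSpan.setFinite_inter D.L.basis Metric.isBounded_closedBall
  have hmem (j : ℕ) :
      D.α ^ j * D.L.ω₁ ∈ Metric.closedBall (0 : ℂ) ‖D.L.ω₁‖ ∩ D.L.lattice := by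
    refine ⟨?_, D.pow_mul_mem j D.L.ω₁_mem_lattice⟩
    rw [mem_closedBall_zero_iff, norm_mul, norm_pow]
    exact mul_le_of_le_one_left (norm_nonneg _) (pow_le_one₀ (norm_nonneg _) hα)
  obtain ⟨i, j, hij, h⟩ := Set.Finite.exists_lt_map_eq_of_forall_mem hmem hfin
  have hpow : D.α ^ i = D.α ^ j := mul_right_cancel₀ D.period_ne_zero h
  obtain ⟨P, hP⟩ := hG.exists_fixedPoint
  obtain ⟨ζ, r, hr, hζ, hζr⟩ := D.exists_periodic_lift (m := 1) hP
  rw [one_mul] at hζr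
  have hdr : ∃ e, d ^ r = e + 1 := ⟨d ^ r - 1, by have := Nat.one_le_pow r d (by omega); omega⟩
  by_cases h0 : D.α = 0
  · obtain ⟨e, he⟩ := hdr
    have hlift := isLift_iterate hG r
    rw [he] at hlift
    have hconst (Q : PSpace 1) : f^[r] Q = P := by
      obtain ⟨z, rfl⟩ := D.surjective Q
      have h1 := D.iterate_apply_add hζr (z - ζ)
      rw [h0, zero_pow hr.ne', zero_mul, add_zero, add_sub_cancel, hζ] at h1
      exact h1
    obtain ⟨x, y, hxy⟩ := D.nonconstant
    obtain ⟨Q, hQ⟩ := hlift.surjective (D.Θ x)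
    obtain ⟨Q', hQ'⟩ := hlift.surjective (D.Θ y)
    exact hxy (by rw [← hQ, ← hQ', hconst, hconst])
  · have hone : D.α ^ (j - i) = 1 := by
      have h1 : D.α ^ i * D.α ^ (j - i) = D.α ^ i * 1 := by
        rw [← pow_add, Nat.add_sub_cancel' hij.le, ← hpow, mul_one]
      exact mul_left_cancel₀ (pow_ne_zero _ h0) h1
    have hid : f^[r * (j - i)] = id := by
      funext Q
      obtain ⟨z, rfl⟩ := D.surjective Q
      have h1 := D.iterate_apply_add (D.affine_iterate_sub_mem hζr (j - i)) (z - ζ)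
      rw [mul_comm r, pow_mul, hone, one_pow, one_mul, add_sub_cancel, mul_comm] at h1
      exact h1
    have hlift := isLift_iterate hG (r * (j - i))
    rw [hid] at hlift
    refine not_isLift_id ?_ hlift
    have : r * (j - i) ≠ 0 := Nat.mul_ne_zero hr.ne' (by omega)
    exact hd.trans (Nat.le_self_pow this d)

theorem isAlgebraic : IsAlgebraic ℚ D.α := by
  have h : IsIntegral ℤ D.α := by
    refine isIntegral_of_smul_mem_submodule D.L.lattice ?_ ?_ D.α fun ω hω => D.mul_mem ω hω
    · intro h
      have := D.L.ω₁_mem_lattice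
      rw [h, Submodule.mem_bot] at this
      exact D.period_ne_zero this
    · rw [PeriodPair.lattice]
      exact Submodule.fg_span (by simp)
  exact (h.tower_top (A := ℚ)).isAlgebraic

end LattesData

/-! ### Hölder continuity of local inverses -/

theorem eq_of_toAffine_eq {N : ℕ} {b : Fin (N + 1)} {P Q : PSpace N} (hP : P.rep b ≠ 0)
    (hQ : Q.rep b ≠ 0) (h : toAffine b P = toAffine b Q) : P = Q := by
  rw [← ofAffine_toAffine b P hP, ← ofAffine_toAffine b Q hQ, h]

/-- A nonconstant holomorphic function is locally surjective, with a Hölder bound. -/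
theorem exists_holder_preimage {θ : ℂ → ℂ} {z₀ : ℂ} (hθ : AnalyticAt ℂ θ z₀)
    (hnc : ¬ ∀ᶠ z in 𝓝 z₀, θ z = θ z₀) {p : ℂ → Prop} (hp : ∀ᶠ z in 𝓝 z₀, p z) :
    ∃ e : ℕ, 0 < e ∧ ∃ C : ℝ, 0 ≤ C ∧ ∀ᶠ y in 𝓝 (θ z₀), ∃ h : ℂ, θ (z₀ + h) = y ∧
      p (z₀ + h) ∧ ‖h‖ ^ e ≤ C * ‖y - θ z₀‖ := by
  have hθ' : AnalyticAt ℂ (fun z => θ z - θ z₀) z₀ := hθ.sub analyticAt_const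
  obtain ⟨e, W, hW, hW0, hθW⟩ := hθ'.exists_eventuallyEq_pow_smul_nonzero_iff.2 (by
    simpa only [sub_eq_zero] using hnc)
  have he : 0 < e := by
    rw [Nat.pos_iff_ne_zero]
    rintro rfl
    have := hθW.self_of_nhds
    simp only [sub_self, pow_zero, one_smul] at this
    exact hW0 this.symm
  set m : ℝ := ‖W z₀‖ / 2 with hm
  have hm0 : 0 < m := half_pos (norm_pos_iff.2 hW0)
  have hWm : ∀ᶠ z in 𝓝 z₀, m < ‖W z‖ :=
    hW.continuousAt.norm.eventually (lt_mem_nhds (half_lt_self (norm_pos_iff.2 hW0)))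
  obtain ⟨r₀, hr₀, hball⟩ := Metric.eventually_nhds_iff_ball.1
    (hp.and (hWm.and (hθW.and hθ.eventually_analyticAt)))
  refine ⟨e, he, 4 / m, by positivity, ?_⟩
  have hsmall : ∀ᶠ y in 𝓝 (θ z₀), 4 / m * ‖y - θ z₀‖ < r₀ ^ e := by
    have hcont : Continuous fun y => 4 / m * ‖y - θ z₀‖ := by fun_prop
    refine hcont.continuousAt.eventually (gt_mem_nhds ?_)
    simp only [sub_self, norm_zero, mul_zero]
    positivity
  filter_upwards [hsmall] with y hy
  by_cases hy0 : y = θ z₀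
  · refine ⟨0, by simp [hy0], ?_, by simp [he.ne', hy0]⟩
    simpa using (hball z₀ (Metric.mem_ball_self hr₀)).1
  have hpos : 0 < ‖y - θ z₀‖ := norm_pos_iff.2 (sub_ne_zero.2 hy0)
  set r : ℝ := (4 / m * ‖y - θ z₀‖) ^ ((e : ℝ)⁻¹) with hr
  have hre : r ^ e = 4 / m * ‖y - θ z₀‖ := Real.rpow_inv_natCast_pow (by positivity) he.ne'
  have hr0 : 0 < r := Real.rpow_pos_of_pos (by positivity) _
  have hrr₀ : r < r₀ := lt_of_pow_lt_pow_left₀ e hr₀.le (by rwa [hre])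
  have hsub : Metric.closedBall z₀ r ⊆ Metric.ball z₀ r₀ := Metric.closedBall_subset_ball hrr₀
  have hdiff : DiffContOnCl ℂ θ (Metric.ball z₀ r) := by
    refine DifferentiableOn.diffContOnCl_ball (U := Metric.ball z₀ r₀) (fun z hz => ?_) hsub
    exact (hball z hz).2.2.2.differentiableAt.differentiableWithinAt
  have himg := hdiff.ball_subset_image_closedBall (ε := m * r ^ e) hr0 (fun z hz => by
    have hz' := hball z (hsub (Metric.sphere_subset_closedBall hz))
    rw [hz'.2.2.1, norm_smul, norm_pow, ← dist_eq_norm, Metric.mem_sphere.1 hz, mul_comm]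
    exact mul_le_mul_of_nonneg_left hz'.2.1.le (by positivity))
    (Filter.not_eventually.1 hnc)
  have hymem : y ∈ Metric.ball (θ z₀) (m * r ^ e / 2) := by
    rw [Metric.mem_ball, dist_eq_norm, hre]
    have : m * (4 / m * ‖y - θ z₀‖) / 2 = 2 * ‖y - θ z₀‖ := by
      field_simp
      ring
    rw [this]
    linarith
  obtain ⟨z, hz, hzy⟩ := himg hymem
  refine ⟨z - z₀, by rw [add_sub_cancel, hzy], ?_, ?_⟩
  · rw [add_sub_cancel]
    exact (hball z (hsub hz)).1
  · rw [← hre]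
    refine pow_le_pow_left₀ (norm_nonneg _) ?_ e
    rw [← dist_eq_norm]
    exact hz

/-- A nonconstant holomorphic map to the projective line is locally surjective, with a Hölder
bound. -/
theorem IsHolomorphicToP1.exists_holder_preimage {Θ : ℂ → PSpace 1} (hΘ : IsHolomorphicToP1 Θ)
    (hnc : ∃ z w, Θ z ≠ Θ w) {z₀ : ℂ} {g : ℂ → Fin 2 → ℂ} (hg : AnalyticAt ℂ g z₀)
    (hΘg : ∀ᶠ z in 𝓝 z₀, ∃ h : g z ≠ 0, Θ z = Projectivization.mk ℂ (g z) h) :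
    ∃ e : ℕ, 0 < e ∧ ∃ C : ℝ, 0 ≤ C ∧ ∀ᶠ v in 𝓝 (g z₀), ∀ hv : v ≠ 0, ∃ h : ℂ,
      Θ (z₀ + h) = Projectivization.mk ℂ v hv ∧ ‖h‖ ^ e ≤ C * ‖v - g z₀‖ := by
  obtain ⟨hg0, hΘ0⟩ := hΘg.self_of_nhds
  obtain ⟨b, hb⟩ := Function.ne_iff.1 hg0
  simp only [Pi.zero_apply] at hb
  set b' := b.succAbove (0 : Fin 1) with hb'
  set θ : ℂ → ℂ := fun z => g z b' / g z b with hθdef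
  have hθ : AnalyticAt ℂ θ z₀ := (analyticAt_apply hg b').div (analyticAt_apply hg b) hb
  have hgb : ∀ᶠ z in 𝓝 z₀, g z b ≠ 0 := (analyticAt_apply hg b).continuousAt.eventually_ne hb
  have haff (P : PSpace 1) (v : Fin 2 → ℂ) (hv : v ≠ 0) (hP : P = Projectivization.mk ℂ v hv)
      (z : ℂ) (hz : ∃ h : g z ≠ 0, Θ z = Projectivization.mk ℂ (g z) h) (hzb : g z b ≠ 0)
      (hvb : v b ≠ 0) (h : θ z = v b' / v b) : Θ z = P := by
    obtain ⟨h1, h2⟩ := hz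
    rw [h2, hP]
    refine eq_of_toAffine_eq (N := 1) (b := b) ((rep_mk_ne_zero_iff h1 b).2 hzb)
      ((rep_mk_ne_zero_iff hv b).2 hvb) ?_
    rw [toAffine_mk (N := 1), toAffine_mk (N := 1)]
    funext l
    rw [Subsingleton.elim l 0]
    exact h
  have hθnc : ¬ ∀ᶠ z in 𝓝 z₀, θ z = θ z₀ := by
    intro h
    have h1 : ∀ᶠ z in 𝓝 z₀, Θ z = Θ z₀ := by
      filter_upwards [h, hΘg, hgb] with z hz hzg hzb
      exact haff _ (g z₀) hg0 hΘ0 z hzg hzb hb hz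
    have h2 := hΘ.eventually_ne hnc z₀ (Θ z₀)
    obtain ⟨z, hz, hz'⟩ := ((h1.filter_mono nhdsWithin_le_nhds).and h2).exists
    exact hz' hz
  obtain ⟨e, he, C, hC, hev⟩ := IsoSym.exists_holder_preimage hθ hθnc (hΘg.and hgb)
  have hκ : DifferentiableAt ℂ (fun v : Fin 2 → ℂ => v b' / v b) (g z₀) := by
    simp only [div_eq_mul_inv]
    exact (differentiableAt_apply b' _).fun_mul ((differentiableAt_apply b _).fun_inv hb)
  obtain ⟨c, hc0, hc⟩ := hκ.isBigO_sub.exists_pos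
  refine ⟨e, he, C * c, by positivity, ?_⟩
  have hvb : ∀ᶠ v in 𝓝 (g z₀), v b ≠ 0 := (continuous_apply b).continuousAt.eventually_ne hb
  filter_upwards [hκ.continuousAt.eventually hev, hc.bound, hvb] with v hv hvc hvb hv0
  obtain ⟨h, h1, ⟨h2, h3⟩, h4⟩ := hv
  refine ⟨h, haff _ v hv0 rfl _ h2 h3 hvb h1, h4.trans ?_⟩
  rw [mul_assoc]
  exact mul_le_mul_of_nonneg_left hvc hC

/-! ### Factors of nearby forms -/

theorem norm_mulLin_le {k : ℕ} (l : Fin 2 → ℂ) (p : Fin (k + 1) → ℂ) :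
    ‖mulLin l p‖ ≤ 2 * ‖l‖ * ‖p‖ := by
  refine (pi_norm_le_iff_of_nonneg (by positivity)).2 fun j => ?_
  have h1 : ‖Fin.snoc (α := fun _ => ℂ) p 0 j‖ ≤ ‖p‖ := by
    induction j using Fin.lastCases with
    | last => simp
    | cast j => simpa using norm_le_pi_norm p j
  have h2 : ‖Fin.cons (α := fun _ => ℂ) 0 p j‖ ≤ ‖p‖ := by
    induction j using Fin.cases with
    | zero => simp
    | succ j => simpa using norm_le_pi_norm p j
  calc ‖mulLin l p j‖ ≤ ‖l 0‖ * ‖Fin.snoc (α := fun _ => ℂ) p 0 j‖ +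
        ‖l 1‖ * ‖Fin.cons (α := fun _ => ℂ) 0 p j‖ := by
        rw [← norm_mul, ← norm_mul]
        exact norm_add_le _ _
    _ ≤ ‖l‖ * ‖p‖ + ‖l‖ * ‖p‖ := by
        gcongr
        · exact norm_le_pi_norm l 0
        · exact norm_le_pi_norm l 1
    _ = 2 * ‖l‖ * ‖p‖ := by ring

theorem norm_symVec_le {k : ℕ} (v : Fin k → Fin 2 → ℂ) (hv : ∀ i, ‖v i‖ = 1) :
    ‖symVec v‖ ≤ 2 ^ k := by
  induction k with
  | zero => simp [symVec_zero, pi_norm_const]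
  | succ k ih =>
    rw [symVec_succAbove v 0]
    refine (norm_mulLin_le _ _).trans ?_
    rw [hv, pow_succ']
    have := ih (fun j => v ((0 : Fin (k + 1)).succAbove j)) fun i => hv _
    linarith

theorem eq_zero_of_mulLin_eq_zero {k : ℕ} {l : Fin 2 → ℂ} (hl : l ≠ 0) {p : Fin (k + 1) → ℂ}
    (h : mulLin l p = 0) : p = 0 := by
  obtain ⟨b, hb⟩ := Function.ne_iff.1 hl
  by_contra hp
  obtain ⟨s, v, hs, hv, rfl⟩ := exists_eq_smul_symVec p hp
  rw [mulLin_smul, smul_eq_zero, or_iff_right hs] at h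
  have h1 := symVec_succAbove (Fin.cons l v : Fin (k + 1) → Fin 2 → ℂ) 0
  simp only [Fin.cons_zero, Fin.succAbove_zero, Fin.cons_succ, h] at h1
  refine symVec_ne_zero _ (fun i => ?_) h1
  induction i using Fin.cases with
  | zero => simpa using hl
  | succ i => simpa using hv i

theorem exists_norm_le_mulLin (k : ℕ) {l : Fin 2 → ℂ} (hl : l ≠ 0) :
    ∃ c : ℝ, 0 < c ∧ ∀ p : Fin (k + 1) → ℂ, ‖p‖ ≤ c * ‖mulLin l p‖ := by
  let T : (Fin (k + 1) → ℂ) →ₗ[ℂ] (Fin (k + 1 + 1) → ℂ) :=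
    { toFun := mulLin l
      map_add' := mulLin_add l
      map_smul' := mulLin_smul l }
  have hT : LinearMap.ker T = ⊥ := by
    rw [LinearMap.ker_eq_bot']
    exact fun p hp => eq_zero_of_mulLin_eq_zero hl hp
  obtain ⟨K, hK, hA⟩ := T.exists_antilipschitzWith hT
  refine ⟨K, hK, fun p => ?_⟩
  have := hA.le_mul_dist p 0
  rw [dist_zero_right, map_zero, dist_zero_right] at this
  exact this

theorem exists_eq_smul_symVec_norm_one {k : ℕ} (q : Fin (k + 1) → ℂ) (hq : q ≠ 0) :
    ∃ (s : ℂ) (v : Fin k → Fin 2 → ℂ), s ≠ 0 ∧ (∀ i, ‖v i‖ = 1) ∧ q = s • symVec v := by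
  obtain ⟨s, v, hs, hv, rfl⟩ := exists_eq_smul_symVec q hq
  have hn (i) : (‖v i‖ : ℂ) ≠ 0 := by exact_mod_cast norm_ne_zero_iff.2 (hv i)
  refine ⟨s * ∏ i, (‖v i‖ : ℂ), fun i => (‖v i‖ : ℂ)⁻¹ • v i,
    mul_ne_zero hs (Finset.prod_ne_zero_iff.2 fun i _ => hn i), fun i => ?_, ?_⟩
  · rw [norm_smul, norm_inv, Complex.norm_real, norm_norm,
      inv_mul_cancel₀ (norm_ne_zero_iff.2 (hv i))]
  · rw [symVec_smul, smul_smul, mul_assoc, ← Finset.prod_mul_distrib]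
    simp [hn]

/-- A linear form of norm one is close to a multiple of `l` if it almost vanishes at the zero
of `l`. -/
theorem exists_smul_sub_norm_eq (l m : Fin 2 → ℂ) (hm : ‖m‖ = 1) :
    ∃ μ : ℂ, ‖μ • m - l‖ = ‖m 0 * l 1 - m 1 * l 0‖ := by
  have key (a b : Fin 2) (hab : a ≠ b) (ha : ‖m a‖ = 1) :
      ‖(l a / m a) • m - l‖ = ‖m a * l b - m b * l a‖ := by
    have hma : m a ≠ 0 := by
      rw [← norm_ne_zero_iff, ha]
      exact one_ne_zero
    have hxa : ((l a / m a) • m - l) a = 0 := by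
      simp [div_mul_cancel₀ _ hma]
    have hxb : ‖((l a / m a) • m - l) b‖ = ‖m a * l b - m b * l a‖ := by
      have : ((l a / m a) • m - l) b = -(m a * l b - m b * l a) / m a := by
        simp only [Pi.sub_apply, Pi.smul_apply, smul_eq_mul]
        field_simp
        ring
      rw [this, norm_div, norm_neg, ha, div_one]
    apply le_antisymm
    · refine (pi_norm_le_iff_of_nonneg (norm_nonneg _)).2 fun i => ?_
      have : i = a ∨ i = b := by omega
      rcases this with rfl | rfl
      · rw [hxa, norm_zero]; exact norm_nonneg _
      · exact hxb.le
    · rw [← hxb]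
      exact norm_le_pi_norm _ b
  have hex : ‖m 0‖ = 1 ∨ ‖m 1‖ = 1 := by
    have h0 : ‖m 0‖ ≤ 1 := hm ▸ norm_le_pi_norm m 0
    have h1 : ‖m 1‖ ≤ 1 := hm ▸ norm_le_pi_norm m 1
    by_contra! hcon
    have h2 : ‖m‖ < 1 := (pi_norm_lt_iff one_pos).2 fun i => by
      fin_cases i
      · exact lt_of_le_of_ne h0 hcon.1
      · exact lt_of_le_of_ne h1 hcon.2
    exact h2.ne hm
  rcases hex with h | h
  · exact ⟨_, key 0 1 (by decide) h⟩
  · refine ⟨_, (key 1 0 (by decide) h).trans ?_⟩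
    rw [← norm_neg]
    congr 1
    ring

/-- If `p` is divisible by the linear form `l`, then a form close to `p` is divisible by a linear
form close to `l`. -/
theorem exists_near_factor {k : ℕ} {l : Fin 2 → ℂ} (hl : l ≠ 0) (p' : Fin (k + 1) → ℂ)
    (hp' : p' ≠ 0) :
    ∃ c : ℝ, 0 ≤ c ∧ ∀ᶠ q in 𝓝 (mulLin l p'), ∃ (l' : Fin 2 → ℂ) (q' : Fin (k + 1) → ℂ),
      q = mulLin l' q' ∧ ‖l' - l‖ ^ (k + 1) ≤ c * ‖q - mulLin l p'‖ := by
  set p := mulLin l p' with hp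
  have hp0 : p ≠ 0 := fun h => hp' (eq_zero_of_mulLin_eq_zero hl h)
  set x : Fin 2 → ℂ := ![l 1, -l 0] with hx
  have hpx : formEval p x = 0 := by
    rw [hp, formEval_mulLin]
    simp only [hx, Matrix.cons_val_zero, Matrix.cons_val_one]
    ring
  set c₁ : ℝ := ∑ j : Fin (k + 1 + 1), ‖x 0 ^ (k + 1 - (j : ℕ)) * x 1 ^ (j : ℕ)‖ with hc₁
  have hc₁0 : 0 ≤ c₁ := Finset.sum_nonneg fun _ _ => norm_nonneg _
  have hqx (q : Fin (k + 1 + 1) → ℂ) : ‖formEval q x‖ ≤ c₁ * ‖q - p‖ := by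
    have h1 : formEval q x = formEval (q - p) x := by
      have : formEval (q - p) x = formEval q x - formEval p x := by
        simp [formEval, sub_mul, Finset.sum_sub_distrib]
      rw [this, hpx, sub_zero]
    rw [h1, formEval, hc₁, Finset.sum_mul]
    refine (norm_sum_le _ _).trans (Finset.sum_le_sum fun j _ => ?_)
    rw [norm_mul, mul_comm]
    exact mul_le_mul_of_nonneg_left (norm_le_pi_norm (q - p) j) (norm_nonneg _)
  have hpn : 0 < ‖p‖ := norm_pos_iff.2 hp0
  set c : ℝ := c₁ * 2 ^ (k + 1) * (2 / ‖p‖) with hc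
  have hc0 : 0 ≤ c := by positivity
  refine ⟨c, hc0, ?_⟩
  have h1 : ∀ᶠ q in 𝓝 p, ‖p‖ / 2 < ‖q‖ :=
    continuous_norm.continuousAt.eventually (lt_mem_nhds (half_lt_self hpn))
  have hln : 0 < ‖l‖ := norm_pos_iff.2 hl
  have h2 : ∀ᶠ q in 𝓝 p, c * ‖q - p‖ < ‖l‖ ^ (k + 1) := by
    have hcont : Continuous fun q => c * ‖q - p‖ := by fun_prop
    refine hcont.continuousAt.eventually (gt_mem_nhds ?_)
    simp only [sub_self, norm_zero, mul_zero]
    positivity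
  filter_upwards [h1, h2] with q hq1 hq2
  have hq0 : q ≠ 0 := by
    rintro rfl
    rw [norm_zero] at hq1
    linarith
  obtain ⟨s, m, hs, hm, hqm⟩ := exists_eq_smul_symVec_norm_one q hq0
  have hsn : ‖p‖ / 2 / 2 ^ (k + 1) ≤ ‖s‖ := by
    rw [div_le_iff₀ (by positivity)]
    refine hq1.le.trans ?_
    rw [hqm, norm_smul]
    exact mul_le_mul_of_nonneg_left (norm_symVec_le m hm) (norm_nonneg _)
  obtain ⟨i, -, hi⟩ := Finset.exists_min_image Finset.univ
    (fun i => ‖m i 0 * x 0 + m i 1 * x 1‖) ⟨0, Finset.mem_univ _⟩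
  have hprod : ‖m i 0 * x 0 + m i 1 * x 1‖ ^ (k + 1) ≤ c * ‖q - p‖ := by
    have h3 : ‖m i 0 * x 0 + m i 1 * x 1‖ ^ (k + 1) ≤ ∏ j, ‖m j 0 * x 0 + m j 1 * x 1‖ := by
      have := Finset.prod_le_prod (s := Finset.univ)
        (f := fun _ : Fin (k + 1) => ‖m i 0 * x 0 + m i 1 * x 1‖)
        (g := fun j => ‖m j 0 * x 0 + m j 1 * x 1‖) (fun _ _ => norm_nonneg _)
        fun j _ => hi j (Finset.mem_univ j)
      simpa using this
    have h4 : ‖s‖ * ∏ j, ‖m j 0 * x 0 + m j 1 * x 1‖ ≤ c₁ * ‖q - p‖ := by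
      rw [← norm_prod, ← formEval_symVec, ← norm_mul, ← formEval_smul, ← hqm]
      exact hqx q
    have hspos : 0 < ‖p‖ / 2 / 2 ^ (k + 1) := by positivity
    have h5 : ∏ j, ‖m j 0 * x 0 + m j 1 * x 1‖ ≤ c * ‖q - p‖ := by
      have h6 : ‖p‖ / 2 / 2 ^ (k + 1) * ∏ j, ‖m j 0 * x 0 + m j 1 * x 1‖ ≤ c₁ * ‖q - p‖ :=
        (mul_le_mul_of_nonneg_right hsn
          (Finset.prod_nonneg fun _ _ => norm_nonneg _)).trans h4
      rw [mul_comm, ← le_div_iff₀ hspos] at h6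
      refine h6.trans (le_of_eq ?_)
      rw [hc]
      field_simp
    exact h3.trans h5
  obtain ⟨μ, hμ⟩ := exists_smul_sub_norm_eq l (m i) (hm i)
  have hdet : m i 0 * l 1 - m i 1 * l 0 = m i 0 * x 0 + m i 1 * x 1 := by
    simp only [hx, Matrix.cons_val_zero, Matrix.cons_val_one]
    ring
  rw [hdet] at hμ
  have hμ0 : μ ≠ 0 := by
    rintro rfl
    rw [zero_smul, zero_sub, norm_neg] at hμ
    rw [← hμ] at hprod
    exact absurd hprod (not_le.2 hq2)
  refine ⟨μ • m i, (s / μ) • symVec fun j => m (i.succAbove j), ?_, by rw [hμ]; exact hprod⟩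
  rw [mulLin_smul, smul_mulLin, smul_smul, div_mul_cancel₀ _ hμ0, ← symVec_succAbove]
  exact hqm

/-- A form close to a product of linear forms is a product of linear forms close to the given
ones, with a Hölder bound. -/
theorem exists_holder_symVec {k : ℕ} (v : Fin k → Fin 2 → ℂ) (hv : ∀ i, v i ≠ 0) :
    ∃ J : ℕ, 0 < J ∧ ∃ C : ℝ, 0 ≤ C ∧ ∀ᶠ q in 𝓝 (symVec v), ∃ (s : ℂ) (v' : Fin k → Fin 2 → ℂ),
      q = s • symVec v' ∧ ∀ i, ‖v' i - v i‖ ^ J ≤ C * ‖q - symVec v‖ := by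
  induction k with
  | zero =>
    refine ⟨1, one_pos, 0, le_rfl, Filter.Eventually.of_forall fun q => ⟨q 0, v, ?_, ?_⟩⟩
    · funext i
      fin_cases i
      simp [symVec_zero]
    · exact fun i => i.elim0
  | succ k ih =>
    set l := v 0 with hldef
    have hl : l ≠ 0 := hv 0
    set t : Fin k → Fin 2 → ℂ := fun j => v j.succ with ht
    obtain ⟨J, hJ, C, hC, hev⟩ := ih t fun j => hv _
    set p' := symVec t with hp'
    have hp'0 : p' ≠ 0 := symVec_ne_zero t fun j => hv _
    have hp : symVec v = mulLin l p' := by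
      rw [symVec_succAbove v 0]
      simp only [Fin.succAbove_zero, hp', ht, hldef]
    obtain ⟨c₂, hc₂, hfac⟩ := exists_near_factor hl p' hp'0
    obtain ⟨c, hc, hlow⟩ := exists_norm_le_mulLin k hl
    obtain ⟨ρ, hρ, hball⟩ := Metric.eventually_nhds_iff_ball.1 hev
    set c₆ : ℝ := 2 * c * (1 + 2 * ‖p'‖) with hc₆
    have hc₆0 : 0 ≤ c₆ := by positivity
    set c₅ : ℝ := c₆ ^ (k + 1) * (1 + c₂) with hc₅
    have hc₅0 : 0 ≤ c₅ := by positivity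
    rw [hp]
    refine ⟨J * (k + 1), by positivity, C ^ (k + 1) * c₅ + c₂ ^ J, by positivity, ?_⟩
    have hsm (a b : ℝ) (hb : 0 < b) : ∀ᶠ q in 𝓝 (mulLin l p'), a * ‖q - mulLin l p'‖ < b := by
      have hcont : Continuous fun q => a * ‖q - mulLin l p'‖ := by fun_prop
      refine hcont.continuousAt.eventually (gt_mem_nhds ?_)
      simpa using hb
    filter_upwards [hfac, hsm 1 1 one_pos, hsm c₂ ((1 / (4 * c)) ^ (k + 1)) (by positivity),
      hsm c₅ (ρ ^ (k + 1)) (by positivity)] with q hq hq1 hq2 hq3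
    rw [one_mul] at hq1
    obtain ⟨l', q', hqq', hδ⟩ := hq
    set ε := ‖q - mulLin l p'‖ with hε
    have hε0 : 0 ≤ ε := norm_nonneg _
    set δ := ‖l' - l‖ with hδdef
    have hδ0 : 0 ≤ δ := norm_nonneg _
    have hδc : δ < 1 / (4 * c) :=
      lt_of_pow_lt_pow_left₀ (k + 1) (by positivity) (hδ.trans_lt hq2)
    have hcδ : 4 * c * δ ≤ 1 := by
      rw [lt_div_iff₀ (by positivity)] at hδc
      linarith
    -- the cofactors are close
    set D := q' - p' with hD
    have hlD : mulLin l' D = (q - mulLin l p') - mulLin (l' - l) p' := by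
      have h1 : mulLin l' q' = mulLin l' D + mulLin l' p' := by
        rw [← mulLin_add, hD, sub_add_cancel]
      have h2 : mulLin l' p' = mulLin (l' - l) p' + mulLin l p' := by
        rw [← add_mulLin, sub_add_cancel]
      rw [hqq', h1, h2]
      abel
    have hD1 : ‖mulLin l D‖ ≤ ‖mulLin l' D‖ + 2 * δ * ‖D‖ := by
      have h1 : mulLin l' D = mulLin (l' - l) D + mulLin l D := by
        rw [← add_mulLin, sub_add_cancel]
      have h2 : mulLin l D = mulLin l' D - mulLin (l' - l) D := by
        rw [h1]
        abel
      rw [h2]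
      exact (norm_sub_le _ _).trans (add_le_add_right (norm_mulLin_le _ _) _)
    have hD2 : ‖mulLin l' D‖ ≤ ε + 2 * δ * ‖p'‖ := by
      rw [hlD]
      exact (norm_sub_le _ _).trans (add_le_add_right (norm_mulLin_le _ _) _)
    have hD3 : ‖D‖ ≤ 2 * c * (ε + 2 * δ * ‖p'‖) := by
      have h1 := hlow D
      have h2 : c * ‖mulLin l D‖ ≤ c * (ε + 2 * δ * ‖p'‖ + 2 * δ * ‖D‖) :=
        mul_le_mul_of_nonneg_left (by linarith) hc.le
      have h3 : 4 * c * δ * ‖D‖ ≤ 1 * ‖D‖ := mul_le_mul_of_nonneg_right hcδ (norm_nonneg _)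
      nlinarith
    have hmax : (max ε δ) ^ (k + 1) ≤ (1 + c₂) * ε := by
      rcases max_cases ε δ with h | h
      · rw [h.1]
        have : ε ^ (k + 1) ≤ ε := pow_le_of_le_one hε0 hq1.le (by omega)
        nlinarith [mul_nonneg hc₂ hε0]
      · rw [h.1]
        linarith
    have hD4 : ‖D‖ ≤ c₆ * max ε δ := by
      refine hD3.trans ?_
      have h1 : ε + 2 * δ * ‖p'‖ ≤ (1 + 2 * ‖p'‖) * max ε δ := by
        have h2 := mul_le_mul_of_nonneg_right (le_max_right ε δ)
          (by positivity : 0 ≤ 2 * ‖p'‖)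
        have h3 := le_max_left ε δ
        nlinarith
      calc 2 * c * (ε + 2 * δ * ‖p'‖) ≤ 2 * c * ((1 + 2 * ‖p'‖) * max ε δ) := by gcongr
        _ = c₆ * max ε δ := by rw [hc₆]; ring
    have hD5 : ‖D‖ ^ (k + 1) ≤ c₅ * ε := by
      calc ‖D‖ ^ (k + 1) ≤ (c₆ * max ε δ) ^ (k + 1) := by gcongr
        _ = c₆ ^ (k + 1) * (max ε δ) ^ (k + 1) := mul_pow _ _ _
        _ ≤ c₆ ^ (k + 1) * ((1 + c₂) * ε) := by gcongr
        _ = c₅ * ε := by rw [hc₅]; ring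
    have hDρ : ‖D‖ < ρ := lt_of_pow_lt_pow_left₀ (k + 1) hρ.le (hD5.trans_lt hq3)
    obtain ⟨s, v'', hq's, hv''⟩ := hball q' (by rwa [Metric.mem_ball, dist_eq_norm])
    refine ⟨s, Fin.cons l' v'', ?_, fun i => ?_⟩
    · rw [hqq', hq's, mulLin_smul, symVec_succAbove (Fin.cons l' v'') 0]
      simp
    · have hA : 0 ≤ C ^ (k + 1) * c₅ * ε := by positivity
      have hB : 0 ≤ c₂ ^ J * ε := by positivity
      induction i using Fin.cases with
      | zero =>
        simp only [Fin.cons_zero]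
        calc ‖l' - l‖ ^ (J * (k + 1)) = (δ ^ (k + 1)) ^ J := by rw [← pow_mul, mul_comm J]
          _ ≤ (c₂ * ε) ^ J := by gcongr
          _ = c₂ ^ J * ε ^ J := mul_pow _ _ _
          _ ≤ c₂ ^ J * ε := by
            gcongr
            exact pow_le_of_le_one hε0 hq1.le (by omega)
          _ ≤ (C ^ (k + 1) * c₅ + c₂ ^ J) * ε := by linarith
      | succ i =>
        simp only [Fin.cons_succ]
        calc ‖v'' i - v i.succ‖ ^ (J * (k + 1)) = (‖v'' i - v i.succ‖ ^ J) ^ (k + 1) := by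
              rw [pow_mul]
          _ ≤ (C * ‖D‖) ^ (k + 1) := by
            gcongr
            exact hv'' i
          _ = C ^ (k + 1) * ‖D‖ ^ (k + 1) := mul_pow _ _ _
          _ ≤ C ^ (k + 1) * (c₅ * ε) := by gcongr
          _ ≤ (C ^ (k + 1) * c₅ + c₂ ^ J) * ε := by linarith

/-! ### Linearizable maps -/

/-- Let `u` be an analytic map with a local right inverse satisfying a Hölder bound with exponent
`1 / J`. If `u` semiconjugates the homothety of ratio `c` to a map with differential `A`, then
`(A - c) (A - c ^ 2) ⋯ (A - c ^ J) = 0`. -/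
theorem aeval_eq_zero_of_semiconj {E V : Type*} [NormedAddCommGroup E] [NormedSpace ℂ E]
    [NormedAddCommGroup V] [NormedSpace ℂ V] {u : E → V} (hu : AnalyticAt ℂ u 0)
    {g : ℕ → V → V} {A : V →L[ℂ] V} (hg : ∀ i, HasFDerivAt (g i) (A ^ i) (u 0)) (c : ℂ)
    (hsemi : ∀ i : ℕ, ∀ᶠ h in 𝓝 (0 : E), g i (u h) = u (c ^ i • h)) {J : ℕ} {C : ℝ}
    (hC : 0 ≤ C) (hH : ∀ᶠ y in 𝓝 (u 0), ∃ h, u h = y ∧ ‖h‖ ^ J ≤ C * ‖y - u 0‖) :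
    Polynomial.aeval A (∏ j ∈ Finset.Icc 1 J, (Polynomial.X - Polynomial.C (c ^ j))) = 0 := by
  set Q : Polynomial ℂ := ∏ j ∈ Finset.Icc 1 J, (Polynomial.X - Polynomial.C (c ^ j)) with hQ
  set S := Finset.range (Q.natDegree + 1) with hS
  set Φ : V → V := fun y => ∑ i ∈ S, Q.coeff i • (g i y - u 0) with hΦ
  have hΦd : HasFDerivAt Φ (Polynomial.aeval A Q) (u 0) := by
    rw [Polynomial.aeval_eq_sum_range]
    exact HasFDerivAt.fun_sum fun i _ => ((hg i).sub_const _).fun_const_smul _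
  obtain ⟨p, hp⟩ := hu
  have hp0 (y : E) : p 0 (fun _ => y) = u 0 := hp.coeff_zero _
  have hpart (y : E) : ∑ i ∈ S, Q.coeff i • (p.partialSum (J + 1) (c ^ i • y) - u 0) = 0 := by
    have h1 (i : ℕ) : p.partialSum (J + 1) (c ^ i • y) - u 0 =
        ∑ n ∈ Finset.range J, (c ^ (n + 1)) ^ i • p (n + 1) fun _ => y := by
      rw [FormalMultilinearSeries.partialSum, Finset.sum_range_succ', hp0, add_sub_cancel_right]
      refine Finset.sum_congr rfl fun n _ => ?_
      have := (p (n + 1)).map_smul_univ (fun _ => c ^ i) fun _ => y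
      rw [this, Finset.prod_const, Finset.card_univ, Fintype.card_fin, ← pow_mul, ← pow_mul,
        mul_comm]
    simp only [h1, Finset.smul_sum]
    rw [Finset.sum_comm]
    refine Finset.sum_eq_zero fun n hn => ?_
    simp only [smul_smul]
    rw [← Finset.sum_smul, hS, ← Polynomial.eval_eq_sum_range, hQ, Polynomial.eval_prod,
      Finset.prod_eq_zero (i := n + 1), zero_smul]
    · have := Finset.mem_range.1 hn
      exact Finset.mem_Icc.2 ⟨by omega, by omega⟩
    · simp
  have hO : (fun h => Φ (u h)) =O[𝓝 0] fun h => ‖h‖ ^ (J + 1) := by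
    have h1 (i : ℕ) : (fun h : E => u (c ^ i • h) - p.partialSum (J + 1) (c ^ i • h)) =O[𝓝 0]
        fun h => ‖h‖ ^ (J + 1) := by
      have ht : Filter.Tendsto (fun h : E => c ^ i • h) (𝓝 0) (𝓝 0) := by
        have : Continuous fun h : E => c ^ i • h := by fun_prop
        simpa using this.tendsto 0
      have h2 := (hp.isBigO_sub_partialSum_pow (J + 1)).comp_tendsto ht
      simp only [Function.comp_def, zero_add] at h2
      refine h2.trans ?_
      simp only [norm_smul, mul_pow]
      exact Asymptotics.isBigO_const_mul_self _ _ _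
    have h2 : (fun h => ∑ i ∈ S, Q.coeff i •
        (u (c ^ i • h) - p.partialSum (J + 1) (c ^ i • h))) =O[𝓝 0] fun h => ‖h‖ ^ (J + 1) :=
      Asymptotics.IsBigO.fun_sum fun i _ => (h1 i).const_smul_left (Q.coeff i)
    refine h2.congr' ?_ Filter.EventuallyEq.rfl
    have h3 : ∀ᶠ h in 𝓝 (0 : E), ∀ i ∈ S, g i (u h) = u (c ^ i • h) := by
      rw [Filter.eventually_all_finset]
      exact fun i _ => hsemi i
    filter_upwards [h3] with h hh
    have h4 : Φ (u h) = ∑ i ∈ S, Q.coeff i • (u (c ^ i • h) - u 0) :=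
      Finset.sum_congr rfl fun i hi => by rw [hh i hi]
    rw [h4, ← sub_zero (∑ i ∈ S, Q.coeff i • (u (c ^ i • h) - u 0)), ← hpart h,
      ← Finset.sum_sub_distrib]
    refine Finset.sum_congr rfl fun i _ => ?_
    rw [← smul_sub]
    congr 1
    abel
  obtain ⟨K, hK, hKb⟩ := hO.exists_pos
  obtain ⟨ρ, hρ, hball⟩ := Metric.eventually_nhds_iff_ball.1 hKb.bound
  have hΦ0 : Φ (u 0) = 0 := by
    have := hball 0 (Metric.mem_ball_self hρ)
    simpa using this
  have hzero : HasFDerivAt Φ (0 : V →L[ℂ] V) (u 0) := by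
    rw [hasFDerivAt_iff_isLittleO, Asymptotics.isLittleO_iff]
    intro ε hε
    set σ : ℝ := min ρ (ε / (K * C + 1)) with hσ
    have hσ0 : 0 < σ := lt_min hρ (by positivity)
    have hsmall : ∀ᶠ y in 𝓝 (u 0), C * ‖y - u 0‖ < σ ^ J := by
      have hcont : Continuous fun y => C * ‖y - u 0‖ := by fun_prop
      refine hcont.continuousAt.eventually (gt_mem_nhds ?_)
      simp only [sub_self, norm_zero, mul_zero]
      positivity
    filter_upwards [hH, hsmall] with y hy hyσ
    obtain ⟨h, hhy, hhJ⟩ := hy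
    have hhσ : ‖h‖ < σ := lt_of_pow_lt_pow_left₀ J hσ0.le (hhJ.trans_lt hyσ)
    have hb := hball h (by
      rw [mem_ball_zero_iff]
      exact hhσ.trans_le (min_le_left _ _))
    rw [hhy, norm_pow, norm_norm] at hb
    rw [hΦ0, sub_zero, zero_apply, sub_zero]
    have hσε : K * C * σ ≤ ε := by
      have h1 : σ ≤ ε / (K * C + 1) := min_le_right _ _
      rw [le_div_iff₀ (by positivity)] at h1
      nlinarith
    calc ‖Φ y‖ ≤ K * ‖h‖ ^ (J + 1) := hb
      _ = K * ‖h‖ ^ J * ‖h‖ := by rw [pow_succ]; ring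
      _ ≤ K * (C * ‖y - u 0‖) * σ := by gcongr
      _ = K * C * σ * ‖y - u 0‖ := by ring
      _ ≤ ε * ‖y - u 0‖ := by gcongr
  exact hΦd.unique hzero

theorem aeval_apply_of_eigenvector {V : Type*} [NormedAddCommGroup V] [NormedSpace ℂ V]
    {A : V →L[ℂ] V} {μ : ℂ} {w : V} (hw : A w = μ • w) (p : Polynomial ℂ) :
    Polynomial.aeval A p w = p.eval μ • w := by
  have h (i : ℕ) : (A ^ i) w = μ ^ i • w := by
    induction i with
    | zero => simp
    | succ i ih => rw [pow_succ, mul_apply_eq_comp, hw, map_smul, ih, smul_smul,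
        pow_succ, mul_comm]
  rw [Polynomial.aeval_eq_sum_range, Polynomial.eval_eq_sum_range, Finset.sum_smul,
    sum_apply]
  refine Finset.sum_congr rfl fun i _ => ?_
  rw [smul_apply, h, smul_smul]

/-! ### Symmetric products in homogeneous coordinates -/

theorem analyticAt_symVec {E : Type*} [NormedAddCommGroup E] [NormedSpace ℂ E] {k : ℕ}
    {v : E → Fin k → Fin 2 → ℂ} {x : E} (hv : ∀ i l, AnalyticAt ℂ (fun y => v y i l) x)
    (j : Fin (k + 1)) : AnalyticAt ℂ (fun y => symVec (v y) j) x := by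
  classical
  have h (S : Finset (Fin k)) (j : ℕ) : AnalyticAt ℂ (fun y => (∏ i ∈ S,
      (Polynomial.C (v y i 0) + Polynomial.C (v y i 1) * Polynomial.X)).coeff j) x := by
    induction S using Finset.induction generalizing j with
    | empty => simpa using analyticAt_const
    | insert i S hi ih =>
      simp only [Finset.prod_insert hi, coeff_linear_mul]
      refine ((hv i 0).mul (ih j)).add ((hv i 1).mul ?_)
      split_ifs
      · exact analyticAt_const
      · exact ih _
  exact h Finset.univ j

theorem pow_mul_le_of_pow_le {a t C : ℝ} {e m : ℕ} (ha : 0 ≤ a) (ht : 0 ≤ t) (ht1 : t ≤ 1)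
    (hC : 0 ≤ C) (hm : m ≠ 0) (h : a ^ e ≤ C * t) : a ^ (e * m) ≤ C ^ m * t := by
  calc a ^ (e * m) = (a ^ e) ^ m := pow_mul _ _ _
    _ ≤ (C * t) ^ m := by gcongr
    _ = C ^ m * t ^ m := mul_pow _ _ _
    _ ≤ C ^ m * t := by
      gcongr
      exact pow_le_of_le_one ht ht1 hm

theorem pi_norm_pow_le {k M : ℕ} (hM : M ≠ 0) {h : Fin k → ℂ} {B : ℝ} (hB : 0 ≤ B)
    (hh : ∀ i, ‖h i‖ ^ M ≤ B) : ‖h‖ ^ M ≤ B := by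
  have hr : (B ^ ((M : ℝ)⁻¹)) ^ M = B := Real.rpow_inv_natCast_pow hB hM
  have hr0 : 0 ≤ B ^ ((M : ℝ)⁻¹) := Real.rpow_nonneg hB _
  rw [← hr]
  refine pow_le_pow_left₀ (norm_nonneg _) ((pi_norm_le_iff_of_nonneg hr0).2 fun i => ?_) M
  exact le_of_pow_le_pow_left₀ hM hr0 (by rw [hr]; exact hh i)

theorem norm_affineVec_sub_le {N : ℕ} (b : Fin (N + 1)) (y z : Fin N → ℂ) :
    ‖affineVec b y - affineVec b z‖ ≤ ‖y - z‖ := by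
  refine (pi_norm_le_iff_of_nonneg (norm_nonneg _)).2 ?_
  rw [Fin.forall_iff_succAbove b]
  refine ⟨by simp, fun l => ?_⟩
  simpa using norm_le_pi_norm (y - z) l

/-- The map `h ↦ η (Θ (ζ_1 + h_1), …, Θ (ζ_k + h_k))`, read in a chart, is analytic and has a
local right inverse with a Hölder bound. -/
theorem exists_holder_symMap {Θ : ℂ → PSpace 1} (hΘ : IsHolomorphicToP1 Θ)
    (hnc : ∃ z w, Θ z ≠ Θ w) {k : ℕ} (ζ : Fin k → ℂ) (b : Fin (k + 1))
    (hb : (symMap fun i => Θ (ζ i)).rep b ≠ 0) :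
    (∀ᶠ h in 𝓝 (0 : Fin k → ℂ), (symMap fun i => Θ (ζ i + h i)).rep b ≠ 0) ∧
    AnalyticAt ℂ (fun h : Fin k → ℂ => toAffine b (symMap fun i => Θ (ζ i + h i))) 0 ∧
    ∃ J : ℕ, 0 < J ∧ ∃ C : ℝ, 0 ≤ C ∧
      ∀ᶠ y in 𝓝 (toAffine b (symMap fun i => Θ (ζ i))), ∃ h : Fin k → ℂ,
        toAffine b (symMap fun i => Θ (ζ i + h i)) = y ∧
        ‖h‖ ^ J ≤ C * ‖y - toAffine b (symMap fun i => Θ (ζ i))‖ := by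
  choose g hg hΘg using fun i => hΘ (ζ i)
  choose e he Ce hCe hev using fun i => hΘ.exists_holder_preimage hnc (hg i) (hΘg i)
  set v : Fin k → Fin 2 → ℂ := fun i => g i (ζ i) with hv
  have hv0 (i) : v i ≠ 0 := (hΘg i).self_of_nhds.1
  have hΘv (i) : Θ (ζ i) = Projectivization.mk ℂ (v i) (hv0 i) := (hΘg i).self_of_nhds.2
  have hsym0 : (symMap fun i => Θ (ζ i)) =
      Projectivization.mk ℂ (symVec v) (symVec_ne_zero v hv0) := by
    simp only [hΘv]
    exact symMap_mk v hv0
  -- local lifts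
  have hshift (i : Fin k) : Filter.Tendsto (fun h : Fin k → ℂ => ζ i + h i) (𝓝 0) (𝓝 (ζ i)) := by
    have : Continuous fun h : Fin k → ℂ => ζ i + h i := by fun_prop
    simpa using this.tendsto 0
  have hlift : ∀ᶠ h in 𝓝 (0 : Fin k → ℂ), ∀ i, ∃ h0 : g i (ζ i + h i) ≠ 0,
      Θ (ζ i + h i) = Projectivization.mk ℂ (g i (ζ i + h i)) h0 := by
    rw [Filter.eventually_all]
    exact fun i => (hshift i).eventually (hΘg i)
  set q : (Fin k → ℂ) → Fin (k + 1) → ℂ := fun h => symVec fun i => g i (ζ i + h i) with hq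
  have hq0 : q 0 = symVec v := by simp [hq, hv]
  have hqa (j) : AnalyticAt ℂ (fun h => q h j) 0 := by
    refine analyticAt_symVec (fun i l => ?_) j
    have h1 : AnalyticAt ℂ (fun h : Fin k → ℂ => ζ i + h i) 0 :=
      analyticAt_const.add ((ContinuousLinearMap.proj (R := ℂ) (φ := fun _ : Fin k => ℂ)
        i).analyticAt 0)
    refine AnalyticAt.fun_comp (g := fun w => g i w l) ?_ h1
    simpa using analyticAt_apply (hg i) l
  have hsymq : ∀ᶠ h in 𝓝 (0 : Fin k → ℂ), ∃ h0 : q h ≠ 0,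
      (symMap fun i => Θ (ζ i + h i)) = Projectivization.mk ℂ (q h) h0 := by
    filter_upwards [hlift] with h hh
    choose h1 h2 using hh
    refine ⟨symVec_ne_zero _ h1, ?_⟩
    simp only [h2]
    exact symMap_mk _ h1
  have hvb : symVec v b ≠ 0 := by rwa [hsym0, rep_mk_ne_zero_iff] at hb
  have hqb : ∀ᶠ h in 𝓝 (0 : Fin k → ℂ), q h b ≠ 0 :=
    (hqa b).continuousAt.eventually_ne (by rwa [hq0])
  refine ⟨?_, ?_, ?_⟩
  · filter_upwards [hsymq, hqb] with h hh hhb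
    obtain ⟨h1, h2⟩ := hh
    rw [h2, rep_mk_ne_zero_iff]
    exact hhb
  · have h1 : AnalyticAt ℂ (fun h (l : Fin k) => q h (b.succAbove l) / q h b) 0 :=
      AnalyticAt.pi fun l => (hqa _).div (hqa b) (by rwa [hq0])
    refine h1.congr ?_
    filter_upwards [hsymq] with h hh
    obtain ⟨h2, h3⟩ := hh
    rw [h3, toAffine_mk]
  · obtain ⟨J, hJ, C, hC, hfac⟩ := exists_holder_symVec v hv0
    set z := toAffine b (symMap fun i => Θ (ζ i)) with hz
    have hvz : symVec v b • affineVec b z = symVec v := by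
      rw [hz, hsym0, toAffine_mk]
      exact smul_affineVec_div _ b hvb
    set κ := ‖symVec v b‖ with hκ
    have hκ0 : 0 ≤ κ := norm_nonneg _
    have hyq (y : Fin k → ℂ) : ‖symVec v b • affineVec b y - symVec v‖ ≤ κ * ‖y - z‖ := by
      conv_lhs => rw [← hvz]
      simp only [Pi.smul_apply, affineVec_same, smul_eq_mul, mul_one]
      rw [← smul_sub, norm_smul]
      exact mul_le_mul_of_nonneg_left (norm_affineVec_sub_le b y z) hκ0
    have hyt : Filter.Tendsto (fun y => symVec v b • affineVec b y) (𝓝 z) (𝓝 (symVec v)) := by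
      have hcont : Continuous fun y : Fin k → ℂ => symVec v b • affineVec b y :=
        (contDiff_affineVec (m := 0) b).continuous.fun_const_smul _
      have := hcont.tendsto z
      rwa [hvz] at this
    have hnear : ∀ᶠ v' in 𝓝 v, ∀ i, v' i ≠ 0 ∧ ∀ hv' : v' i ≠ 0, ∃ h : ℂ,
        Θ (ζ i + h) = Projectivization.mk ℂ (v' i) hv' ∧ ‖h‖ ^ e i ≤ Ce i * ‖v' i - v i‖ := by
      rw [Filter.eventually_all]
      intro i
      have hap : Filter.Tendsto (fun v' : Fin k → Fin 2 → ℂ => v' i) (𝓝 v) (𝓝 (v i)) :=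
        (continuous_apply i).tendsto v
      exact (hap.eventually_ne (hv0 i)).and (hap.eventually (hev i))
    obtain ⟨ρ₀, hρ₀, hball⟩ := Metric.eventually_nhds_iff_ball.1 hnear
    set ρ := min ρ₀ 1 with hρ
    have hρ0 : 0 < ρ := lt_min hρ₀ one_pos
    set M := ∏ i, e i with hM
    have hM0 : 0 < M := Finset.prod_pos fun i _ => he i
    choose m hm using fun i => Finset.dvd_prod_of_mem e (Finset.mem_univ i)
    have hm0 (i) : m i ≠ 0 := by
      intro h
      have := hm i
      rw [h, mul_zero] at this
      exact hM0.ne' this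
    set B : ℝ := ∑ i, (Ce i ^ m i) ^ J with hB
    have hBi (i) : (Ce i ^ m i) ^ J ≤ B :=
      Finset.single_le_sum (f := fun i => (Ce i ^ m i) ^ J)
        (fun i _ => pow_nonneg (pow_nonneg (hCe i) _) _) (Finset.mem_univ i)
    have hB0 : 0 ≤ B := Finset.sum_nonneg fun i _ => pow_nonneg (pow_nonneg (hCe i) _) _
    refine ⟨M * J, Nat.mul_pos hM0 hJ, B * (C * κ), by positivity, ?_⟩
    have hsmall : ∀ᶠ y in 𝓝 z, C * κ * ‖y - z‖ < ρ ^ J := by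
      have hcont : Continuous fun y => C * κ * ‖y - z‖ := by fun_prop
      refine hcont.continuousAt.eventually (gt_mem_nhds ?_)
      simp only [sub_self, norm_zero, mul_zero]
      positivity
    filter_upwards [hyt.eventually hfac, hsmall] with y hy hys
    obtain ⟨s, v', hqs, hv'⟩ := hy
    have hv'1 (i) : ‖v' i - v i‖ ^ J ≤ C * κ * ‖y - z‖ := by
      refine (hv' i).trans ?_
      rw [mul_assoc]
      exact mul_le_mul_of_nonneg_left (hyq y) hC
    have hv'2 (i) : ‖v' i - v i‖ < ρ :=
      lt_of_pow_lt_pow_left₀ J hρ0.le ((hv'1 i).trans_lt hys)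
    have hmem : v' ∈ Metric.ball v ρ₀ := by
      rw [mem_ball_iff_norm, pi_norm_lt_iff hρ₀]
      exact fun i => (hv'2 i).trans_le (min_le_left _ _)
    have hv'0 (i) : v' i ≠ 0 := (hball v' hmem i).1
    choose h hh1 hh2 using fun i => (hball v' hmem i).2 (hv'0 i)
    refine ⟨h, ?_, ?_⟩
    · simp only [hh1]
      rw [symMap_mk v' hv'0]
      have h1 : Projectivization.mk ℂ (symVec v') (symVec_ne_zero v' hv'0) = ofAffine b y := by
        rw [ofAffine_eq, eq_comm, Projectivization.mk_eq_mk_iff']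
        exact ⟨(symVec v b)⁻¹ * s, by rw [mul_smul, ← hqs, inv_smul_smul₀ hvb]⟩
      rw [h1, toAffine_ofAffine]
    · refine pi_norm_pow_le (Nat.mul_pos hM0 hJ).ne' (by positivity) fun i => ?_
      have h1 : ‖h i‖ ^ M ≤ Ce i ^ m i * ‖v' i - v i‖ := by
        rw [hM, hm i]
        exact pow_mul_le_of_pow_le (norm_nonneg _) (norm_nonneg _)
          ((hv'2 i).le.trans (min_le_right _ _)) (hCe i) (hm0 i) (hh2 i)
      calc ‖h i‖ ^ (M * J) = (‖h i‖ ^ M) ^ J := pow_mul _ _ _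
        _ ≤ (Ce i ^ m i * ‖v' i - v i‖) ^ J := by gcongr
        _ = (Ce i ^ m i) ^ J * ‖v' i - v i‖ ^ J := mul_pow _ _ _
        _ ≤ B * (C * κ * ‖y - z‖) :=
          mul_le_mul (hBi i) (hv'1 i) (by positivity) hB0
        _ = B * (C * κ) * ‖y - z‖ := by ring

/-! ### Multipliers of symmetric products of Lattès maps -/

theorem exists_iterate_eq_of_symMap_eq {k : ℕ} {φ : PSpace 1 → PSpace 1} {x : Fin k → PSpace 1}
    (h : symMap (fun i => φ (x i)) = symMap x) (i : Fin k) : ∃ r, 0 < r ∧ φ^[r] (x i) = x i := by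
  have hmem (y : Set.range x) : φ y ∈ Set.range x := by
    obtain ⟨_, j, rfl⟩ := y
    obtain ⟨l, hl⟩ := exists_eq_of_symMap_eq h j
    exact ⟨l, hl.symm⟩
  let ψ : Set.range x → Set.range x := fun y => ⟨φ y, hmem y⟩
  have hsurj : Function.Surjective ψ := by
    rintro ⟨_, j, rfl⟩
    obtain ⟨l, hl⟩ := exists_eq_of_symMap_eq h.symm j
    exact ⟨⟨x l, l, rfl⟩, Subtype.ext hl.symm⟩
  obtain ⟨r, hr, hper⟩ := Function.mem_periodicPts.1
    ((Finite.injective_iff_surjective.2 hsurj).mem_periodicPts ⟨x i, i, rfl⟩)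
  have hsemi : Function.Semiconj (Subtype.val : Set.range x → PSpace 1) ψ φ := fun _ => rfl
  refine ⟨r, hr, ?_⟩
  have h1 := hsemi.iterate_right r ⟨x i, i, rfl⟩
  rw [hper.eq] at h1
  exact h1.symm

namespace LattesData

variable {f : PSpace 1 → PSpace 1} (D : LattesData f)

theorem exists_common_periodic_lift {k n : ℕ} {x : Fin k → PSpace 1}
    (h : symMap (fun i => f^[n] (x i)) = symMap x) : ∃ (ζ : Fin k → ℂ) (r : ℕ), 0 < r ∧
      ∀ i, D.Θ (ζ i) = x i ∧ D.affine^[n * r] (ζ i) - ζ i ∈ D.L.lattice := by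
  choose r hr hper using exists_iterate_eq_of_symMap_eq h
  simp only [← Function.iterate_mul] at hper
  choose ζ s hs hζ hmem using fun i => D.exists_periodic_lift (hper i)
  refine ⟨ζ, ∏ i, r i * s i, Finset.prod_pos fun i _ => Nat.mul_pos (hr i) (hs i),
    fun i => ⟨hζ i, ?_⟩⟩
  obtain ⟨t, ht⟩ := Finset.dvd_prod_of_mem (fun i => r i * s i) (Finset.mem_univ i)
  rw [ht, ← mul_assoc, ← mul_assoc]
  exact D.affine_iterate_sub_mem (hmem i) t

/-- The multipliers of the symmetric product of a Lattès map at its periodic points are, up to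
roots, powers of the ratio of the affine map. -/
theorem exists_pow_eq_pow {k d n : ℕ} {F : PSpace k → PSpace k} (hF : IsSymProduct k f F)
    {H : Fin (k + 1) → MvPolynomial (Fin (k + 1)) ℂ} (hH : IsLift d H F) (hn : 0 < n)
    {P : PSpace k} (hP : F^[n] P = P) {ν : ℂ} (hν : (multiplierPoly (F^[n]) P).IsRoot ν) :
    ∃ r j, 0 < r ∧ 0 < j ∧ ν ^ r = D.α ^ j := by
  obtain ⟨x, rfl⟩ := symMap_surjective P
  have hx : symMap (fun i => f^[n] (x i)) = symMap x := by rw [← hF.iterate n, hP]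
  obtain ⟨ζ, r, hr, hζ⟩ := D.exists_common_periodic_lift hx
  obtain rfl : (fun i => D.Θ (ζ i)) = x := funext fun i => (hζ i).1
  set P := symMap fun i => D.Θ (ζ i) with hPdef
  set b := chartIdx P with hb
  have hb0 : P.rep b ≠ 0 := rep_chartIdx_ne_zero P
  obtain ⟨hrep, han, J, -, C, hC, hhol⟩ :=
    exists_holder_symMap D.holomorphic D.nonconstant ζ b hb0
  set u : (Fin k → ℂ) → Fin k → ℂ := fun h => toAffine b (symMap fun i => D.Θ (ζ i + h i)) with hu
  have hu0 : u 0 = toAffine b P := by simp [hu, hPdef]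
  have hfix : F^[n] (ofAffine b (u 0)) = ofAffine b (u 0) := by
    rw [hu0, ofAffine_toAffine b P hb0, hP]
  set B := fderiv ℂ (chartMap b (F^[n])) (u 0) with hB
  have hderiv (i : ℕ) : HasFDerivAt (chartMap b ((F^[n])^[r * i])) ((B ^ r) ^ i) (u 0) := by
    rw [← pow_mul]
    exact hasFDerivAt_chartMap_iterate (isLift_iterate hH n) b (u 0) hfix (r * i)
  have hsemi (i : ℕ) : ∀ᶠ h in 𝓝 (0 : Fin k → ℂ),
      chartMap b ((F^[n])^[r * i]) (u h) = u ((D.α ^ (n * r)) ^ i • h) := by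
    filter_upwards [hrep] with h hh
    rw [chartMap, hu]
    simp only
    rw [ofAffine_toAffine b _ hh, ← Function.iterate_mul, hF.iterate, ← mul_assoc]
    congr 2
    funext l
    rw [D.iterate_apply_add (D.affine_iterate_sub_mem (hζ l).2 i), pow_mul, Pi.smul_apply,
      smul_eq_mul]
  rw [← hu0] at hhol
  have hzero := aeval_eq_zero_of_semiconj han hderiv _ hsemi hC hhol
  rw [multiplierPoly_eq (isLift_iterate hH n) P hP b hb0, ← hu0, ← hB,
    ← Module.End.hasEigenvalue_iff_isRoot_charpoly] at hν
  obtain ⟨w, hw⟩ := hν.exists_hasEigenvector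
  have hBw : B w = ν • w := hw.apply_eq_smul
  have hBr : (B ^ r) w = ν ^ r • w := by
    have := aeval_apply_of_eigenvector hBw (Polynomial.X ^ r)
    simpa using this
  have h1 := aeval_apply_of_eigenvector hBr
    (∏ j ∈ Finset.Icc 1 J, (Polynomial.X - Polynomial.C ((D.α ^ (n * r)) ^ j)))
  rw [hzero, zero_apply, eq_comm, smul_eq_zero_iff_left hw.2, Polynomial.eval_prod,
    Finset.prod_eq_zero_iff] at h1
  obtain ⟨j, hj, hj0⟩ := h1
  refine ⟨r, n * r * j, hr, Nat.mul_pos (Nat.mul_pos hn hr) (Finset.mem_Icc.1 hj).1, ?_⟩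
  rw [Polynomial.eval_sub, Polynomial.eval_X, Polynomial.eval_C, sub_eq_zero] at hj0
  rw [hj0, ← pow_mul]

end LattesData

/-! ### Algebraicity of the multiplier invariants -/

/-- The complex polynomials with algebraic coefficients. -/
abbrev algebraicPolys : Subring (Polynomial ℂ) :=
  Polynomial.liftsRing (algebraMap (integralClosure ℚ ℂ) ℂ)

theorem mem_algebraicPolys_of_roots {p : Polynomial ℂ} (hp : p.Monic)
    (h : ∀ ν, p.IsRoot ν → IsAlgebraic ℚ ν) : p ∈ algebraicPolys := by
  rw [(IsAlgClosed.splits p).eq_prod_roots_of_monic hp]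
  refine Subring.multiset_prod_mem _ _ fun q hq => ?_
  obtain ⟨ν, hν, rfl⟩ := Multiset.mem_map.1 hq
  have hν : IsIntegral ℚ ν := (h ν (Polynomial.isRoot_of_mem_roots hν)).isIntegral
  exact ⟨Polynomial.X - Polynomial.C ⟨ν, hν⟩, by simp⟩

theorem monic_multiplierPoly {N : ℕ} (g : PSpace N → PSpace N) (P : PSpace N) :
    (multiplierPoly g P).Monic := LinearMap.charpoly_monic _

theorem isAlgebraic_coeff_bigSigma {N d n : ℕ} (f : HomPN N d)
    (h : ∀ P, f.toFun^[n] P = P → ∀ ν, (multiplierPoly (f.toFun^[n]) P).IsRoot ν →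
      IsAlgebraic ℚ ν) (m j : ℕ) : IsAlgebraic ℚ (((bigSigma n f).coeff m).coeff j) := by
  have hmem : bigSigma n f ∈ Polynomial.liftsRing algebraicPolys.subtype := by
    rw [bigSigma]
    refine finprod_mem_induction (· ∈ Polynomial.liftsRing algebraicPolys.subtype)
      (Subring.one_mem _) (fun _ _ => Subring.mul_mem _) fun P hP => Subring.pow_mem _ ?_ _
    exact ⟨Polynomial.X - Polynomial.C ⟨_, mem_algebraicPolys_of_roots
      (monic_multiplierPoly _ P) (h P hP)⟩, by simp⟩
  obtain ⟨q, hq⟩ := hmem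
  obtain ⟨p, hp⟩ := (q.coeff m).2
  rw [← hq]
  have : ((Polynomial.mapRingHom algebraicPolys.subtype q).coeff m).coeff j = (p.coeff j : ℂ) := by
    simp [← hp]
  rw [this]
  exact IsIntegral.isAlgebraic (p.coeff j).2

theorem eq_of_continuous_of_isAlgebraic {A : Type*} [TopologicalSpace A] [PreconnectedSpace A]
    {φ : A → ℂ} (hφ : Continuous φ) (h : ∀ a, IsAlgebraic ℚ (φ a)) (a b : A) : φ a = φ b :=
  (Algebraic.countable ℚ ℂ).isTotallyDisconnected (Set.range φ)
    (Set.range_subset_iff.2 h) (isPreconnected_range hφ) ⟨a, rfl⟩ ⟨b, rfl⟩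

end IsoSym

end

theorem mainTheorem4 {A : Type*} [TopologicalSpace A] [ConnectedSpace A] (d k : ℕ) (hd : 2 ≤ d)
    (f : A → IsoSym.HomPN 1 d) (hf : IsoSym.IsFamily f)
    (hL : ∀ a, IsoSym.IsLattes (f a).toFun) :
    ∃ F : A → IsoSym.HomPN k d,
      (∀ (a : A) (G : IsoSym.PSpace k → IsoSym.PSpace k), IsoSym.IsSymProduct k (f a).toFun G ↔ G = (F a).toFun) ∧
        IsoSym.IsFamily F ∧ IsoSym.IsIsospectral F := by
  choose S hS using fun a => IsoSym.exists_isSymProduct k (f a).isLift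
  let F : A → IsoSym.HomPN k d := fun a => ⟨S a, _, (hS a).isLift (f a).isLift⟩
  have hF : IsoSym.IsFamily F := by
    intro a₀
    obtain ⟨U, hU, G, hG, hGc⟩ := hf a₀
    exact ⟨U, hU, fun a => IsoSym.symLift k d (G a), fun a ha => (hS a).isLift (hG a ha),
      IsoSym.continuousOn_coeff_symLift k d hGc⟩
  refine ⟨F, fun a G => ⟨fun h => h.unique (hS a), fun h => h ▸ hS a⟩, hF, fun n a b => ?_⟩
  have hroot (m : ℕ) (a : A) (P : IsoSym.PSpace k) (hP : (F a).toFun^[m + 1] P = P) (ν : ℂ)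
      (hν : (IsoSym.multiplierPoly ((F a).toFun^[m + 1]) P).IsRoot ν) :
      ν ≠ 1 ∧ IsAlgebraic ℚ ν := by
    obtain ⟨D⟩ := (hL a).nonempty_data
    obtain ⟨r, j, hr, hj, hrj⟩ := D.exists_pow_eq_pow (hS a) (F a).isLift m.succ_pos hP hν
    refine ⟨?_, IsAlgebraic.of_pow hr (hrj ▸ D.isAlgebraic.pow j)⟩
    rintro rfl
    have h1 := one_lt_pow₀ (D.one_lt_norm hd (f a).isLift) hj.ne'
    rw [← norm_pow, ← hrj] at h1
    simp at h1
  have hconst (m : ℕ) : IsoSym.bigSigma (m + 1) (F a) = IsoSym.bigSigma (m + 1) (F b) := by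
    ext i j
    exact IsoSym.eq_of_continuous_of_isAlgebraic
      (IsoSym.continuous_coeff_bigSigma F hF (m + 1)
        (fun a P hP h => (hroot m a P hP 1 h).1 rfl) i j)
      (fun a => IsoSym.isAlgebraic_coeff_bigSigma (F a)
        (fun P hP ν hν => (hroot m a P hP ν hν).2) i j) a b
  funext m i j
  simp only [IsoSym.multiplierMap, IsoSym.sigmaInv, hconst]
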